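/- **Notation.** Let $\mathcal A=\{\mathcal A_j\}_{j\ge1}$, $\mathcal B=\{\mathcal B_j\}_{j\ge1}$ be even (commuting) formal variables, $\mathcal M=\{\mathcal M_{j-1/2}\}_{j\ge1}$, $\mathcal N=\{\mathcal N_{j-1/2}\}_{j\ge1}$ odd (anticommuting) formal variables, $\alpha_0^{1/2}$ an invertible even formal variable, $x$ an even and $\varphi$ an odd formal variable. All sums $\sum_j$ below run over the integers $j\ge1$. For a vector space $V$ let $V[\alpha_0^{1/2},\alpha_0^{-1/2}][[\mathcal A,\mathcal B]][\mathcal M,\mathcal N]$ be the space of all formal sums of monomials in $\mathcal A,\mathcal B,\mathcal M,\mathcal N$ with coefficients in $V[\alpha_0^{1/2},\alpha_0^{-1/2}]$; put $K=\mathbb C[\alpha_0^{1/2},\alpha_0^{-1/2}]$, $R=K[[\mathcal A,\mathcal B]][\mathcal M,\mathcal N]$ and $\mathcal S=K[x,x^{-1},\varphi][[\mathcal A,\mathcal B]][\mathcal M,\mathcal N]$. For $n\in\mathbb Z$ let $$L_n(x,\varphi)=-\Bigl(x^{n+1}\tfrac{\partial}{\partial x}+\tfrac{n+1}{2}\varphi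 x^n\tfrac{\partial}{\partial\varphi}\Bigr),\qquad G_{n-\frac12}(x,\varphi)=-x^n\Bigl(\tfrac{\partial}{\partial\varphi}-\varphi\tfrac{\partial}{\partial x}\Bigr),$$ let $(\alpha_0^{1/2})^{\mp2L_0(x,\varphi)}$ be the $R$-linear operator with $\varphi^\varepsilon x^k\mapsto(\alpha_0^{1/2})^{\pm(2k+\varepsilon)}\varphi^\varepsilon x^k$, and let $D=\frac{\partial}{\partial\varphi}+\varphi\frac{\partial}{\partial x}$. A pair $(\tilde x,\tilde\varphi)\in\mathcal S^0\oplus\mathcal S^1$ is superconformal if $D\tilde x=\tilde\varphi D\tilde\varphi$ and $D\tilde\varphi\ne0$. Operators act on pairs componentwise. Let $I(x,\varphi)=(1/x,i\varphi/x)$, $$H^{(1)}=\exp\Bigl(-\sum_j(\mathcal A_jL_j+\mathcal M_{j-\frac12}G_{j-\frac12})\Bigr)\cdot(\alpha_0^{1/2})^{-2L_0}\cdot(x,\varphi),$$ $$H^{(2)}=\exp\Bigl(\sum_j(\mathcal B_jL_{-j}+\mathcal N_{j-\frac12}G_{-j+\frac12})\Bigr)\cdot I(x,\varphi),$$ and let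 $(H^{(2)})^{-1}$ be the compositional inverse. **The series $\bar F^{(1)},\bar F^{(2)}$.** There is exactly one pair $(\bar F^{(1)},\bar F^{(2)})$ of superconformal pairs of series such that: both components of $\bar F^{(1)}$ have, for each monomial in $\mathcal A,\mathcal B,\mathcal M,\mathcal N$, a coefficient in $xK[x^{-1},\varphi]$, and those of $\bar F^{(2)}$ a coefficient in $xK[x]\oplus\varphi K[x]$; the boundary conditions $$\bar F^{(1)}|_{(\mathcal A,\mathcal M)=0}=(\alpha_0^{1/2})^{-2L_0}\exp\Bigl(-\sum_j(\mathcal B_jL_{-j}+\mathcal N_{j-\frac12}G_{-j+\frac12})\Bigr)(\alpha_0^{1/2})^{2L_0}\cdot(x,\varphi),\quad \bar F^{(1)}|_{(\mathcal B,\mathcal N)=0}=(x,\varphi),$$ $$\bar F^{(2)}|_{(\mathcal A,\mathcal M)=0}=(\alpha_0^{-1}x,\alpha_0^{-1/2}\varphi),\quad \bar F^{(2)}|_{(\mathcal B,\mathcal N)=0}=(\alpha_0^{1/2})^{2L_0}\exp\Bigl(\sum_j(\mathcal A_jL_j+\mathcal M_{j-\frac12}G_{j-\frac12})\Bigr)\cdot(x,\varphi)$$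 hold; $\varphi\bar F^{(1)}-\varphi\bar F^{(1)}|_{(\mathcal A,\mathcal M)=0}$ contains no positive powers of $x$; and the formal sewing equation $\bar F^{(1)}=\bar F^{(2)}\circ(H^{(2)})^{-1}\circ I\circ H^{(1)}$ holds. **The coefficients $\Psi$.** There are unique sequences $\Psi_j\in R^0$, $\Psi_{j-\frac12}\in R^1$, $j\in\mathbb Z$, such that $$\bar F^{(1)}=\exp\Bigl(\sum_j(\Psi_{-j}L_{-j}+\Psi_{-j+\frac12}G_{-j+\frac12})\Bigr)\cdot(x,\varphi),$$ $$\bar F^{(2)}=\exp(-\Psi_0\,2L_0)\cdot(\alpha_0^{1/2})^{2L_0}\cdot\exp\Bigl(-\sum_j(\Psi_jL_j+\Psi_{j-\frac12}G_{j-\frac12})\Bigr)\cdot(x,\varphi).$$ **Proposition.** (1) For all $j\ge1$, $$\Psi_j=-\mathcal A_j+\mathcal P_j,\quad \Psi_{j-\frac12}=-\mathcal M_{j-\frac12}+\mathcal P_{j-\frac12},\quad \Psi_{-j}=-\alpha_0^{-j}\mathcal B_j+\mathcal P_{-j},\quad \Psi_{-j+\frac12}=-\alpha_0^{-j+\frac12}\mathcal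 N_{j-\frac12}+\mathcal P_{-j+\frac12},\quad \Psi_0=\mathcal P_0,$$ where each $\mathcal P$ contains only terms of total degree at least one in the $\mathcal A_k,\mathcal M_{k-\frac12}$ and of total degree at least one in the $\mathcal B_k,\mathcal N_{k-\frac12}$. (2) The operators $\exp(\sum_j(\Psi_{-j}L_{-j}+\Psi_{-j+\frac12}G_{-j+\frac12}))$ and $\exp(\sum_j(\Psi_jL_j+\Psi_{j-\frac12}G_{j-\frac12}))$ are well defined and belong to the even part of the algebra $(\operatorname{End}\mathbb C[x,x^{-1},\varphi])[\alpha_0^{1/2},\alpha_0^{-1/2}][[\mathcal A,\mathcal B]][\mathcal M,\mathcal N]$, and so do the other exponentials in (3). (3) As operators on $\mathcal S$, $$\exp\Bigl(-\sum_j(\mathcal A_jL_j+\mathcal M_{j-\frac12}G_{j-\frac12})\Bigr)\cdot(\alpha_0^{1/2})^{-2L_0}\cdot\exp\Bigl(-\sum_j(\mathcal B_jL_{-j}+\mathcal N_{j-\frac12}G_{-j+\frac12})\Bigr)$$ $$=\exp\Bigl(\sum_j(\Psi_{-j}L_{-j}+\Psi_{-j+\frac12}G_{-j+\frac12})\Bigr)\cdot\exp\Bigl(\sum_j(\Psi_jL_j+\Psi_{j-\frac12}G_{j-\frac12})\Bigr)\cdot(\alpha_0^{1/2})^{-2L_0}\cdot\exp(\Psi_0\,2L_0).$$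 -/

import Mathlib

namespace NSNormalOrder

/-- Formal sums `∑ s, f s · ζ_s` over the finite sets `s` of anticommuting variables indexed by the
linearly ordered type `O`, where `ζ_s` is the product of the variables in `s` in increasing order. -/
def SuperSeries (O : Type*) (Q : Type*) := Finset O → Q

namespace SuperSeries
variable {O : Type*} {Q : Type*}

instance [AddCommGroup Q] : AddCommGroup (SuperSeries O Q) :=
  inferInstanceAs (AddCommGroup (Finset O → Q))

instance [AddCommGroup Q] [Module ℂ Q] : Module ℂ (SuperSeries O Q) :=
  inferInstanceAs (Module ℂ (Finset O → Q))

end SuperSeries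

/-- The number of transpositions needed to sort `ζ_s ζ_t`. -/
def inversions {O : Type*} [LinearOrder O] (s t : Finset O) : ℕ :=
  ((s ×ˢ t).filter fun p => p.2 < p.1).card

/-- For disjoint `s`, `t`: `ζ_s ζ_t = sgn s t · ζ_{s ∪ t}`. -/
def sgn {O : Type*} [LinearOrder O] (s t : Finset O) : ℤ := (-1) ^ inversions s t

theorem sgn_union_left {O : Type*} [LinearOrder O] {s t : Finset O} (u : Finset O)
    (h : Disjoint s t) : sgn (s ∪ t) u = sgn s u * sgn t u := by
  unfold sgn inversions
  rw [← pow_add, Finset.union_product, Finset.filter_union, Finset.card_union_of_disjoint]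
  apply Finset.disjoint_filter_filter
  exact Finset.disjoint_product.2 (Or.inl h)

theorem sgn_union_right {O : Type*} [LinearOrder O] (s : Finset O) {t u : Finset O}
    (h : Disjoint t u) : sgn s (t ∪ u) = sgn s t * sgn s u := by
  unfold sgn inversions
  rw [← pow_add, Finset.product_union, Finset.filter_union, Finset.card_union_of_disjoint]
  apply Finset.disjoint_filter_filter
  exact Finset.disjoint_product.2 (Or.inr h)

namespace SuperSeries
variable {O : Type*} {Q : Type*} [LinearOrder O] [CommRing Q]

/-- The Grassmann product, with `ζ_i ζ_j = - ζ_j ζ_i` and `ζ_i ^ 2 = 0`. -/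
def mul (f g : SuperSeries O Q) : SuperSeries O Q :=
  fun u => ∑ s ∈ u.powerset, sgn s (u \ s) • (f s * g (u \ s))

instance : Mul (SuperSeries O Q) := ⟨mul⟩

instance : One (SuperSeries O Q) := ⟨fun s => if s = ∅ then 1 else 0⟩

theorem mul_def (f g : SuperSeries O Q) (u : Finset O) :
    (f * g) u = ∑ s ∈ u.powerset, sgn s (u \ s) • (f s * g (u \ s)) := rfl

theorem one_def (s : Finset O) : (1 : SuperSeries O Q) s = if s = ∅ then 1 else 0 := rfl

protected theorem mul_assoc' (f g h : SuperSeries O Q) : f * g * h = f * (g * h) := by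
  funext u
  simp only [mul_def, Finset.sum_mul, Finset.mul_sum, Finset.smul_sum]
  rw [Finset.sum_sigma', Finset.sum_sigma']
  refine Finset.sum_bij' (fun p _ => ⟨p.2, p.1 \ p.2⟩) (fun p _ => ⟨p.1 ∪ p.2, p.1⟩) ?_ ?_ ?_ ?_ ?_
  · rintro ⟨s, t⟩ hp
    simp only [Finset.mem_sigma, Finset.mem_powerset] at hp ⊢
    exact ⟨hp.2.trans hp.1, Finset.sdiff_subset_sdiff hp.1 le_rfl⟩
  · rintro ⟨t, w⟩ hp
    simp only [Finset.mem_sigma, Finset.mem_powerset] at hp ⊢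
    exact ⟨Finset.union_subset hp.1 (hp.2.trans Finset.sdiff_subset), Finset.subset_union_left⟩
  · rintro ⟨s, t⟩ hp
    simp only [Finset.mem_sigma, Finset.mem_powerset] at hp
    simp [Finset.union_sdiff_of_subset hp.2]
  · rintro ⟨t, w⟩ hp
    simp only [Finset.mem_sigma, Finset.mem_powerset] at hp
    have hd : Disjoint w t := Finset.disjoint_of_subset_left hp.2 Finset.sdiff_disjoint
    have : (t ∪ w) \ t = w := by
      rw [Finset.union_sdiff_left, Finset.sdiff_eq_self_of_disjoint hd]
    simp [this]
  · rintro ⟨s, t⟩ hp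
    simp only [Finset.mem_sigma, Finset.mem_powerset] at hp
    obtain ⟨hs, ht⟩ := hp
    have e1 : (u \ t) \ (s \ t) = u \ s := by
      ext a; simp only [Finset.mem_sdiff]
      constructor
      · rintro ⟨⟨h1, h2⟩, h3⟩; exact ⟨h1, fun h => h3 ⟨h, h2⟩⟩
      · rintro ⟨h1, h2⟩; exact ⟨⟨h1, fun h => h2 (ht h)⟩, fun h => h2 h.1⟩
    have e2 : u \ t = (s \ t) ∪ (u \ s) := by
      ext a; simp only [Finset.mem_sdiff, Finset.mem_union]
      constructor
      · rintro ⟨h1, h2⟩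
        by_cases h : a ∈ s
        · exact Or.inl ⟨h, h2⟩
        · exact Or.inr ⟨h1, h⟩
      · rintro (⟨h1, h2⟩ | ⟨h1, h2⟩)
        · exact ⟨hs h1, h2⟩
        · exact ⟨h1, fun h => h2 (ht h)⟩
    have e3 : sgn s (u \ s) = sgn t (u \ s) * sgn (s \ t) (u \ s) := by
      rw [← sgn_union_left _ Finset.disjoint_sdiff, Finset.union_sdiff_of_subset ht]
    have e4 : sgn t (u \ t) = sgn t (s \ t) * sgn t (u \ s) := by
      rw [e2, sgn_union_right]
      exact Finset.disjoint_of_subset_left Finset.sdiff_subset Finset.disjoint_sdiff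
    simp only [e1, e3, e4, zsmul_eq_mul]
    push_cast
    ring

instance : Ring (SuperSeries O Q) where
  __ := (inferInstance : AddCommGroup (SuperSeries O Q))
  mul_assoc := SuperSeries.mul_assoc'
  one_mul f := by
    funext u
    rw [mul_def, Finset.sum_eq_single ∅]
    · simp [one_def, sgn, inversions]
    · intro s _ hs; simp [one_def, hs]
    · simp
  mul_one f := by
    funext u
    rw [mul_def, Finset.sum_eq_single u]
    · simp [one_def, sgn, inversions]
    · intro s hs hne
      have : u \ s ≠ ∅ := fun h =>
        hne (Finset.Subset.antisymm (Finset.mem_powerset.1 hs) (Finset.sdiff_eq_empty_iff_subset.1 h))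
      simp [one_def, this]
    · simp
  left_distrib f g h := by
    funext u
    change _ = (f * g) u + (f * h) u
    simp only [mul_def, ← Finset.sum_add_distrib]
    refine Finset.sum_congr rfl fun s _ => ?_
    change sgn s (u \ s) • (f s * (g (u \ s) + h (u \ s))) = _
    rw [mul_add, smul_add]
  right_distrib f g h := by
    funext u
    change _ = (f * h) u + (g * h) u
    simp only [mul_def, ← Finset.sum_add_distrib]
    refine Finset.sum_congr rfl fun s _ => ?_
    change sgn s (u \ s) • ((f s + g s) * h (u \ s)) = _
    rw [add_mul, smul_add]
  zero_mul f := by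
    funext u
    rw [mul_def]
    refine Finset.sum_eq_zero fun s _ => ?_
    change sgn s (u \ s) • ((0 : Q) * f (u \ s)) = 0
    simp
  mul_zero f := by
    funext u
    rw [mul_def]
    refine Finset.sum_eq_zero fun s _ => ?_
    change sgn s (u \ s) • (f s * (0 : Q)) = 0
    simp

end SuperSeries

open Filter

/-- `ℂ[α₀^{1/2}, α₀^{-1/2}]`; the element `LaurentPolynomial.T n` is `(α₀^{1/2})^n`. -/
abbrev AlphaRing := LaurentPolynomial ℂ

/-- Indices of the even variables: `inl j` is `𝒜_j` and `inr j` is `ℬ_j`, for `j ≥ 1`. -/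
abbrev EvenVar := ℕ+ ⊕ ℕ+

/-- Indices of the odd variables: `inl j` is `ℳ_{j-1/2}` and `inr j` is `𝒩_{j-1/2}`, for `j ≥ 1`. -/
abbrev OddVar := ℕ+ ⊕ₗ ℕ+

/-- The odd variables together with `φ`, which is the bottom element, so that `φ` stands to the left
of all other odd variables in every ordered monomial. -/
def OddVarPhi := WithBot OddVar

instance : LinearOrder OddVarPhi := inferInstanceAs (LinearOrder (WithBot OddVar))

instance : OrderBot OddVarPhi := inferInstanceAs (OrderBot (WithBot OddVar))

/-- The inclusion of the odd variables other than `φ`. -/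
def oddEmb : OddVar ↪ OddVarPhi := (Function.Embedding.coeWithBot : OddVar ↪ WithBot OddVar)

/-- `ℂ[α₀^{1/2}, α₀^{-1/2}][x, x⁻¹]`. -/
abbrev XRing := LaurentPolynomial AlphaRing

/-- `ℂ[x, x⁻¹, φ][α₀^{1/2}, α₀^{-1/2}][[𝒜, ℬ]][ℳ, 𝒩]`: all formal sums of monomials in the variables
`𝒜, ℬ, ℳ, 𝒩` with coefficients in `ℂ[α₀^{1/2}, α₀^{-1/2}][x, x⁻¹, φ]`. -/
abbrev Ser := SuperSeries OddVarPhi (MvPowerSeries EvenVar XRing)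

noncomputable section

/-- The index of `ℳ_{j-1/2}`. -/
def idxM (j : ℕ+) : OddVarPhi := oddEmb (toLex (Sum.inl j))

/-- The index of `𝒩_{j-1/2}`. -/
def idxN (j : ℕ+) : OddVarPhi := oddEmb (toLex (Sum.inr j))

/-- The coefficient in `ℂ[α₀^{1/2}, α₀^{-1/2}]` of `x^k ζ_s` times the monomial in `𝒜, ℬ` with
exponent vector `e`. -/
def coef (f : Ser) (s : Finset OddVarPhi) (e : EvenVar →₀ ℕ) (k : ℤ) : AlphaRing :=
  (MvPowerSeries.coeff e (f s)).coeff k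

/-- The series `q · ζ_s`. -/
def mono (s : Finset OddVarPhi) (q : MvPowerSeries EvenVar XRing) : Ser :=
  fun t => if t = s then q else 0

/-- An element of `ℂ[α₀^{1/2}, α₀^{-1/2}]` as a series. -/
def ofAlpha (c : AlphaRing) : Ser := mono ∅ (MvPowerSeries.C (LaurentPolynomial.C c))

/-- `(α₀^{1/2})^n`. -/
def alpha (n : ℤ) : Ser := ofAlpha (LaurentPolynomial.T n)

/-- `x^k`. -/
def xpow (k : ℤ) : Ser := mono ∅ (MvPowerSeries.C (LaurentPolynomial.T k))

/-- `φ`. -/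
def phi : Ser := mono {⊥} 1

/-- `𝒜_j`. -/
def varA (j : ℕ+) : Ser := mono ∅ (MvPowerSeries.X (Sum.inl j))

/-- `ℬ_j`. -/
def varB (j : ℕ+) : Ser := mono ∅ (MvPowerSeries.X (Sum.inr j))

/-- `ℳ_{j-1/2}`. -/
def varM (j : ℕ+) : Ser := mono {idxM j} 1

/-- `𝒩_{j-1/2}`. -/
def varN (j : ℕ+) : Ser := mono {idxN j} 1

/-- The pair `(x, φ)`. -/
def xphi : Ser × Ser := (xpow 1, phi)

/-- The series is even: every monomial contains an even number of odd variables (`φ` included). -/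
def IsEvenSer (f : Ser) : Prop := ∀ s, f s ≠ 0 → Even s.card

/-- The series is odd. -/
def IsOddSer (f : Ser) : Prop := ∀ s, f s ≠ 0 → Odd s.card

/-- The series involves neither `x` nor `φ`, i.e. it belongs to
`R = ℂ[α₀^{1/2}, α₀^{-1/2}][[𝒜, ℬ]][ℳ, 𝒩]`. -/
def IsScalar (f : Ser) : Prop := ∀ s e k, coef f s e k ≠ 0 → ⊥ ∉ s ∧ k = 0

/-- `∑ c_k x^k ↦ ∑ a_k c_k x^(k+n)`. -/
def laurentMap (a : ℤ → AlphaRing) (n : ℤ) (p : XRing) : XRing :=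
  p.coeff.sum fun k c => AddMonoidAlgebra.single (k + n) (a k * c)

/-- `∂/∂x`. -/
def dx (u : Ser) : Ser :=
  fun s => fun e => laurentMap (fun k => (k : AlphaRing)) (-1) (MvPowerSeries.coeff e (u s))

/-- The left derivative `∂/∂φ`, i.e. `φ ζ_s ↦ ζ_s` and `ζ_s ↦ 0` if `φ` does not occur in `ζ_s`. -/
def dphi (u : Ser) : Ser := fun s => if ⊥ ∈ s then 0 else u (insert ⊥ s)

/-- `D = ∂/∂φ + φ ∂/∂x`. -/
def superD (u : Ser) : Ser := dphi u + phi * dx u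

/-- `L_j(x,φ) = -(x^{j+1} ∂/∂x + ((j+1)/2) φ x^j ∂/∂φ)`. -/
def opL (j : ℤ) (u : Ser) : Ser :=
  -(xpow (j + 1) * dx u + (((j : ℂ) + 1) / 2) • (phi * xpow j * dphi u))

/-- `G_{j-1/2}(x,φ) = -x^j (∂/∂φ - φ ∂/∂x)`. -/
def opG (j : ℤ) (u : Ser) : Ser := -(xpow j * (dphi u - phi * dx u))

/-- `(α₀^{1/2})^{-2 n L_0(x,φ)}`: it multiplies `φ^ε x^k` by `(α₀^{1/2})^{n (2k + ε)}`. -/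
def scale (n : ℤ) (u : Ser) : Ser :=
  fun s => fun e => laurentMap
    (fun k => LaurentPolynomial.T (n * (2 * k + if ⊥ ∈ s then 1 else 0))) 0
    (MvPowerSeries.coeff e (u s))

/-- The partial sums `∑_{1 ≤ j ≤ J} (c_j L_j(x,φ) + d_j G_{j-1/2}(x,φ))`. -/
def posOp (c d : ℕ+ → Ser) (J : ℕ+) (u : Ser) : Ser :=
  ∑ j ∈ Finset.Icc 1 J, (c j * opL (j : ℕ) u + d j * opG (j : ℕ) u)

/-- The partial sums `∑_{1 ≤ j ≤ J} (c_j L_{-j}(x,φ) + d_j G_{-j+1/2}(x,φ))`; note that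
`-j + 1/2 = (1 - j) - 1/2`. -/
def negOp (c d : ℕ+ → Ser) (J : ℕ+) (u : Ser) : Ser :=
  ∑ j ∈ Finset.Icc 1 J, (c j * opL (-((j : ℕ) : ℤ)) u + d j * opG (1 - (j : ℕ)) u)

/-- The operator `c · 2 L_0(x,φ)`, as a constant sequence of partial sums. -/
def zeroOp (c : Ser) (_ : ℕ+) (u : Ser) : Ser := c * ((2 : ℂ) • opL 0 u)

/-- `exp(T) · u = v`, where `T` is the formal limit of the operators `T J` as `J → ∞`: every
coefficient of `∑_{n < N} (T J)^n u / n!` is equal to that of `v` as soon as `N` and `J` are large. -/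
def HasExp (T : ℕ+ → Ser → Ser) (u v : Ser) : Prop :=
  ∀ s e k, ∀ᶠ p : ℕ × ℕ+ in atTop,
    coef (∑ n ∈ Finset.range p.1, ((n.factorial : ℂ)⁻¹) • (T p.2)^[n] u) s e k = coef v s e k

/-- `exp(T) · (u₀, u₁) = (v₀, v₁)`. -/
def HasExpPair (T : ℕ+ → Ser → Ser) (u v : Ser × Ser) : Prop :=
  HasExp T u.1 v.1 ∧ HasExp T u.2 v.2

/-- `E` is the operator `exp(T)` on all of `Ser`. -/
def IsExp (T : ℕ+ → Ser → Ser) (E : Ser → Ser) : Prop := ∀ u, HasExp T u (E u)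

/-- `scale` on pairs. -/
def scalePair (n : ℤ) (u : Ser × Ser) : Ser × Ser := (scale n u.1, scale n u.2)

/-- `X^k` for an integer `k` and an invertible `X`. -/
def ipow (X : Ser) : ℤ → Ser
  | Int.ofNat n => X ^ n
  | Int.negSucc n => Ring.inverse X ^ (n + 1)

/-- The value `p(X)` of a Laurent polynomial `p(x)`. -/
def evalX (p : XRing) (X : Ser) : Ser := p.coeff.sum fun k c => ofAlpha c * ipow X k

/-- If `p(x) + φ q(x)` is the coefficient in `F` of the monomial `m` in `𝒜, ℬ, ℳ, 𝒩` given by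
`(t, a)`, then this is `(p(X) + Φ q(X)) m`. -/
def compTerm (F X Φ : Ser) (t : Finset OddVarPhi) (a : EvenVar →₀ ℕ) : Ser :=
  (evalX (MvPowerSeries.coeff a (F t)) X
    + Φ * evalX (MvPowerSeries.coeff a (F (insert ⊥ t))) X) * mono t (MvPowerSeries.monomial a 1)

/-- The substitution `F(X, Φ)`: the sum of all `compTerm F X Φ t a` with `φ` not in `t`. Only the
terms whose monomial divides a given monomial contribute to the coefficient of the latter. -/
def substSer (F X Φ : Ser) : Ser :=
  fun s => fun e => ∑ t ∈ (s.erase ⊥).powerset, ∑ a ∈ Finset.Iic e,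
    MvPowerSeries.coeff e (compTerm F X Φ t a s)

/-- The composition `F ∘ H` of pairs of series in `(x, φ)`. -/
def comp (F H : Ser × Ser) : Ser × Ser := (substSer F.1 H.1 H.2, substSer F.2 H.1 H.2)

/-- `I(x, φ) = (1/x, iφ/x)`. -/
def inversionI : Ser × Ser := (xpow (-1), Complex.I • (phi * xpow (-1)))

/-- The even/odd pair `H(x,φ) = (x̃, φ̃)` is superconformal: `D x̃ = φ̃ D φ̃`, with `D φ̃ ≠ 0`. -/
def IsSuperconformal (H : Ser × Ser) : Prop :=
  IsEvenSer H.1 ∧ IsOddSer H.2 ∧ superD H.1 = H.2 * superD H.2 ∧ superD H.2 ≠ 0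

/-- The monomial contains one of the `𝒜_j` or `ℳ_{j-1/2}`. -/
def HasAM (s : Finset OddVarPhi) (e : EvenVar →₀ ℕ) : Prop :=
  ∃ j, idxM j ∈ s ∨ e (Sum.inl j) ≠ 0

/-- The monomial contains one of the `ℬ_j` or `𝒩_{j-1/2}`. -/
def HasBN (s : Finset OddVarPhi) (e : EvenVar →₀ ℕ) : Prop :=
  ∃ j, idxN j ∈ s ∨ e (Sum.inr j) ≠ 0

open Classical in
/-- `F` at `(𝒜, ℳ) = 0`. -/
def setAMZero (F : Ser) : Ser :=
  fun s => fun e => if HasAM s e then 0 else MvPowerSeries.coeff e (F s)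

open Classical in
/-- `F` at `(ℬ, 𝒩) = 0`. -/
def setBNZero (F : Ser) : Ser :=
  fun s => fun e => if HasBN s e then 0 else MvPowerSeries.coeff e (F s)

/-- `F` contains only terms of degree at least one in the `𝒜`'s and `ℳ`'s and of degree at least one
in the `ℬ`'s and `𝒩`'s. -/
def IsMixed (F : Ser) : Prop := ∀ s e k, coef F s e k ≠ 0 → HasAM s e ∧ HasBN s e

/-- `H` is the series
`H⁽¹⁾ = exp(-∑ (𝒜_j L_j + ℳ_{j-1/2} G_{j-1/2})) · (α₀^{1/2})^{-2L_0} · (x, φ)`. -/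
def IsH1 (H : Ser × Ser) : Prop :=
  HasExpPair (posOp (fun j => -varA j) (fun j => -varM j)) (scalePair 1 xphi) H

/-- `H` is the series `H⁽²⁾ = exp(∑ (ℬ_j L_{-j} + 𝒩_{j-1/2} G_{-j+1/2})) · (1/x, iφ/x)`. -/
def IsH2 (H : Ser × Ser) : Prop := HasExpPair (negOp varB varN) inversionI H

/-- The formal sewing equation `F⁽¹⁾ = F⁽²⁾ ∘ (H⁽²⁾)⁻¹ ∘ I ∘ H⁽¹⁾`. -/
def SewingEquation (F₁ F₂ : Ser × Ser) : Prop :=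
  ∃ H₁ H₂ K₂ : Ser × Ser, IsH1 H₁ ∧ IsH2 H₂ ∧
    (IsEvenSer K₂.1 ∧ IsOddSer K₂.2 ∧ comp H₂ K₂ = xphi ∧ comp K₂ H₂ = xphi) ∧
    F₁ = comp F₂ (comp K₂ (comp inversionI H₁))

/-- The component belongs to `x ℂ[α₀^{1/2}, α₀^{-1/2}][x⁻¹, φ][[𝒜, ℬ]][ℳ, 𝒩]`. -/
def InftySpace (f : Ser) : Prop := ∀ s e k, coef f s e k ≠ 0 → k ≤ 1

/-- Every monomial in `𝒜, ℬ, ℳ, 𝒩` has a coefficient in `x K[x] ⊕ φ K[x]`, where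
`K = ℂ[α₀^{1/2}, α₀^{-1/2}]`. -/
def ZeroSpace (f : Ser) : Prop :=
  ∀ s e k, coef f s e k ≠ 0 → 0 ≤ k ∧ (⊥ ∉ s → 1 ≤ k)

/-- In `φ f - φ f|_{(𝒜,ℳ)=0}` only nonpositive powers of `x` occur. -/
def InftyNormalized (f : Ser) : Prop :=
  ∀ s e k, ⊥ ∉ s → 1 ≤ k → coef f s e k = coef (setAMZero f) s e k

/-- `(F⁽¹⁾, F⁽²⁾)` is the solution of the formal sewing equation together with the formal boundary
conditions and the normalization. -/
structure IsSewingSolution (F : (Ser × Ser) × (Ser × Ser)) : Prop where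
  space₁ : InftySpace F.1.1 ∧ InftySpace F.1.2
  space₂ : ZeroSpace F.2.1 ∧ ZeroSpace F.2.2
  superconformal₁ : IsSuperconformal F.1
  superconformal₂ : IsSuperconformal F.2
  /-- `F⁽¹⁾|_{(𝒜,ℳ)=0} = (α₀^{1/2})^{-2L_0} exp(-∑(ℬ_j L_{-j} + 𝒩_{j-1/2} G_{-j+1/2}))
  (α₀^{1/2})^{2L_0} (x,φ)` -/
  boundary₁ : ∃ U, HasExpPair (negOp (fun j => -varB j) (fun j => -varN j)) (scalePair (-1) xphi) U ∧
    (setAMZero F.1.1, setAMZero F.1.2) = scalePair 1 U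
  boundary₁' : (setBNZero F.1.1, setBNZero F.1.2) = xphi
  boundary₂' : (setAMZero F.2.1, setAMZero F.2.2) = (alpha (-2) * xpow 1, alpha (-1) * phi)
  /-- `F⁽²⁾|_{(ℬ,𝒩)=0} = (α₀^{1/2})^{2L_0} exp(∑(𝒜_j L_j + ℳ_{j-1/2} G_{j-1/2})) (x,φ)` -/
  boundary₂ : ∃ U, HasExpPair (posOp varA varM) xphi U ∧
    (setBNZero F.2.1, setBNZero F.2.2) = scalePair (-1) U
  normalized : InftyNormalized F.1.1 ∧ InftyNormalized F.1.2
  sewing : SewingEquation F.1 F.2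

/-- A pair of sequences: `even j` is `Ψ_j` and `odd j` is `Ψ_{j-1/2}`, for all integers `j`. -/
structure PsiSeq where
  even : ℤ → Ser
  odd : ℤ → Ser

/-- The partial sums of `∑_{j ≥ 1} (Ψ_{-j} L_{-j}(x,φ) + Ψ_{-j+1/2} G_{-j+1/2}(x,φ))`. -/
def psiNeg (Ψ : PsiSeq) : ℕ+ → Ser → Ser :=
  negOp (fun j => Ψ.even (-((j : ℕ) : ℤ))) (fun j => Ψ.odd (1 - (j : ℕ)))

/-- The partial sums of `∑_{j ≥ 1} (Ψ_j L_j(x,φ) + Ψ_{j-1/2} G_{j-1/2}(x,φ))`. -/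
def psiPos (Ψ : PsiSeq) : ℕ+ → Ser → Ser :=
  posOp (fun j => Ψ.even (j : ℕ)) (fun j => Ψ.odd (j : ℕ))

/-- The sequences `Ψ` lie in `R` (with the right parities) and are the exponential coordinates of
`(F⁽¹⁾, F⁽²⁾)`:
`F⁽¹⁾ = exp(∑ (Ψ_{-j} L_{-j} + Ψ_{-j+1/2} G_{-j+1/2})) · (x, φ)` and
`F⁽²⁾ = exp(-Ψ_0 2L_0) · (α₀^{1/2})^{2L_0} · exp(-∑ (Ψ_j L_j + Ψ_{j-1/2} G_{j-1/2})) · (x, φ)`. -/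
structure IsPsi (F : (Ser × Ser) × (Ser × Ser)) (Ψ : PsiSeq) : Prop where
  even : ∀ j, IsScalar (Ψ.even j) ∧ IsEvenSer (Ψ.even j)
  odd : ∀ j, IsScalar (Ψ.odd j) ∧ IsOddSer (Ψ.odd j)
  eq₁ : HasExpPair (psiNeg Ψ) xphi F.1
  eq₂ : ∃ U, HasExpPair (fun J u => -psiPos Ψ J u) xphi U ∧
    HasExpPair (zeroOp (-Ψ.even 0)) (scalePair (-1) U) F.2

/-- `ℂ[x, x⁻¹, φ]`: the function `v` stands for `v 0 + φ (v 1)`. -/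
abbrev VSpace := ZMod 2 → LaurentPolynomial ℂ

/-- The inclusion of `ℂ[x, x⁻¹, φ]` in `Ser`. -/
def ofV (v : VSpace) : Ser :=
  ∑ i : ZMod 2, phi ^ i.val *
    mono ∅ (MvPowerSeries.C ((v i).coeff.sum fun k c =>
      AddMonoidAlgebra.single k (LaurentPolynomial.C c)))

/-- The set of variables of the monomial `φ^i ζ_s`. -/
def withPhi (i : ZMod 2) (s : Finset OddVar) : Finset OddVarPhi :=
  if i = 0 then s.map oddEmb
  else insert ⊥ (s.map oddEmb)

/-- `E` is the action on `Ser` of an element of the even part of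
`(End ℂ[x, x⁻¹, φ])[α₀^{1/2}, α₀^{-1/2}][[𝒜, ℬ]][ℳ, 𝒩]`, that is, of a formal sum of `m θ_m` over the
monomials `m` in `𝒜, ℬ, ℳ, 𝒩`, where `θ_m` is a Laurent polynomial in `α₀^{1/2}` whose coefficients
are endomorphisms of `ℂ[x, x⁻¹, φ]` of the same parity as `m`. Such an element acts on
`v ∈ ℂ[x, x⁻¹, φ]` by `v ↦ ∑ m θ_m(v)` (the sign in `action` comes from sorting `m φ`), and on `Ser` by
the linear extension over `R` that is compatible with infinite formal sums. -/
structure IsEnvelopeOp (E : Ser → Ser) : Prop where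
  map_add : ∀ u v, E (u + v) = E u + E v
  map_scalar_mul : ∀ r u, IsScalar r → E (r * u) = r * E u
  continuous : ∀ u s e, (∀ t a, t ⊆ insert ⊥ s → a ≤ e → ∀ k, coef u t a k = 0) →
    ∀ k, coef (E u) s e k = 0
  action : ∃ θ : Finset OddVar → (EvenVar →₀ ℕ) → LaurentPolynomial (Module.End ℂ VSpace),
    (∀ s e l i j p, (θ s e).coeff l (Pi.single i p) j ≠ 0 → j = i + (s.card : ZMod 2)) ∧
    ∀ v s e i k l, (coef (E (ofV v)) (withPhi i s) e k).coeff l =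
      (-1) ^ (s.card * i.val) * ((θ s e).coeff l v i).coeff k

end

end NSNormalOrder

open NSNormalOrder

namespace NSNormalOrder

open Finset

noncomputable section

/-! The proof translates pairs of series into operators. A vector field `vf a b` with `a` even, `b`
odd, both free of φ and without constant term, is an even derivation over the scalars which raises
the degree in 𝒜, ℬ, ℳ, 𝒩. Its exponential is therefore well defined and an algebra automorphism, and
since the commutator of `D` with the field is a multiple of `D`, it is superconformal (`scHom_evf`).
Substituting the images of x and φ under such a homomorphism into a series is the same as applying
the homomorphism to the series (`RHom.substSer`). Composition of pairs thus becomes composition of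
operators in the opposite order, the two inversions cancel, and the sewing equation says exactly
that `sewOp`, the left side of the asserted operator identity, carries the second pair to the first
(`sewing_iff`).

The core is the factorization `sewOp_eq_facOp` of `sewOp` into exponentials of negative, positive
and zero modes and the scaling, constructed degree by degree. Two superconformal homomorphisms with
the same leading term which agree below some degree differ, in that degree, by an infinitesimal
superconformal transformation; it is a vector field determined by the φ-free parts of the
differences at x and φ (`superconformal_difference`). Conversely, changing the field in `facOp`
changes the product in lowest degree by the full change of the field, because its mode parts add up
(`facOp_step`). Hence the error of an approximate factorization can be removed in its lowest degree
(`IsApproxFac.next`), and the corrections converge. The starting field, linear in the variables, is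
already an exact solution when (𝒜, ℳ) = 0 and when (ℬ, 𝒩) = 0; so every correction consists of mixed
terms, which is the claim about the shape of Ψ.

Moving the positive and zero factors to the other side yields a solution of the sewing problem
(`isSewingSolution_facF`); the conditions on powers of x hold because negative modes lower and
positive modes raise the weight of x^k φ^ε. Uniqueness of the solution is an induction on the
degree: the prescribed spaces and the normalization fix the φ-free part of the second pair,
linearized superconformality fixes the rest (`IsSewingSolution.unique`). Uniqueness of Ψ cannot
begin with the degree, as constant terms of Ψ are not excluded beforehand. For the nonzero modes the
weight takes its place (`exp_coords_unique`); for the zero mode, existence of the exponential forces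
the constant term to vanish (`IsPsi.ord_zero_mode`). By these uniqueness statements every solution
and every Ψ is the constructed one.

That the exponentials lie in the algebra of formal sums of endomorphisms requires, for each
monomial, a bound on the powers of α₀^{1/2} that is uniform in the argument (`exists_alpha_bound`).
-/

/-- Shortcut instances, which make the ring structure and the module structure of `Ser` agree
syntactically on addition, negation and subtraction. -/
@[reducible] def serRing : Ring Ser := SuperSeries.instRing

attribute [local instance] serRing

@[reducible] def serAddCommGroup : AddCommGroup Ser := Ring.toAddCommGroup
@[reducible] def serNeg : Neg Ser := Ring.toNeg
@[reducible] def serSub : Sub Ser := Ring.toSub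

attribute [local instance] serAddCommGroup serNeg serSub

/-! ### Coefficients of series -/

/-- The Laurent polynomial in `x` which is the coefficient of the monomial given by `s` and `e`. -/
def cf (u : Ser) (s : Finset OddVarPhi) (e : EvenVar →₀ ℕ) : XRing := MvPowerSeries.coeff e (u s)

/-- The series with given coefficients. -/
def mkSer (f : Finset OddVarPhi → (EvenVar →₀ ℕ) → XRing) : Ser := fun s => fun e => f s e

@[simp] theorem cf_mkSer (f : Finset OddVarPhi → (EvenVar →₀ ℕ) → XRing) (s e) :
    cf (mkSer f) s e = f s e := rfl

theorem coef_eq (u : Ser) (s : Finset OddVarPhi) (e : EvenVar →₀ ℕ) (k : ℤ) :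
    coef u s e k = (cf u s e).coeff k := rfl

theorem ser_ext {u v : Ser} (h : ∀ s e, cf u s e = cf v s e) : u = v :=
  funext fun s => MvPowerSeries.ext fun e => h s e

theorem ser_ext_coef {u v : Ser} (h : ∀ s e k, coef u s e k = coef v s e k) : u = v :=
  ser_ext fun s e => LaurentPolynomial.ext fun k => h s e k

@[simp] theorem cf_zero (s e) : cf 0 s e = 0 := rfl
@[simp] theorem cf_add (u v : Ser) (s e) : cf (u + v) s e = cf u s e + cf v s e := rfl
@[simp] theorem cf_neg (u : Ser) (s e) : cf (-u) s e = -cf u s e := rfl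
@[simp] theorem cf_sub (u v : Ser) (s e) : cf (u - v) s e = cf u s e - cf v s e := rfl
@[simp] theorem cf_smul (c : ℂ) (u : Ser) (s e) : cf (c • u) s e = c • cf u s e := rfl

/-- `cf` as a linear map. -/
def cfL (s : Finset OddVarPhi) (e : EvenVar →₀ ℕ) : Ser →ₗ[ℂ] XRing where
  toFun u := cf u s e
  map_add' _ _ := rfl
  map_smul' _ _ := rfl

@[simp] theorem cf_sum {ι : Type*} (t : Finset ι) (f : ι → Ser) (s e) :
    cf (∑ i ∈ t, f i) s e = ∑ i ∈ t, cf (f i) s e := map_sum (cfL s e) f t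

theorem cf_mul (u v : Ser) (s e) : cf (u * v) s e =
    ∑ t ∈ s.powerset, ∑ p ∈ antidiagonal e, sgn t (s \ t) • (cf u t p.1 * cf v (s \ t) p.2) := by
  unfold cf
  rw [SuperSeries.mul_def, map_sum]
  refine sum_congr rfl fun t _ => ?_
  rw [map_zsmul, MvPowerSeries.coeff_mul, smul_sum]

theorem cf_mono (t : Finset OddVarPhi) (q : MvPowerSeries EvenVar XRing) (s e) :
    cf (mono t q) s e = if s = t then MvPowerSeries.coeff e q else 0 := by
  unfold cf mono
  split_ifs <;> simp

theorem cf_one (s e) : cf 1 s e = if s = ∅ ∧ e = 0 then 1 else 0 := by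
  unfold cf
  rw [SuperSeries.one_def]
  split_ifs with h1 h2 h2
  · simp [h2.2]
  · simp only [MvPowerSeries.coeff_one]; rw [if_neg]; tauto
  · tauto
  · simp

/-- With the next instance this serves in place of a ℂ-algebra structure: scalars move freely
through products, and left and right multiplication are ℂ-linear maps. -/
instance : IsScalarTower ℂ Ser Ser where
  smul_assoc c u v := by
    refine ser_ext fun s e => ?_
    simp only [smul_eq_mul, cf_smul, cf_mul, smul_sum, smul_mul_assoc]
    refine sum_congr rfl fun t _ => sum_congr rfl fun p _ => ?_
    rw [smul_comm]

instance : SMulCommClass ℂ Ser Ser where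
  smul_comm c u v := by
    refine ser_ext fun s e => ?_
    simp only [smul_eq_mul, cf_smul, cf_mul, smul_sum, mul_smul_comm]
    refine sum_congr rfl fun t _ => sum_congr rfl fun p _ => ?_
    rw [smul_comm]

/-! ### Coefficientwise maps of Laurent polynomials -/

theorem coeff_laurentMap (a : ℤ → AlphaRing) (n : ℤ) (p : XRing) (k : ℤ) :
    (laurentMap a n p).coeff k = a (k - n) * p.coeff (k - n) := by
  unfold laurentMap
  rw [AddMonoidAlgebra.coeff_finsuppSum, Finsupp.sum_apply, Finsupp.sum,
    sum_eq_single (k - n)]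
  · rw [AddMonoidAlgebra.coeff_single, sub_add_cancel, Finsupp.single_eq_same]
  · intro b _ hb
    rw [AddMonoidAlgebra.coeff_single, Finsupp.single_apply, if_neg]
    omega
  · intro h
    simp [Finsupp.notMem_support_iff.1 h]

/-- `laurentMap` as a linear map. -/
def laurentMapL (a : ℤ → AlphaRing) (n : ℤ) : XRing →ₗ[ℂ] XRing where
  toFun := laurentMap a n
  map_add' p q := LaurentPolynomial.ext fun k => by
    simp [coeff_laurentMap, mul_add]
  map_smul' c p := LaurentPolynomial.ext fun k => by
    simp [coeff_laurentMap]

@[simp] theorem laurentMap_zero (a : ℤ → AlphaRing) (n : ℤ) : laurentMap a n 0 = 0 :=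
  (laurentMapL a n).map_zero

@[simp] theorem laurentMapL_apply (a n p) : laurentMapL a n p = laurentMap a n p := rfl

@[simp] theorem laurentMap_single (a : ℤ → AlphaRing) (n k : ℤ) (c : AlphaRing) :
    laurentMap a n (AddMonoidAlgebra.single k c) = AddMonoidAlgebra.single (k + n) (a k * c) := by
  unfold laurentMap
  rw [AddMonoidAlgebra.coeff_single, Finsupp.sum_single_index]
  simp

/-- A bilinear identity on Laurent polynomials holds if it does on monomials. -/
theorem xring_bilinear {f g : XRing →+ XRing →+ XRing}
    (h : ∀ k c l d, f (AddMonoidAlgebra.single k c) (AddMonoidAlgebra.single l d) =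
      g (AddMonoidAlgebra.single k c) (AddMonoidAlgebra.single l d)) (p q : XRing) :
    f p q = g p q := by
  have : f = g := by
    refine AddMonoidAlgebra.addMonoidHom_ext fun k c => AddMonoidAlgebra.addMonoidHom_ext fun l d => h k c l d
  rw [this]

/-- The multiplier behaves like a character of the exponent. Besides the scaling of φ-free
coefficients this covers coefficients of φ, where one factor carries an additional constant. -/
theorem laurentMap_mul (a b c : ℤ → AlphaRing) (n m : ℤ)
    (h : ∀ k l, a (k + l) = b k * c l) (p q : XRing) :
    laurentMap a (n + m) (p * q) = laurentMap b n p * laurentMap c m q := by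
  refine xring_bilinear
    (f := (AddMonoidHom.mul (R := XRing)).compr₂ (laurentMapL a (n + m)).toAddMonoidHom)
    (g := ((AddMonoidHom.mul (R := XRing)).comp
      (laurentMapL b n).toAddMonoidHom).compl₂ (laurentMapL c m).toAddMonoidHom) ?_ p q
  intro k c' l d
  simp only [AddMonoidHom.compr₂_apply, AddMonoidHom.mul_apply, AddMonoidAlgebra.single_mul_single,
    LinearMap.toAddMonoidHom_coe, laurentMapL_apply, laurentMap_single, h,
    AddMonoidHom.compl₂_apply, AddMonoidHom.comp_apply]
  congr 1 <;> ring

theorem laurentMap_deriv_mul (p q : XRing) :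
    laurentMap (fun k => (k : AlphaRing)) (-1) (p * q) =
      laurentMap (fun k => (k : AlphaRing)) (-1) p * q +
        p * laurentMap (fun k => (k : AlphaRing)) (-1) q := by
  refine xring_bilinear
    (f := (AddMonoidHom.mul (R := XRing)).compr₂
      (laurentMapL (fun k => (k : AlphaRing)) (-1)).toAddMonoidHom)
    (g := (AddMonoidHom.mul (R := XRing)).comp
      (laurentMapL (fun k => (k : AlphaRing)) (-1)).toAddMonoidHom +
      (AddMonoidHom.mul (R := XRing)).compl₂
      (laurentMapL (fun k => (k : AlphaRing)) (-1)).toAddMonoidHom) ?_ p q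
  intro k c' l d
  simp only [AddMonoidHom.compr₂_apply, AddMonoidHom.mul_apply, AddMonoidAlgebra.single_mul_single,
    LinearMap.toAddMonoidHom_coe, laurentMapL_apply, laurentMap_single, AddMonoidHom.add_apply,
    AddMonoidHom.compl₂_apply, AddMonoidHom.comp_apply]
  have e1 : l + (-1) + k = k + l + -1 := by ring
  have e2 : k + (l + -1) = k + l + -1 := by ring
  have e3 : k + -1 + l = k + l + -1 := by ring
  rw [e2, e3, ← AddMonoidAlgebra.single_add]
  congr 1
  push_cast
  ring

/-! ### Signs -/

/-- The least variable on the left is never part of an inversion. -/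
theorem sgn_insert_bot_left {s t : Finset OddVarPhi} (hs : ⊥ ∉ s) :
    sgn (insert ⊥ s) t = sgn s t := by
  rw [insert_eq, sgn_union_left _ (by simpa using hs)]
  have : sgn ({⊥} : Finset OddVarPhi) t = 1 := by
    unfold sgn inversions
    rw [filter_false_of_mem]
    · simp
    · rintro ⟨a, b⟩ h
      simp only [mem_product, mem_singleton] at h
      simp [h.1]
  rw [this, one_mul]

/-- On the right, φ has to pass every variable of `s`. -/
theorem sgn_insert_bot_right {s t : Finset OddVarPhi} (hs : ⊥ ∉ s) (ht : ⊥ ∉ t) :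
    sgn s (insert ⊥ t) = (-1) ^ s.card * sgn s t := by
  rw [insert_eq, sgn_union_right _ (by simpa using ht)]
  have : sgn s ({⊥} : Finset OddVarPhi) = (-1) ^ s.card := by
    unfold sgn inversions
    rw [filter_true_of_mem]
    · simp
    · rintro ⟨a, b⟩ h
      simp only [mem_product, mem_singleton] at h
      rw [h.2]
      exact bot_lt_iff_ne_bot.2 fun h' => hs (h' ▸ h.1)
  rw [this]

/-- For disjoint sets every pair of variables is an inversion in exactly one of the two orders, so
the two inversion numbers add up to the number of pairs. -/
theorem sgn_comm {O : Type*} [LinearOrder O] {s t : Finset O} (h : Disjoint s t) :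
    sgn s t = (-1) ^ (s.card * t.card) * sgn t s := by
  have key : inversions s t + inversions t s = s.card * t.card := by
    unfold inversions
    rw [← card_product, ← card_map (Equiv.prodComm O O).toEmbedding (s := filter _ (t ×ˢ s)),
      ← card_union_of_disjoint]
    · congr 1
      ext ⟨a, b⟩
      simp only [mem_union, mem_filter, mem_product, mem_map, Equiv.coe_toEmbedding,
        Equiv.prodComm_apply, Prod.exists, Prod.swap_prod_mk, Prod.mk.injEq]
      constructor
      · rintro (⟨h1, _⟩ | ⟨_, _, ⟨h1, _⟩, rfl, rfl⟩)
        · exact h1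
        · exact h1.symm
      · rintro ⟨ha, hb⟩
        rcases lt_trichotomy a b with hab | hab | hab
        · exact Or.inr ⟨b, a, ⟨⟨hb, ha⟩, hab⟩, rfl, rfl⟩
        · exact absurd (hab ▸ hb) (disjoint_left.1 h ha)
        · exact Or.inl ⟨⟨ha, hb⟩, hab⟩
    · rw [disjoint_left]
      rintro ⟨a, b⟩ h1 h2
      simp only [mem_filter, mem_product, mem_map, Equiv.coe_toEmbedding, Equiv.prodComm_apply,
        Prod.exists, Prod.swap_prod_mk, Prod.mk.injEq] at h1 h2
      obtain ⟨_, _, ⟨_, h3⟩, rfl, rfl⟩ := h2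
      exact lt_asymm h1.2 h3
  unfold sgn
  rw [← key, ← pow_add]
  have : (-1 : ℤ) ^ (inversions t s + inversions t s) = 1 := by
    rw [← two_mul, pow_mul]; simp
  rw [add_assoc, pow_add, this, mul_one]

/-! ### Parity -/

/-- The automorphism which is `1` on even and `-1` on odd series. -/
def par : Ser →ₗ[ℂ] Ser where
  toFun u := fun s => (-1 : ℤ) ^ s.card • u s
  map_add' u v := by
    funext s
    exact smul_add _ _ _
  map_smul' c u := by
    funext s
    exact smul_comm ((-1 : ℤ) ^ s.card) c (u s)

@[simp] theorem cf_par (u : Ser) (s e) : cf (par u) s e = (-1 : ℤ) ^ s.card • cf u s e := by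
  change MvPowerSeries.coeff e ((-1 : ℤ) ^ s.card • u s) = _
  rw [map_zsmul]; rfl

theorem par_par (u : Ser) : par (par u) = u := by
  refine ser_ext fun s e => ?_
  rw [cf_par, cf_par, smul_smul, ← mul_pow]
  simp

theorem par_mul (u v : Ser) : par (u * v) = par u * par v := by
  refine ser_ext fun s e => ?_
  simp only [cf_par, cf_mul, smul_sum]
  refine sum_congr rfl fun t ht => sum_congr rfl fun p _ => ?_
  rw [mem_powerset] at ht
  have : s.card = t.card + (s \ t).card := by
    rw [card_sdiff_of_subset ht]; have := card_le_card ht; omega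
  rw [this, pow_add]
  simp only [zsmul_eq_mul]
  push_cast
  ring

theorem xring_eq_zero_of_eq_neg {p : XRing} (h : p = -p) : p = 0 := by
  have h2 : (2 : ℂ) • p = 0 := by
    rw [two_smul]
    nth_rewrite 2 [h]
    exact add_neg_cancel p
  exact (smul_eq_zero.1 h2).resolve_left two_ne_zero

theorem cf_of_eq_zero {u : Ser} {s : Finset OddVarPhi} (h : u s = 0) (e) : cf u s e = 0 := by
  unfold cf
  rw [h, map_zero]

/-- Parity becomes an equation for `par`, which can be propagated by rewriting through products,
derivatives and exponentials. -/
theorem isEvenSer_iff {u : Ser} : IsEvenSer u ↔ par u = u := by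
  constructor
  · intro h
    refine ser_ext fun s e => ?_
    rw [cf_par]
    by_cases hs : u s = 0
    · rw [cf_of_eq_zero hs, smul_zero]
    · rw [(h s hs).neg_one_pow, one_smul]
  · intro h s hs
    by_contra hodd
    rw [Nat.not_even_iff_odd] at hodd
    refine hs (MvPowerSeries.ext fun e => ?_)
    have := congrArg (fun w => cf w s e) h
    simp only [cf_par, hodd.neg_one_pow, neg_smul, one_smul] at this
    exact xring_eq_zero_of_eq_neg this.symm

theorem isOddSer_iff {u : Ser} : IsOddSer u ↔ par u = -u := by
  constructor
  · intro h
    refine ser_ext fun s e => ?_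
    rw [cf_par, cf_neg]
    by_cases hs : u s = 0
    · rw [cf_of_eq_zero hs, smul_zero, neg_zero]
    · rw [(h s hs).neg_one_pow, neg_smul, one_smul]
  · intro h s hs
    by_contra hev
    rw [Nat.not_odd_iff_even] at hev
    refine hs (MvPowerSeries.ext fun e => ?_)
    have := congrArg (fun w => cf w s e) h
    simp only [cf_par, hev.neg_one_pow, one_smul, cf_neg] at this
    exact xring_eq_zero_of_eq_neg this

/-- Reindexing of a product by complements. -/
theorem cf_mul_swap (u v : Ser) (s e) : cf (u * v) s e =
    ∑ t ∈ s.powerset, ∑ p ∈ antidiagonal e,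
      ((-1) ^ (t.card * (s \ t).card) * sgn t (s \ t)) • (cf v t p.1 * cf u (s \ t) p.2) := by
  rw [cf_mul]
  refine sum_bij' (fun t _ => s \ t) (fun t _ => s \ t) ?_ ?_ ?_ ?_ ?_
  · intro t _; simp
  · intro t _; simp
  · intro t ht; exact Finset.sdiff_sdiff_eq_self (mem_powerset.1 ht)
  · intro t ht; exact Finset.sdiff_sdiff_eq_self (mem_powerset.1 ht)
  · intro t ht
    rw [Finset.sdiff_sdiff_eq_self (mem_powerset.1 ht)]
    refine sum_bij' (fun p _ => p.swap) (fun p _ => p.swap) ?_ ?_ ?_ ?_ ?_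
    · intro p hp; simpa [add_comm] using hp
    · intro p hp; simpa [add_comm] using hp
    · intro p _; simp
    · intro p _; simp
    · intro p _
      have h : sgn t (s \ t) = (-1) ^ ((s \ t).card * t.card) * sgn (s \ t) t := by
        rw [sgn_comm sdiff_disjoint.symm, mul_comm t.card]
      rw [← h, mul_comm (cf u t p.1)]
      rfl

theorem even_mul_comm {a : Ser} (ha : par a = a) (u : Ser) : a * u = u * a := by
  refine ser_ext fun s e => ?_
  rw [cf_mul_swap, cf_mul]
  refine sum_congr rfl fun t _ => sum_congr rfl fun p _ => ?_
  by_cases h : cf a (s \ t) p.2 = 0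
  · simp [h]
  · have : Even (s \ t).card := isEvenSer_iff.2 ha _ fun h' => h (cf_of_eq_zero h' _)
    rw [(this.mul_left _).neg_one_pow, one_mul]

/-- The automorphism `par` carries the sign, so `u` need not be homogeneous. -/
theorem odd_mul_comm {b : Ser} (hb : par b = -b) (u : Ser) : b * u = par u * b := by
  refine ser_ext fun s e => ?_
  rw [cf_mul_swap, cf_mul]
  refine sum_congr rfl fun t _ => sum_congr rfl fun p _ => ?_
  by_cases h : cf b (s \ t) p.2 = 0
  · simp [h]
  · have : Odd (s \ t).card := isOddSer_iff.2 hb _ fun h' => h (cf_of_eq_zero h' _)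
    rw [mul_comm t.card, pow_mul, this.neg_one_pow, cf_par]
    simp only [zsmul_eq_mul]
    push_cast
    ring

/-! ### The derivations `∂/∂x` and `∂/∂φ` -/

/-- `dx` as a linear map. -/
def dxL : Ser →ₗ[ℂ] Ser where
  toFun := dx
  map_add' u v := ser_ext fun s e => (laurentMapL _ (-1)).map_add (cf u s e) (cf v s e)
  map_smul' c u := ser_ext fun s e => (laurentMapL _ (-1)).map_smul c (cf u s e)

theorem cf_dphi (u : Ser) (s e) :
    cf (dphi u) s e = if ⊥ ∈ s then 0 else cf u (insert ⊥ s) e := by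
  unfold cf dphi
  split_ifs <;> simp

/-- `dphi` as a linear map. -/
def dphiL : Ser →ₗ[ℂ] Ser where
  toFun := dphi
  map_add' u v := ser_ext fun s e => by
    simp only [cf_add, cf_dphi]
    split_ifs <;> simp
  map_smul' c u := ser_ext fun s e => by
    simp only [cf_smul, cf_dphi, RingHom.id_apply]
    split_ifs <;> simp

@[simp] theorem dx_add (u v : Ser) : dx (u + v) = dx u + dx v := dxL.map_add u v
@[simp] theorem dx_sub (u v : Ser) : dx (u - v) = dx u - dx v := dxL.map_sub u v
@[simp] theorem dx_neg (u : Ser) : dx (-u) = -dx u := dxL.map_neg u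
@[simp] theorem dx_zero : dx 0 = 0 := dxL.map_zero
@[simp] theorem dx_smul (c : ℂ) (u : Ser) : dx (c • u) = c • dx u := dxL.map_smul c u
@[simp] theorem dphi_add (u v : Ser) : dphi (u + v) = dphi u + dphi v := dphiL.map_add u v
@[simp] theorem dphi_sub (u v : Ser) : dphi (u - v) = dphi u - dphi v := dphiL.map_sub u v
@[simp] theorem dphi_neg (u : Ser) : dphi (-u) = -dphi u := dphiL.map_neg u
@[simp] theorem dphi_zero : dphi 0 = 0 := dphiL.map_zero
@[simp] theorem dphi_smul (c : ℂ) (u : Ser) : dphi (c • u) = c • dphi u := dphiL.map_smul c u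

theorem cf_dx (u : Ser) (s e) :
    cf (dx u) s e = laurentMap (fun k => (k : AlphaRing)) (-1) (cf u s e) := rfl

theorem coef_dx (u : Ser) (s e k) : coef (dx u) s e k = (k + 1 : ℤ) * coef u s e (k + 1) := by
  rw [coef_eq, cf_dx, coeff_laurentMap]
  simp [coef_eq]

theorem dx_mul (u v : Ser) : dx (u * v) = dx u * v + u * dx v := by
  refine ser_ext fun s e => ?_
  rw [cf_dx, cf_add]
  simp only [cf_mul]
  change laurentMapL _ _ _ = _
  simp only [map_sum, map_zsmul, laurentMapL_apply, laurentMap_deriv_mul, smul_add,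
    sum_add_distrib]
  rfl

theorem dphi_dphi (u : Ser) : dphi (dphi u) = 0 := by
  refine ser_ext fun s e => ?_
  simp [cf_dphi]

theorem dx_dphi (u : Ser) : dx (dphi u) = dphi (dx u) := by
  refine ser_ext fun s e => ?_
  rw [cf_dx, cf_dphi, cf_dphi, cf_dx]
  split_ifs
  · exact laurentMap_zero _ _
  · rfl

theorem par_dx (u : Ser) : par (dx u) = dx (par u) := by
  refine ser_ext fun s e => ?_
  rw [cf_dx, cf_par, cf_par, cf_dx]
  exact ((laurentMapL _ (-1)).map_smul_of_tower _ _).symm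

theorem par_dphi (u : Ser) : par (dphi u) = -dphi (par u) := by
  refine ser_ext fun s e => ?_
  rw [cf_neg, cf_dphi, cf_par, cf_par, cf_dphi]
  split_ifs with h
  · simp
  · rw [card_insert_of_notMem h, pow_succ, mul_neg_one, neg_smul, neg_neg]

theorem sum_powerset_insert_bot {M : Type*} [AddCommMonoid M] {s : Finset OddVarPhi} (hs : ⊥ ∉ s)
    (f : Finset OddVarPhi → M) :
    ∑ t ∈ (insert ⊥ s).powerset, f t = ∑ t ∈ s.powerset, f t + ∑ t ∈ s.powerset, f (insert ⊥ t) :=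
  sum_powerset_insert hs f

/-- The Leibniz rule of an odd left derivation: passing `u` costs the sign recorded by `par`. -/
theorem dphi_mul (u v : Ser) : dphi (u * v) = dphi u * v + par u * dphi v := by
  refine ser_ext fun s e => ?_
  rw [cf_dphi, cf_add]
  by_cases h : ⊥ ∈ s
  · obtain ⟨r, hr, rfl⟩ : ∃ r, ⊥ ∉ r ∧ insert ⊥ r = s :=
      ⟨s.erase ⊥, notMem_erase _ _, insert_erase h⟩
    rw [if_pos h, cf_mul, cf_mul, sum_powerset_insert_bot hr, sum_powerset_insert_bot hr,
      add_add_add_comm, ← sum_add_distrib, ← sum_add_distrib, ← sum_add_distrib]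
    -- Here the left side is zero. On the right the surviving terms take φ from both `u` and `v`,
    -- once from each summand of the Leibniz rule, and they cancel for each `t`.
    refine (sum_eq_zero fun t ht => ?_).symm
    have ht' : ⊥ ∉ t := fun h => hr (mem_powerset.1 ht h)
    have e1 : insert ⊥ r \ t = insert ⊥ (r \ t) := insert_sdiff_of_notMem _ ht'
    have e2 : insert ⊥ r \ insert ⊥ t = r \ t := by
      rw [insert_sdiff_insert, sdiff_insert_of_notMem hr]
    have h2 : ⊥ ∉ r \ t := fun h => hr (mem_sdiff.1 h).1
    rw [e1, e2, ← sum_add_distrib, ← sum_add_distrib, ← sum_add_distrib]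
    refine sum_eq_zero fun p _ => ?_
    simp only [cf_dphi, cf_par, mem_insert_self, if_true, ht', h2, if_false,
      sgn_insert_bot_left ht', sgn_insert_bot_right ht' h2, card_insert_of_notMem ht']
    generalize cf u (insert ⊥ t) p.1 = A
    generalize cf v (insert ⊥ (r \ t)) p.2 = B
    generalize sgn t (r \ t) = σ
    generalize t.card = c
    rw [pow_succ]
    simp only [zsmul_eq_mul, mul_zero, zero_mul, zero_add]
    push_cast
    ring
  · rw [if_neg h, cf_mul, cf_mul, cf_mul, sum_powerset_insert_bot h, add_comm]
    refine congrArg₂ (· + ·) ?_ ?_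
    · refine sum_congr rfl fun t ht => ?_
      have ht' : ⊥ ∉ t := fun h' => h (mem_powerset.1 ht h')
      have e2 : insert ⊥ s \ insert ⊥ t = s \ t := by
        rw [insert_sdiff_insert, sdiff_insert_of_notMem h]
      refine sum_congr rfl fun p _ => ?_
      simp only [e2, cf_dphi, ht', if_false, sgn_insert_bot_left ht']
    · refine sum_congr rfl fun t ht => ?_
      have ht' : ⊥ ∉ t := fun h' => h (mem_powerset.1 ht h')
      have e1 : insert ⊥ s \ t = insert ⊥ (s \ t) := insert_sdiff_of_notMem _ ht'
      have h2 : ⊥ ∉ s \ t := fun h' => h (mem_sdiff.1 h').1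
      refine sum_congr rfl fun p _ => ?_
      simp only [e1, cf_dphi, h2, if_false, cf_par, sgn_insert_bot_right ht' h2, zsmul_eq_mul]
      generalize cf u t p.1 = A
      generalize cf v (insert ⊥ (s \ t)) p.2 = B
      generalize sgn t (s \ t) = σ
      generalize t.card = c
      push_cast
      ring

/-! ### Coefficientwise algebra maps -/

/-- The linear map which applies `f` to the coefficients without `φ` and `g` to those with `φ`. -/
def cmap (f g : XRing →ₗ[ℂ] XRing) : Ser →ₗ[ℂ] Ser where
  toFun u := mkSer fun s e => if ⊥ ∈ s then g (cf u s e) else f (cf u s e)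
  map_add' u v := ser_ext fun s e => by
    simp only [cf_add, cf_mkSer]
    split_ifs
    · exact g.map_add _ _
    · exact f.map_add _ _
  map_smul' c u := ser_ext fun s e => by
    simp only [cf_smul, cf_mkSer, RingHom.id_apply]
    split_ifs
    · exact g.map_smul _ _
    · exact f.map_smul _ _

theorem cf_cmap (f g : XRing →ₗ[ℂ] XRing) (u : Ser) (s e) :
    cf (cmap f g u) s e = if ⊥ ∈ s then g (cf u s e) else f (cf u s e) := rfl

/-- A product contains φ at most once, so at most one of its factors is treated by `g`. It is
therefore enough that `f` is multiplicative and `g` is semilinear over `f`. -/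
theorem cmap_mul {f g : XRing →ₗ[ℂ] XRing} (hf : ∀ p q, f (p * q) = f p * f q)
    (hg : ∀ p q, g (p * q) = g p * f q) (u v : Ser) :
    cmap f g (u * v) = cmap f g u * cmap f g v := by
  refine ser_ext fun s e => ?_
  rw [cf_cmap, cf_mul, cf_mul, map_sum, map_sum]
  split_ifs with h
  · refine sum_congr rfl fun t ht => ?_
    rw [map_sum]
    refine sum_congr rfl fun p _ => ?_
    rw [map_zsmul, cf_cmap, cf_cmap]
    by_cases ht' : ⊥ ∈ t
    · rw [if_pos ht', if_neg (by simp [ht']), hg]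
    · rw [if_neg ht', if_pos (by simp [ht', h]), mul_comm, hg, mul_comm]
  · refine sum_congr rfl fun t ht => ?_
    rw [map_sum]
    refine sum_congr rfl fun p _ => ?_
    have ht' : ⊥ ∉ t := fun h' => h (mem_powerset.1 ht h')
    rw [map_zsmul, cf_cmap, cf_cmap, if_neg ht', if_neg (by simp [h]), hf]

/-- `scale n` as a linear map. -/
def scaleL (n : ℤ) : Ser →ₗ[ℂ] Ser :=
  cmap (laurentMapL (fun k => LaurentPolynomial.T (n * (2 * k))) 0)
    (laurentMapL (fun k => LaurentPolynomial.T (n * (2 * k + 1))) 0)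

theorem scaleL_apply (n : ℤ) (u : Ser) : scaleL n u = scale n u := by
  refine ser_ext fun s e => ?_
  unfold scaleL
  rw [cf_cmap]
  change _ = laurentMap (fun k => LaurentPolynomial.T (n * (2 * k + if ⊥ ∈ s then 1 else 0))) 0
    (cf u s e)
  split_ifs <;> simp

theorem coef_scale (n : ℤ) (u : Ser) (s e k) : coef (scale n u) s e k =
    LaurentPolynomial.T (n * (2 * k + if ⊥ ∈ s then 1 else 0)) * coef u s e k := by
  change (laurentMap _ _ _).coeff k = _
  rw [coeff_laurentMap]
  simp [coef]

theorem scale_mul (n : ℤ) (u v : Ser) : scale n (u * v) = scale n u * scale n v := by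
  simp only [← scaleL_apply]
  refine cmap_mul ?_ ?_ u v
  · intro p q
    exact laurentMap_mul _ _ _ 0 0 (fun k l => by
      rw [← LaurentPolynomial.T_add]; congr 1; ring) p q
  · intro p q
    exact laurentMap_mul _ _ _ 0 0 (fun k l => by
      rw [← LaurentPolynomial.T_add]; congr 1; ring) p q

theorem scale_scale (m n : ℤ) (u : Ser) : scale m (scale n u) = scale (m + n) u := by
  refine ser_ext_coef fun s e k => ?_
  rw [coef_scale, coef_scale, coef_scale, ← mul_assoc, ← LaurentPolynomial.T_add]
  congr 2
  ring

theorem scale_zero_left (u : Ser) : scale 0 u = u := by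
  refine ser_ext_coef fun s e k => ?_
  rw [coef_scale]
  simp

theorem scale_neg_scale (n : ℤ) (u : Ser) : scale (-n) (scale n u) = u := by
  rw [scale_scale, neg_add_cancel, scale_zero_left]

theorem scale_scale_neg (n : ℤ) (u : Ser) : scale n (scale (-n) u) = u := by
  rw [scale_scale, add_neg_cancel, scale_zero_left]

theorem par_cmap (f g : XRing →ₗ[ℂ] XRing) (u : Ser) : par (cmap f g u) = cmap f g (par u) := by
  refine ser_ext fun s e => ?_
  rw [cf_par, cf_cmap, cf_cmap, cf_par]
  split_ifs
  · rw [map_zsmul]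
  · rw [map_zsmul]

theorem par_scale (n : ℤ) (u : Ser) : par (scale n u) = scale n (par u) := by
  rw [← scaleL_apply, ← scaleL_apply]
  exact par_cmap _ _ u

/-! ### Basic elements -/

theorem cf_mono_mul (r : Finset OddVarPhi) (q : MvPowerSeries EvenVar XRing) (u : Ser) (s e) :
    cf (mono r q * u) s e = if r ⊆ s then sgn r (s \ r) • MvPowerSeries.coeff e (q * u (s \ r))
      else 0 := by
  unfold cf
  rw [SuperSeries.mul_def]
  split_ifs with h
  · rw [sum_eq_single r, map_zsmul]
    · simp [mono]
    · intro t _ ht; simp [mono, ht]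
    · intro h'; exact absurd (mem_powerset.2 h) h'
  · rw [sum_eq_zero, map_zero]
    intro t ht
    have : t ≠ r := fun h' => h (h' ▸ mem_powerset.1 ht)
    simp [mono, this]

theorem sgn_empty_left {O : Type*} [LinearOrder O] (s : Finset O) : sgn ∅ s = 1 := by
  simp [sgn, inversions]

theorem cf_mono_empty_mul (q : MvPowerSeries EvenVar XRing) (u : Ser) (s e) :
    cf (mono ∅ q * u) s e = MvPowerSeries.coeff e (q * u s) := by
  rw [cf_mono_mul]
  simp [sgn_empty_left]

/-- A Laurent polynomial in `x` as a series. -/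
def ofX (p : XRing) : Ser := mono ∅ (MvPowerSeries.C p)

theorem cf_ofX_mul (p : XRing) (u : Ser) (s e) : cf (ofX p * u) s e = p * cf u s e := by
  unfold ofX
  rw [cf_mono_empty_mul, MvPowerSeries.coeff_C_mul]
  rfl

theorem cf_ofX (p : XRing) (s e) : cf (ofX p) s e = if s = ∅ ∧ e = 0 then p else 0 := by
  rw [← mul_one (ofX p), cf_ofX_mul, cf_one]
  split_ifs <;> simp

theorem xpow_eq (k : ℤ) : xpow k = ofX (LaurentPolynomial.T k) := rfl
theorem ofAlpha_eq (c : AlphaRing) : ofAlpha c = ofX (LaurentPolynomial.C c) := rfl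

theorem ofX_mul (p q : XRing) : ofX (p * q) = ofX p * ofX q := by
  refine ser_ext fun s e => ?_
  rw [cf_ofX_mul, cf_ofX, cf_ofX]
  split_ifs <;> simp

@[simp] theorem ofX_one : ofX 1 = 1 := by
  refine ser_ext fun s e => ?_
  rw [cf_ofX, cf_one]

theorem ofX_add (p q : XRing) : ofX (p + q) = ofX p + ofX q := by
  refine ser_ext fun s e => ?_
  rw [cf_add, cf_ofX, cf_ofX, cf_ofX]
  split_ifs <;> simp

theorem par_ofX (p : XRing) : par (ofX p) = ofX p := by
  refine ser_ext fun s e => ?_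
  rw [cf_par, cf_ofX]
  split_ifs with h
  · simp [h.1]
  · simp

theorem dphi_ofX (p : XRing) : dphi (ofX p) = 0 := by
  refine ser_ext fun s e => ?_
  simp [cf_dphi, cf_ofX]

theorem dx_ofX (p : XRing) : dx (ofX p) = ofX (laurentMap (fun k => (k : AlphaRing)) (-1) p) := by
  refine ser_ext fun s e => ?_
  rw [cf_dx, cf_ofX, cf_ofX]
  split_ifs
  · rfl
  · exact laurentMap_zero _ _

theorem scale_ofX (n : ℤ) (p : XRing) :
    scale n (ofX p) = ofX (laurentMap (fun k => LaurentPolynomial.T (n * (2 * k))) 0 p) := by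
  rw [← scaleL_apply]
  refine ser_ext fun s e => ?_
  unfold scaleL
  rw [cf_cmap, cf_ofX, cf_ofX]
  split_ifs with h1 h2 h2
  · simp [h2.1] at h1
  · simp
  · rfl
  · simp

theorem xpow_add (k l : ℤ) : xpow (k + l) = xpow k * xpow l := by
  rw [xpow_eq, LaurentPolynomial.T_add, ofX_mul]; rfl

@[simp] theorem xpow_zero : xpow 0 = 1 := by
  rw [xpow_eq, LaurentPolynomial.T_zero, ofX_one]

@[simp] theorem par_xpow (k : ℤ) : par (xpow k) = xpow k := par_ofX _
@[simp] theorem par_alpha (k : ℤ) : par (alpha k) = alpha k := par_ofX _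
@[simp] theorem dphi_xpow (k : ℤ) : dphi (xpow k) = 0 := dphi_ofX _
@[simp] theorem dphi_alpha (k : ℤ) : dphi (alpha k) = 0 := dphi_ofX _

theorem T_eq_single {R : Type*} [Semiring R] (k : ℤ) :
    (LaurentPolynomial.T k : LaurentPolynomial R) = AddMonoidAlgebra.single k 1 := rfl

theorem C_eq_single {R : Type*} [Semiring R] (c : R) :
    (LaurentPolynomial.C c : LaurentPolynomial R) = AddMonoidAlgebra.single 0 c := rfl

theorem dx_xpow (k : ℤ) : dx (xpow k) = (k : ℂ) • xpow (k - 1) := by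
  rw [xpow_eq, dx_ofX, T_eq_single, laurentMap_single]
  refine ser_ext fun s e => ?_
  rw [cf_smul, xpow_eq, cf_ofX, cf_ofX]
  split_ifs
  · rw [T_eq_single, AddMonoidAlgebra.smul_single]
    congr 1
    rw [← Algebra.algebraMap_eq_smul_one, map_intCast, mul_one]
  · simp

@[simp] theorem dx_alpha (k : ℤ) : dx (alpha k) = 0 := by
  unfold alpha
  rw [ofAlpha_eq, dx_ofX, C_eq_single, laurentMap_single]
  refine ser_ext fun s e => ?_
  rw [cf_ofX]
  simp

theorem alpha_add (m n : ℤ) : alpha (m + n) = alpha m * alpha n := by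
  unfold alpha
  rw [ofAlpha_eq, LaurentPolynomial.T_add, map_mul, ofX_mul]; rfl

@[simp] theorem alpha_zero : alpha 0 = 1 := by
  unfold alpha
  rw [ofAlpha_eq, LaurentPolynomial.T_zero, map_one, ofX_one]

theorem cf_phi (s e) : cf phi s e = if s = {⊥} ∧ e = 0 then 1 else 0 := by
  unfold phi
  rw [cf_mono, MvPowerSeries.coeff_one]
  split_ifs <;> simp_all

@[simp] theorem par_phi : par phi = -phi := by
  refine ser_ext fun s e => ?_
  rw [cf_par, cf_neg, cf_phi]
  split_ifs with h
  · simp [h.1]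
  · simp

@[simp] theorem dx_phi : dx phi = 0 := by
  refine ser_ext fun s e => ?_
  rw [cf_dx, cf_phi]
  split_ifs with h
  · rw [AddMonoidAlgebra.one_def, laurentMap_single]; simp
  · exact laurentMap_zero _ _

@[simp] theorem dphi_phi : dphi phi = 1 := by
  refine ser_ext fun s e => ?_
  rw [cf_dphi, cf_phi, cf_one]
  by_cases h : ⊥ ∈ s
  · rw [if_pos h, if_neg]
    rintro ⟨rfl, -⟩
    simp at h
  · rw [if_neg h]
    refine if_congr ?_ rfl rfl
    refine and_congr_left fun _ => ?_
    constructor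
    · intro h'
      rw [← erase_insert h, h']; simp
    · rintro rfl; simp

theorem phi_mul (u : Ser) : phi * u = par u * phi := odd_mul_comm par_phi u

@[simp] theorem phi_mul_phi : phi * phi = 0 := by
  have h : phi * phi = -(phi * phi) := by
    nth_rewrite 1 [phi_mul, par_phi, neg_mul]; rfl
  refine ser_ext fun s e => ?_
  have := congrArg (fun w => cf w s e) h
  exact xring_eq_zero_of_eq_neg this

theorem phi_mul_phi_mul (u : Ser) : phi * (phi * u) = 0 := by
  rw [← mul_assoc, phi_mul_phi, zero_mul]

theorem scale_phi (n : ℤ) : scale n phi = alpha n * phi := by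
  refine ser_ext_coef fun s e k => ?_
  unfold alpha
  rw [coef_scale, ofAlpha_eq, coef_eq, coef_eq, cf_ofX_mul, cf_phi]
  split_ifs with h1 h2 h2
  · by_cases hk : k = 0
    · subst hk; simp
    · rw [AddMonoidAlgebra.one_def, C_eq_single, AddMonoidAlgebra.single_mul_single]
      rw [AddMonoidAlgebra.coeff_single, AddMonoidAlgebra.coeff_single, Finsupp.single_apply,
        Finsupp.single_apply, if_neg (Ne.symm hk), if_neg (by simpa using Ne.symm hk), mul_zero]
  · simp
  · simp [h2.1] at h1
  · simp

theorem scale_xpow (n k : ℤ) : scale n (xpow k) = alpha (2 * n * k) * xpow k := by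
  unfold alpha
  rw [xpow_eq, scale_ofX, ofAlpha_eq, ← ofX_mul, T_eq_single, laurentMap_single, C_eq_single,
    AddMonoidAlgebra.single_mul_single, add_zero, zero_add, show n * (2 * k) = 2 * n * k by ring]

/-! ### Superconformal vector fields -/

/-- The vector field `-(a ∂/∂x + (1/2) (∂a/∂x) φ ∂/∂φ) - b (∂/∂φ - φ ∂/∂x)`. -/
def vf (a b : Ser) : Ser →ₗ[ℂ] Ser where
  toFun u := -(a * dx u + (1 / 2 : ℂ) • (dx a * (phi * dphi u))) - b * (dphi u - phi * dx u)
  map_add' u v := by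
    simp only [dx_add, dphi_add, mul_add, mul_sub]
    module
  map_smul' c u := by
    simp only [dx_smul, dphi_smul, mul_sub, mul_smul_comm, RingHom.id_apply]
    module

theorem vf_apply (a b u : Ser) : vf a b u =
    -(a * dx u + (1 / 2 : ℂ) • (dx a * (phi * dphi u))) - b * (dphi u - phi * dx u) := rfl

/-- `a` is even, `b` is odd, and neither contains `φ`. -/
structure IsVF (a b : Ser) : Prop where
  even : par a = a
  odd : par b = -b
  dphi_even : dphi a = 0
  dphi_odd : dphi b = 0

theorem par_dx_even {a : Ser} (h : par a = a) : par (dx a) = dx a := by rw [par_dx, h]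
theorem par_dx_odd {b : Ser} (h : par b = -b) : par (dx b) = -dx b := by rw [par_dx, h, dx_neg]

theorem mul_left_comm_even {a : Ser} (ha : par a = a) (u v : Ser) : a * (u * v) = u * (a * v) := by
  rw [← mul_assoc, even_mul_comm ha, mul_assoc]

theorem mul_left_comm_odd {b : Ser} (hb : par b = -b) (u v : Ser) :
    b * (u * v) = par u * (b * v) := by
  rw [← mul_assoc, odd_mul_comm hb, mul_assoc]

/-- Both summands of the field are even operators: the odd coefficient `b` stands in front of an odd
derivation. Each `par u` produced by an odd derivative is undone when a second odd factor passes it.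
-/
theorem vf_mul {a b : Ser} (h : IsVF a b) (u v : Ser) :
    vf a b (u * v) = vf a b u * v + u * vf a b v := by
  have e1 : a * (u * dx v) = u * (a * dx v) := mul_left_comm_even h.even _ _
  have e2 : dx a * (phi * (par u * dphi v)) = u * (dx a * (phi * dphi v)) := by
    rw [mul_left_comm_odd par_phi, par_par, mul_left_comm_even (par_dx_even h.even)]
  have e3 : b * (par u * dphi v) = u * (b * dphi v) := by
    rw [mul_left_comm_odd h.odd, par_par]
  have e4 : b * (phi * (u * dx v)) = u * (b * (phi * dx v)) := by
    rw [mul_left_comm_odd par_phi, mul_left_comm_odd h.odd, par_par]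
  simp only [vf_apply, dx_mul, dphi_mul, mul_add, mul_sub, sub_mul, add_mul, neg_mul, mul_neg,
    smul_mul_assoc, mul_smul_comm, e1, e2, e3, e4, mul_assoc]
  module

theorem par_vf {a b : Ser} (h : IsVF a b) (u : Ser) : par (vf a b u) = vf a b (par u) := by
  simp only [vf_apply, map_sub, map_neg, map_add, map_smul, par_mul, par_dx, par_dphi, h.even,
    h.odd, par_phi]
  simp only [neg_mul, mul_neg, sub_eq_add_neg, neg_neg, mul_add, neg_add]

/-- `superD` as a linear map. -/
def superDL : Ser →ₗ[ℂ] Ser where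
  toFun := superD
  map_add' u v := by
    simp only [superD, dx_add, dphi_add, mul_add]
    abel
  map_smul' c u := by
    simp only [superD, dx_smul, dphi_smul, mul_smul_comm, RingHom.id_apply, smul_add]

theorem superD_phi : superD phi = 1 := by simp [superD]

theorem superD_mul (u v : Ser) : superD (u * v) = superD u * v + par u * superD v := by
  simp only [superD, dx_mul, dphi_mul, mul_add, add_mul]
  rw [mul_left_comm_odd par_phi u, mul_assoc]
  abel

/-- The commutator of `D` with the field is a function times `D`. This is the infinitesimal form of
superconformality and the reason why the flow is superconformal. -/
theorem superD_vf {a b : Ser} (h : IsVF a b) (u : Ser) : superD (vf a b u) =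
    vf a b (superD u) + (-((1 / 2 : ℂ) • dx a) - phi * dx b) * superD u := by
  have ha' := par_dx_even h.even
  have hda : dphi (dx a) = 0 := by rw [← dx_dphi, h.dphi_even, dx_zero]
  have f1 : ∀ w, phi * (a * w) = a * (phi * w) := fun w => (mul_left_comm_even h.even _ _).symm
  have f2 : ∀ w, phi * (dx a * w) = dx a * (phi * w) := fun w => (mul_left_comm_even ha' _ _).symm
  have f2' : ∀ w, phi * (dx (dx a) * w) = dx (dx a) * (phi * w) :=
    fun w => (mul_left_comm_even (par_dx_even ha') _ _).symm
  have f3 : ∀ w, phi * (b * w) = -(b * (phi * w)) := fun w => by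
    rw [mul_left_comm_odd par_phi, h.odd, neg_mul]
  have f4 : ∀ w, phi * (dx b * w) = -(dx b * (phi * w)) := fun w => by
    rw [mul_left_comm_odd par_phi, par_dx_odd h.odd, neg_mul]
  simp only [superD, vf_apply, dx_mul, dphi_mul, dx_add, dx_sub, dx_neg, dx_smul, dphi_add,
    dphi_sub, dphi_neg, dphi_smul, h.even, h.odd, h.dphi_even, h.dphi_odd, hda, ha',
    dphi_phi, dx_phi, par_phi, dphi_dphi, dx_dphi, zero_mul, zero_add, mul_zero,
    add_zero, sub_zero, one_mul, neg_mul, mul_neg, neg_neg, mul_add, mul_sub, sub_mul,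
    smul_mul_assoc, mul_smul_comm, f1, f2, f2', f3, f4, phi_mul_phi_mul, mul_assoc, smul_zero,
    neg_zero]
  module

theorem coef_alpha_mul (n : ℤ) (u : Ser) (s e k) :
    coef (alpha n * u) s e k = LaurentPolynomial.T n * coef u s e k := by
  unfold alpha
  rw [coef_eq, ofAlpha_eq, cf_ofX_mul, ← LaurentPolynomial.smul_eq_C_mul,
    AddMonoidAlgebra.coeff_smul_apply, smul_eq_mul, coef_eq]

theorem scale_dx (n : ℤ) (u : Ser) : scale n (dx u) = alpha (-2 * n) * dx (scale n u) := by
  refine ser_ext_coef fun s e k => ?_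
  rw [coef_scale, coef_dx, coef_alpha_mul, coef_dx, coef_scale,
    mul_left_comm (LaurentPolynomial.T (-2 * n)), ← mul_assoc (LaurentPolynomial.T (-2 * n)),
    ← LaurentPolynomial.T_add, mul_left_comm]
  congr 3
  ring

theorem scale_dphi (n : ℤ) (u : Ser) : scale n (dphi u) = alpha (-n) * dphi (scale n u) := by
  refine ser_ext_coef fun s e k => ?_
  rw [coef_scale, coef_alpha_mul, coef_eq, coef_eq, cf_dphi, cf_dphi]
  split_ifs with h
  · simp
  · rw [← coef_eq, ← coef_eq, coef_scale, ← mul_assoc, ← LaurentPolynomial.T_add,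
      if_pos (mem_insert_self _ _)]
    congr 2
    ring

theorem alpha_comm (n : ℤ) (u : Ser) : alpha n * u = u * alpha n := even_mul_comm (par_alpha n) u

theorem alpha_left_comm (n : ℤ) (u v : Ser) : u * (alpha n * v) = alpha n * (u * v) :=
  (mul_left_comm_even (par_alpha n) u v).symm

theorem alpha_mul_alpha_mul (m n : ℤ) (u : Ser) : alpha m * (alpha n * u) = alpha (m + n) * u := by
  rw [alpha_add, mul_assoc]

theorem scale_sub (n : ℤ) (u v : Ser) : scale n (u - v) = scale n u - scale n v := by
  simp only [← scaleL_apply, map_sub]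
theorem scale_add (n : ℤ) (u v : Ser) : scale n (u + v) = scale n u + scale n v := by
  simp only [← scaleL_apply, map_add]
theorem scale_neg (n : ℤ) (u : Ser) : scale n (-u) = -scale n u := by
  simp only [← scaleL_apply, map_neg]
theorem scale_smul (n : ℤ) (c : ℂ) (u : Ser) : scale n (c • u) = c • scale n u := by
  simp only [← scaleL_apply, map_smul]

/-- Conjugation by the scaling preserves the form of the field; the extra powers of `alpha` reflect
the weights -2 of ∂/∂x and -1 of ∂/∂φ. -/
theorem scale_vf (n : ℤ) (a b u : Ser) : scale n (vf a b u) =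
    vf (alpha (-2 * n) * scale n a) (alpha (-n) * scale n b) (scale n u) := by
  simp only [vf_apply, scale_sub, scale_add, scale_neg, scale_smul, scale_mul, scale_dx, scale_dphi,
    scale_phi, dx_mul, dx_alpha, zero_mul, zero_add, mul_assoc, alpha_left_comm _ (scale _ _),
    alpha_left_comm _ phi, alpha_left_comm _ (dx _), alpha_mul_alpha_mul, mul_sub]
  have e1 : -2 * n + (n + -n) = -2 * n := by ring
  have e2 : n + -2 * n = -n := by ring
  rw [e1, e2]

/-- `superD` and `scale`. -/
theorem superD_scale (n : ℤ) (u : Ser) : superD (scale n u) = alpha n * scale n (superD u) := by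
  have e1 : dphi (scale n u) = alpha n * scale n (dphi u) := by
    rw [scale_dphi, alpha_mul_alpha_mul, add_neg_cancel, alpha_zero, one_mul]
  have e2 : dx (scale n u) = alpha (2 * n) * scale n (dx u) := by
    rw [scale_dx, alpha_mul_alpha_mul, show 2 * n + -2 * n = 0 by ring, alpha_zero, one_mul]
  rw [superD, superD, e1, e2, scale_add, scale_mul, scale_phi, alpha_left_comm, mul_add, mul_assoc,
    alpha_mul_alpha_mul, two_mul]

theorem isVF_scale {a b : Ser} (h : IsVF a b) (m l n : ℤ) :
    IsVF (alpha m * scale n a) (alpha l * scale n b) where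
  even := by rw [par_mul, par_alpha, par_scale, h.even]
  odd := by rw [par_mul, par_alpha, par_scale, h.odd, scale_neg, mul_neg]
  dphi_even := by
    have : dphi (scale n a) = alpha n * scale n (dphi a) := by
      rw [scale_dphi, alpha_mul_alpha_mul, add_neg_cancel, alpha_zero, one_mul]
    have h0 : scale n 0 = 0 := by rw [← scaleL_apply, map_zero]
    rw [dphi_mul, dphi_alpha, this, h.dphi_even, h0, zero_mul, mul_zero, mul_zero, add_zero]
  dphi_odd := by
    have : dphi (scale n b) = alpha n * scale n (dphi b) := by
      rw [scale_dphi, alpha_mul_alpha_mul, add_neg_cancel, alpha_zero, one_mul]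
    have h0 : scale n 0 = 0 := by rw [← scaleL_apply, map_zero]
    rw [dphi_mul, dphi_alpha, this, h.dphi_odd, h0, zero_mul, mul_zero, mul_zero, add_zero]

theorem IsVF.neg {a b : Ser} (h : IsVF a b) : IsVF (-a) (-b) where
  even := by rw [map_neg, h.even]
  odd := by rw [map_neg, h.odd]
  dphi_even := by rw [dphi_neg, h.dphi_even, neg_zero]
  dphi_odd := by rw [dphi_neg, h.dphi_odd, neg_zero]

theorem IsVF.add {a b a' b' : Ser} (h : IsVF a b) (h' : IsVF a' b') : IsVF (a + a') (b + b') where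
  even := by rw [map_add, h.even, h'.even]
  odd := by rw [map_add, h.odd, h'.odd, neg_add]
  dphi_even := by rw [dphi_add, h.dphi_even, h'.dphi_even, zero_add]
  dphi_odd := by rw [dphi_add, h.dphi_odd, h'.dphi_odd, zero_add]

theorem vf_neg (a b u : Ser) : vf (-a) (-b) u = -vf a b u := by
  simp only [vf_apply, dx_neg, neg_mul, smul_neg]
  abel

theorem vf_sub (a b a' b' u : Ser) : vf (a - a') (b - b') u = vf a b u - vf a' b' u := by
  simp only [vf_apply, dx_sub, sub_mul, smul_sub]
  abel

theorem vf_add (a b a' b' u : Ser) : vf (a + a') (b + b') u = vf a b u + vf a' b' u := by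
  simp only [vf_apply, dx_add, add_mul, smul_add]
  abel

/-- With `vf_phi`: when `a` and `b` are free of φ, the φ-free parts of the images of x and φ are
`-a` and `-b`, so the field can be read off from these images. -/
theorem vf_xpow_one (a b : Ser) : vf a b (xpow 1) = -a + b * phi := by
  simp [vf_apply, dx_xpow]

theorem vf_phi (a b : Ser) : vf a b phi = -((1 / 2 : ℂ) • (dx a * phi)) - b := by
  simp [vf_apply]

/-! ### Scalars -/

theorem dx_eq_zero_of_isScalar {r : Ser} (h : IsScalar r) : dx r = 0 := by
  refine ser_ext_coef fun s e k => ?_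
  rw [coef_dx]
  by_cases hc : coef r s e (k + 1) = 0
  · rw [hc, mul_zero]; rfl
  · rw [(h _ _ _ hc).2]; simp [coef_eq]

theorem dphi_eq_zero_of_isScalar {r : Ser} (h : IsScalar r) : dphi r = 0 := by
  refine ser_ext_coef fun s e k => ?_
  rw [coef_eq, cf_dphi]
  split_ifs with hs
  · rfl
  · by_contra hc
    exact (h (insert ⊥ s) e k hc).1 (mem_insert_self _ _)

theorem vf_scalar (a b : Ser) {r : Ser} (h : IsScalar r) : vf a b r = 0 := by
  simp [vf_apply, dx_eq_zero_of_isScalar h, dphi_eq_zero_of_isScalar h]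

theorem scale_scalar (n : ℤ) {r : Ser} (h : IsScalar r) : scale n r = r := by
  refine ser_ext_coef fun s e k => ?_
  rw [coef_scale]
  by_cases hc : coef r s e k = 0
  · rw [hc, mul_zero]
  · obtain ⟨h1, h2⟩ := h _ _ _ hc
    simp [h1, h2]

/-! ### Local operators and the degree filtration -/

/-- The degree of a monomial in the variables other than `x` and `φ`. -/
def deg (s : Finset OddVarPhi) (e : EvenVar →₀ ℕ) : ℕ := (s.erase ⊥).card + e.degree

/-- The series vanishes on the monomials in `Λ`. -/
def Van (Λ : Finset OddVarPhi → (EvenVar →₀ ℕ) → Prop) (u : Ser) : Prop :=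
  ∀ s e, Λ s e → cf u s e = 0

/-- The set of monomials is closed under divisors, and does not depend on `φ`. -/
def LowerMon (Λ : Finset OddVarPhi → (EvenVar →₀ ℕ) → Prop) : Prop :=
  ∀ s e t a, Λ s e → t ⊆ insert ⊥ s → a ≤ e → Λ t a

/-- The coefficients of the image depend only on the coefficients of divisors. -/
def LocalOp (C : Ser →ₗ[ℂ] Ser) : Prop :=
  ∀ u s e, (∀ t a, t ⊆ insert ⊥ s → a ≤ e → cf u t a = 0) → cf (C u) s e = 0

/-- The series contains only monomials of degree at least `d`. -/
def Ord (d : ℕ) (u : Ser) : Prop := Van (fun s e => deg s e < d) u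

theorem deg_mono {s t : Finset OddVarPhi} {e a : EvenVar →₀ ℕ} (h : t ⊆ insert ⊥ s) (h' : a ≤ e) :
    deg t a ≤ deg s e := by
  refine add_le_add (card_le_card fun x hx => ?_) (Finsupp.degree_mono h')
  rw [mem_erase] at hx ⊢
  exact ⟨hx.1, (mem_insert.1 (h hx.2)).resolve_left hx.1⟩

theorem lowerMon_deg (d : ℕ) : LowerMon (fun s e => deg s e < d) :=
  fun _ _ _ _ h h1 h2 => (deg_mono h1 h2).trans_lt h

theorem LocalOp.van {C : Ser →ₗ[ℂ] Ser} (hC : LocalOp C)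
    {Λ : Finset OddVarPhi → (EvenVar →₀ ℕ) → Prop} (hΛ : LowerMon Λ) {u : Ser} (h : Van Λ u) :
    Van Λ (C u) :=
  fun s e hs => hC u s e fun t a h1 h2 => h t a (hΛ s e t a hs h1 h2)

section Van
variable {Λ : Finset OddVarPhi → (EvenVar →₀ ℕ) → Prop} {u v w : Ser}

theorem Van.zero : Van Λ 0 := fun _ _ _ => rfl
theorem Van.add (hu : Van Λ u) (hv : Van Λ v) : Van Λ (u + v) := fun s e h => by
  rw [cf_add, hu s e h, hv s e h, add_zero]
theorem Van.sub (hu : Van Λ u) (hv : Van Λ v) : Van Λ (u - v) := fun s e h => by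
  rw [cf_sub, hu s e h, hv s e h, sub_zero]
theorem Van.neg (hu : Van Λ u) : Van Λ (-u) := fun s e h => by
  rw [cf_neg, hu s e h, neg_zero]
theorem Van.smul (c : ℂ) (hu : Van Λ u) : Van Λ (c • u) := fun s e h => by
  rw [cf_smul, hu s e h, smul_zero]
theorem Van.sum {ι : Type*} {t : Finset ι} {f : ι → Ser} (h : ∀ i ∈ t, Van Λ (f i)) :
    Van Λ (∑ i ∈ t, f i) := fun s e hs => by
  rw [cf_sum]
  exact sum_eq_zero fun i hi => h i hi s e hs
theorem Van.trans (h : Van Λ (u - v)) (h' : Van Λ (v - w)) : Van Λ (u - w) := by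
  have := h.add h'
  rwa [sub_add_sub_cancel] at this
theorem Van.symm (h : Van Λ (u - v)) : Van Λ (v - u) := by
  have := h.neg
  rwa [neg_sub] at this

end Van

theorem Ord.mono {d d' : ℕ} (h : d' ≤ d) {u : Ser} (hu : Ord d u) : Ord d' u :=
  fun s e hs => hu s e (hs.trans_le h)

theorem ord_zero (u : Ser) : Ord 0 u := fun _ _ h => absurd h (Nat.not_lt_zero _)

/-- The degree filtration is separated, so identities between exponentials may be checked modulo
each degree, where finite sums suffice. -/
theorem eq_of_ord_sub {u v : Ser} (h : ∀ N, Ord N (u - v)) : u = v :=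
  ser_ext fun s e => sub_eq_zero.1 (h (deg s e + 1) s e (Nat.lt_succ_self _))

theorem cf_mul_eq_zero {u v : Ser} {s : Finset OddVarPhi} {e : EvenVar →₀ ℕ}
    (h : ∀ t a b, t ⊆ s → a + b = e → cf u t a = 0 ∨ cf v (s \ t) b = 0) : cf (u * v) s e = 0 := by
  rw [cf_mul]
  refine sum_eq_zero fun t ht => sum_eq_zero fun p hp => ?_
  rcases h t p.1 p.2 (mem_powerset.1 ht) (mem_antidiagonal.1 hp) with h | h <;> simp [h]

theorem deg_split {s t : Finset OddVarPhi} (h : t ⊆ s) (a b : EvenVar →₀ ℕ) :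
    deg t a + deg (s \ t) b = deg s (a + b) := by
  unfold deg
  have : (s.erase ⊥).card = (t.erase ⊥).card + ((s \ t).erase ⊥).card := by
    rw [← card_union_of_disjoint]
    · congr 1
      ext x
      simp only [mem_erase, mem_union, mem_sdiff]
      constructor
      · rintro ⟨h1, h2⟩
        by_cases hx : x ∈ t
        · exact Or.inl ⟨h1, hx⟩
        · exact Or.inr ⟨h1, h2, hx⟩
      · rintro (⟨h1, h2⟩ | ⟨h1, h2, _⟩)
        · exact ⟨h1, h h2⟩
        · exact ⟨h1, h2⟩
    · exact (disjoint_sdiff (s := t) (t := s)).mono (erase_subset _ _) (erase_subset _ _)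
  rw [this, map_add]
  ring

theorem Ord.mul {m n : ℕ} {u v : Ser} (hu : Ord m u) (hv : Ord n v) : Ord (m + n) (u * v) := by
  intro s e hs
  refine cf_mul_eq_zero fun t a b ht hab => ?_
  have := deg_split ht a b
  rw [hab] at this
  by_cases h : deg t a < m
  · exact Or.inl (hu t a h)
  · exact Or.inr (hv _ b (by omega))

theorem localOp_mul_left (a : Ser) : LocalOp (LinearMap.mulLeft ℂ a) := by
  intro u s e h
  refine cf_mul_eq_zero fun t c b ht hab => Or.inr (h _ _ ?_ ?_)
  · exact sdiff_subset.trans (subset_insert _ _)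
  · exact hab ▸ le_add_self

theorem localOp_mul_right (a : Ser) : LocalOp (LinearMap.mulRight ℂ a) := by
  intro u s e h
  refine cf_mul_eq_zero fun t c b ht hab => Or.inl (h _ _ ?_ ?_)
  · exact ht.trans (subset_insert _ _)
  · exact hab ▸ le_self_add

theorem localOp_dx : LocalOp dxL := by
  intro u s e h
  change cf (dx u) s e = 0
  rw [cf_dx, h s e (subset_insert _ _) le_rfl, laurentMap_zero]

theorem localOp_dphi : LocalOp dphiL := by
  intro u s e h
  change cf (dphi u) s e = 0
  rw [cf_dphi, h _ e subset_rfl le_rfl, ite_self]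

theorem localOp_cmap (f g) : LocalOp (cmap f g) := by
  intro u s e h
  rw [cf_cmap, h s e (subset_insert _ _) le_rfl, map_zero, map_zero, ite_self]

theorem localOp_scale (n : ℤ) : LocalOp (scaleL n) := localOp_cmap _ _

theorem localOp_par : LocalOp par := by
  intro u s e h
  rw [cf_par, h s e (subset_insert _ _) le_rfl, smul_zero]

theorem LocalOp.comp {C C' : Ser →ₗ[ℂ] Ser} (h : LocalOp C) (h' : LocalOp C') :
    LocalOp (C ∘ₗ C') := by
  intro u s e hu
  refine h _ s e fun t a ht ha => h' u t a fun t' a' ht' ha' => hu t' a' ?_ (ha'.trans ha)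
  refine ht'.trans (insert_subset (mem_insert_self _ _) ht)

theorem LocalOp.neg {C : Ser →ₗ[ℂ] Ser} (h : LocalOp C) : LocalOp (-C) := by
  intro u s e hu
  rw [LinearMap.neg_apply, cf_neg, h u s e hu, neg_zero]

section Van
variable {Λ : Finset OddVarPhi → (EvenVar →₀ ℕ) → Prop} {u : Ser}

theorem LowerMon.mul_left (hΛ : LowerMon Λ) (a : Ser) (h : Van Λ u) : Van Λ (a * u) :=
  (localOp_mul_left a).van hΛ h
theorem LowerMon.mul_right (hΛ : LowerMon Λ) (a : Ser) (h : Van Λ u) : Van Λ (u * a) :=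
  (localOp_mul_right a).van hΛ h
theorem LowerMon.dx (hΛ : LowerMon Λ) (h : Van Λ u) : Van Λ (dx u) := localOp_dx.van hΛ h
theorem LowerMon.dphi (hΛ : LowerMon Λ) (h : Van Λ u) : Van Λ (dphi u) := localOp_dphi.van hΛ h
theorem LowerMon.scale (hΛ : LowerMon Λ) (n : ℤ) (h : Van Λ u) : Van Λ (scale n u) := by
  rw [← scaleL_apply]; exact (localOp_scale n).van hΛ h
theorem LowerMon.superD (hΛ : LowerMon Λ) (h : Van Λ u) : Van Λ (superD u) :=
  (hΛ.dphi h).add (hΛ.mul_left _ (hΛ.dx h))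

theorem LowerMon.vf_right (hΛ : LowerMon Λ) (a b : Ser) (h : Van Λ u) : Van Λ (vf a b u) := by
  rw [vf_apply]
  have h1 := hΛ.dx h
  have h2 := hΛ.dphi h
  exact ((hΛ.mul_left _ h1).add ((hΛ.mul_left _ (hΛ.mul_left _ h2)).smul _)).neg.sub
    (hΛ.mul_left _ (h2.sub (hΛ.mul_left _ h1)))

theorem LowerMon.vf_left (hΛ : LowerMon Λ) {a b : Ser} (ha : Van Λ a) (hb : Van Λ b) (u : Ser) :
    Van Λ (vf a b u) := by
  rw [vf_apply]
  exact ((hΛ.mul_right _ ha).add ((hΛ.mul_right _ (hΛ.dx ha)).smul _)).neg.sub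
    (hΛ.mul_right _ hb)

end Van

/-- The monomials dividing a given one, up to `φ`. -/
theorem lowerMon_divisors (s : Finset OddVarPhi) (e : EvenVar →₀ ℕ) :
    LowerMon (fun t a => t ⊆ insert ⊥ s ∧ a ≤ e) :=
  fun _ _ _ _ h h1 h2 =>
    ⟨h1.trans (insert_subset (mem_insert_self _ _) h.1), h2.trans h.2⟩

/-- The divisors of a monomial form one of the admissible sets `Λ`, and vanishing on that set is
what locality asks for. -/
theorem localOp_of_van {C : Ser →ₗ[ℂ] Ser} (h : ∀ Λ, LowerMon Λ → ∀ u, Van Λ u → Van Λ (C u)) :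
    LocalOp C := fun u s e hu =>
  h _ (lowerMon_divisors s e) u (fun t a ha => hu t a ha.1 ha.2) s e ⟨subset_insert _ _, le_rfl⟩

theorem localOp_vf (a b : Ser) : LocalOp (vf a b) :=
  localOp_of_van fun _ hΛ _ h => hΛ.vf_right a b h

theorem localOp_superD : LocalOp superDL := localOp_of_van fun _ hΛ _ h => hΛ.superD h

theorem LocalOp.ord {C : Ser →ₗ[ℂ] Ser} (hC : LocalOp C) {d : ℕ} {u : Ser} (h : Ord d u) :
    Ord d (C u) := hC.van (lowerMon_deg d) h

/-- The operator raises the degree by at least `m`. -/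
def Raises (m : ℕ) (P : Ser →ₗ[ℂ] Ser) : Prop := ∀ d u, Ord d u → Ord (d + m) (P u)

theorem raises_mulLeft {m : ℕ} {a : Ser} (h : Ord m a) : Raises m (LinearMap.mulLeft ℂ a) :=
  fun d _ hu => add_comm m d ▸ h.mul hu

theorem Raises.add {m : ℕ} {P Q : Ser →ₗ[ℂ] Ser} (hP : Raises m P) (hQ : Raises m Q) :
    Raises m (P + Q) := fun d u hu => (hP d u hu).add (hQ d u hu)

theorem raises_vf {m : ℕ} {a b : Ser} (ha : Ord m a) (hb : Ord m b) : Raises m (vf a b) := by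
  intro d u hu
  rw [vf_apply, add_comm d m]
  have h1 : Ord d (dx u) := (lowerMon_deg d).dx hu
  have h2 : Ord d (dphi u) := (lowerMon_deg d).dphi hu
  have h3 : Ord m (dx a) := (lowerMon_deg m).dx ha
  exact ((ha.mul h1).add ((h3.mul ((lowerMon_deg d).mul_left phi h2)).smul _)).neg.sub
    (hb.mul (h2.sub ((lowerMon_deg d).mul_left phi h1)))

theorem Raises.pow {P : Ser →ₗ[ℂ] Ser} (hP : Raises 1 P) (n d : ℕ) {u : Ser} (hu : Ord d u) :
    Ord (d + n) ((P ^ n) u) := by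
  induction n with
  | zero => exact hu
  | succ n ih =>
    rw [pow_succ', Module.End.mul_apply]
    exact hP _ _ ih

theorem Raises.pow_apply {P : Ser →ₗ[ℂ] Ser} (hP : Raises 1 P) (n : ℕ) (u : Ser) :
    Ord n ((P ^ n) u) := by
  simpa using hP.pow n 0 (ord_zero u)

/-! ### Exponentials -/

/-- The exponential of an operator which raises the degree. -/
def expo (P : Ser →ₗ[ℂ] Ser) : Ser →ₗ[ℂ] Ser where
  toFun u := mkSer fun s e =>
    ∑ n ∈ range (deg s e + 1), ((n.factorial : ℂ)⁻¹) • cf ((P ^ n) u) s e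
  map_add' u v := ser_ext fun s e => by
    simp only [cf_mkSer, cf_add, map_add, smul_add, sum_add_distrib]
  map_smul' c u := ser_ext fun s e => by
    simp only [cf_mkSer, cf_smul, map_smul, RingHom.id_apply, smul_sum]
    exact sum_congr rfl fun n _ => smul_comm _ _ _

theorem cf_expo (P : Ser →ₗ[ℂ] Ser) (u : Ser) (s e) : cf (expo P u) s e =
    ∑ n ∈ range (deg s e + 1), ((n.factorial : ℂ)⁻¹) • cf ((P ^ n) u) s e := rfl

/-- The partial sums of the exponential series. -/
def expPartial (P : Ser →ₗ[ℂ] Ser) (N : ℕ) (u : Ser) : Ser :=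
  ∑ n ∈ range N, ((n.factorial : ℂ)⁻¹) • (P ^ n) u

/-- The power `P ^ n` has no terms of degree below `n`, so cutting the sum in `expo` at the degree
of the monomial loses nothing. -/
theorem expo_approx {P : Ser →ₗ[ℂ] Ser} (hP : Raises 1 P) (N : ℕ) (u : Ser) :
    Ord N (expo P u - expPartial P N u) := by
  intro s e hs
  rw [cf_sub, sub_eq_zero, cf_expo, expPartial, cf_sum]
  simp only [cf_smul]
  refine sum_subset (range_subset_range.2 hs) fun n _ hn => ?_
  rw [hP.pow_apply n u s e (by simpa using hn), smul_zero]

theorem LocalOp.pow {P : Ser →ₗ[ℂ] Ser} (hP : LocalOp P) (n : ℕ) : LocalOp (P ^ n) := by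
  induction n with
  | zero => intro u s e h; exact h s e (subset_insert _ _) le_rfl
  | succ n ih => rw [pow_succ']; exact hP.comp ih

theorem LocalOp.expo {P : Ser →ₗ[ℂ] Ser} (hP : LocalOp P) : LocalOp (expo P) := by
  intro u s e h
  rw [cf_expo]
  exact sum_eq_zero fun n _ => by rw [hP.pow n u s e h, smul_zero]

theorem van_pow_sub {Λ : Finset OddVarPhi → (EvenVar →₀ ℕ) → Prop} (hΛ : LowerMon Λ)
    {P Q : Ser →ₗ[ℂ] Ser} (hP : LocalOp P) (h : ∀ u, Van Λ (P u - Q u)) (n : ℕ) (u : Ser) :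
    Van Λ ((P ^ n) u - (Q ^ n) u) := by
  induction n with
  | zero => simpa using Van.zero
  | succ n ih =>
    rw [pow_succ', pow_succ', Module.End.mul_apply, Module.End.mul_apply]
    refine Van.trans ?_ (h _)
    rw [← map_sub]
    exact hP.van hΛ ih

/-- Used for the degree filtration as well as for setting (𝒜, ℳ) or (ℬ, 𝒩) equal to zero: an
exponential modulo `Λ` depends only on the operator modulo `Λ`. -/
theorem van_expo_sub {Λ : Finset OddVarPhi → (EvenVar →₀ ℕ) → Prop} (hΛ : LowerMon Λ)
    {P Q : Ser →ₗ[ℂ] Ser} (hP : LocalOp P) (h : ∀ u, Van Λ (P u - Q u)) (u : Ser) :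
    Van Λ (expo P u - expo Q u) := by
  intro s e hs
  rw [cf_sub, cf_expo, cf_expo, ← sum_sub_distrib]
  refine sum_eq_zero fun n _ => ?_
  rw [← smul_sub, ← cf_sub, van_pow_sub hΛ hP h n u s e hs, smul_zero]

/-- The square and the triangle differ only in terms with `i + j ≥ N`. This compares products of
truncated exponential series with truncated Cauchy products. -/
theorem ord_double_sum {f : ℕ → ℕ → Ser} (hf : ∀ i j, Ord (i + j) (f i j)) (N : ℕ) :
    Ord N (∑ i ∈ range N, ∑ j ∈ range N, f i j -
      ∑ n ∈ range N, ∑ p ∈ antidiagonal n, f p.1 p.2) := by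
  have : ∑ n ∈ range N, ∑ p ∈ antidiagonal n, f p.1 p.2 =
      ∑ i ∈ range N, ∑ j ∈ range (N - i), f i j := by
    rw [← sum_range_diag_flip]
    exact sum_congr rfl fun n _ => Nat.sum_antidiagonal_eq_sum_range_succ_mk _ _
  rw [this]
  intro s e hs
  rw [cf_sub, sub_eq_zero, cf_sum, cf_sum]
  refine sum_congr rfl fun i _ => ?_
  rw [cf_sum, cf_sum]
  refine (sum_subset (range_subset_range.2 (Nat.sub_le _ _)) fun j _ hj => ?_).symm
  exact hf i j s e (by rw [mem_range] at hj; omega)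

/-- Three operators are allowed because the twisted field in `scHom_evf`, a vector field plus a
multiplication, satisfies the Leibniz rule only relative to the untwisted one. -/
theorem pow_leibniz {P Q R : Ser →ₗ[ℂ] Ser} (h : ∀ u v, P (u * v) = Q u * v + u * R v) (n : ℕ)
    (u v : Ser) : (P ^ n) (u * v) =
      ∑ p ∈ antidiagonal n, n.choose p.1 • ((Q ^ p.1) u * (R ^ p.2) v) := by
  induction n with
  | zero => simp
  | succ n ih =>
    rw [sum_antidiagonal_choose_succ_nsmul (fun i j => (Q ^ i) u * (R ^ j) v) n, pow_succ',
      Module.End.mul_apply, ih, map_sum, ← sum_add_distrib]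
    refine sum_congr rfl fun p hp => ?_
    rw [map_nsmul, h, ← Module.End.mul_apply, ← pow_succ', ← Module.End.mul_apply, ← pow_succ',
      Nat.choose_symm_of_eq_add (mem_antidiagonal.1 hp).symm, nsmul_add, add_comm]

theorem inv_factorial_mul_choose {n i j : ℕ} (h : i + j = n) :
    ((n.factorial : ℂ)⁻¹) * (n.choose i : ℂ) = ((i.factorial : ℂ)⁻¹) * ((j.factorial : ℂ)⁻¹) := by
  subst h
  have h1 : ((i + j).factorial : ℂ) ≠ 0 := Nat.cast_ne_zero.2 (Nat.factorial_ne_zero _)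
  have h2 : (i.factorial : ℂ) ≠ 0 := Nat.cast_ne_zero.2 (Nat.factorial_ne_zero _)
  have h3 : (j.factorial : ℂ) ≠ 0 := Nat.cast_ne_zero.2 (Nat.factorial_ne_zero _)
  have h4 : ((i + j).choose i * i.factorial * j.factorial : ℂ) = (i + j).factorial := by
    have := Nat.choose_mul_factorial_mul_factorial (Nat.le_add_right i j)
    rw [Nat.add_sub_cancel_left] at this
    exact_mod_cast this
  field_simp
  rw [← h4]

theorem Raises.expPartial_mem {P : Ser →ₗ[ℂ] Ser} (i : ℕ) (hP : Raises 1 P) (u : Ser) :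
    Ord i (((i.factorial : ℂ)⁻¹) • (P ^ i) u) := (hP.pow_apply i u).smul _

theorem expo_mul {P Q R : Ser →ₗ[ℂ] Ser} (hP : Raises 1 P) (hQ : Raises 1 Q) (hR : Raises 1 R)
    (h : ∀ u v, P (u * v) = Q u * v + u * R v) (u v : Ser) :
    expo P (u * v) = expo Q u * expo R v := by
  refine eq_of_ord_sub fun N => ?_
  refine Van.trans (expo_approx hP N _) ?_
  have h1 : Ord N (expo Q u * expo R v - expPartial Q N u * expPartial R N v) := by
    have e : expo Q u * expo R v - expPartial Q N u * expPartial R N v =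
      (expo Q u - expPartial Q N u) * expo R v +
        expPartial Q N u * (expo R v - expPartial R N v) := by
      rw [sub_mul, mul_sub]; abel
    rw [e]
    exact ((lowerMon_deg N).mul_right _ (expo_approx hQ N u)).add
      ((lowerMon_deg N).mul_left _ (expo_approx hR N v))
  refine Van.trans ?_ h1.symm
  have h2 := ord_double_sum (f := fun i j =>
    (((i.factorial : ℂ)⁻¹) • (Q ^ i) u) * (((j.factorial : ℂ)⁻¹) • (R ^ j) v))
    (fun i j => (hQ.expPartial_mem i u).mul (hR.expPartial_mem j v)) N
  have e1 : expPartial P N (u * v) = ∑ n ∈ range N, ∑ p ∈ antidiagonal n,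
      (((p.1.factorial : ℂ)⁻¹) • (Q ^ p.1) u) * (((p.2.factorial : ℂ)⁻¹) • (R ^ p.2) v) := by
    refine sum_congr rfl fun n _ => ?_
    rw [pow_leibniz h, smul_sum]
    refine sum_congr rfl fun p hp => ?_
    rw [smul_mul_assoc, mul_smul_comm, smul_smul,
      ← inv_factorial_mul_choose (mem_antidiagonal.1 hp), mul_smul, Nat.cast_smul_eq_nsmul]
  have e2 : expPartial Q N u * expPartial R N v = ∑ i ∈ range N, ∑ j ∈ range N,
      (((i.factorial : ℂ)⁻¹) • (Q ^ i) u) * (((j.factorial : ℂ)⁻¹) • (R ^ j) v) :=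
    sum_mul_sum _ _ _ _
  rw [e1, e2]
  exact Van.symm h2

theorem Raises.neg {m : ℕ} {P : Ser →ₗ[ℂ] Ser} (hP : Raises m P) : Raises m (-P) :=
  fun d u hu => (hP d u hu).neg

theorem ord_map_expPartial {P : Ser →ₗ[ℂ] Ser} (hP1 : Raises 1 P) (N : ℕ) (u : Ser)
    (C : Ser →ₗ[ℂ] Ser) (hC : LocalOp C) : Ord N (C (expo P u) - C (expPartial P N u)) := by
  rw [← map_sub]
  exact hC.ord (expo_approx hP1 N u)

theorem expo_neg_apply {P : Ser →ₗ[ℂ] Ser} (hP : LocalOp P) (hP1 : Raises 1 P) (u : Ser) :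
    expo P (expo (-P) u) = u := by
  refine eq_of_ord_sub fun N => ?_
  rcases Nat.eq_zero_or_pos N with rfl | hN
  · exact ord_zero _
  refine Van.trans (ord_map_expPartial hP1.neg N u _ hP.expo) ?_
  refine Van.trans (expo_approx hP1 N _) ?_
  have h2 := ord_double_sum (f := fun i j =>
    ((i.factorial : ℂ)⁻¹) • (P ^ i) (((j.factorial : ℂ)⁻¹) • ((-P) ^ j) u))
    (fun i j => by
      rw [add_comm]
      exact (hP1.pow i j (hP1.neg.expPartial_mem j u)).smul _) N
  have e1 : expPartial P N (expPartial (-P) N u) = ∑ i ∈ range N, ∑ j ∈ range N,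
      ((i.factorial : ℂ)⁻¹) • (P ^ i) (((j.factorial : ℂ)⁻¹) • ((-P) ^ j) u) := by
    refine sum_congr rfl fun i _ => ?_
    rw [expPartial, map_sum, smul_sum]
  rw [e1]
  refine Van.trans h2 ?_
  rw [sum_eq_single_of_mem 0 (mem_range.2 hN)]
  · simpa using Van.zero
  · intro n _ hn
    have : ∀ p ∈ antidiagonal n, ((p.1.factorial : ℂ)⁻¹) •
        (P ^ p.1) (((p.2.factorial : ℂ)⁻¹) • ((-P) ^ p.2) u) =
        (((n.factorial : ℂ)⁻¹) * ((-1) ^ p.2 * (n.choose p.1 : ℂ))) • (P ^ n) u := by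
      intro p hp
      rw [map_smul, smul_smul, ← inv_factorial_mul_choose (mem_antidiagonal.1 hp), neg_pow,
        Module.End.mul_apply, ← mem_antidiagonal.1 hp, pow_add, Module.End.mul_apply]
      have : ((-1 : Module.End ℂ Ser) ^ p.2) ((P ^ p.2) u) = ((-1 : ℂ) ^ p.2) • (P ^ p.2) u := by
        rcases Nat.even_or_odd p.2 with h | h
        · rw [h.neg_one_pow, h.neg_one_pow, one_smul]; rfl
        · rw [h.neg_one_pow, h.neg_one_pow, neg_smul, one_smul]; rfl
      rw [this, map_smul, smul_smul]
      ring_nf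
    rw [sum_congr rfl this, ← sum_smul, ← mul_sum]
    -- The binomial expansion of `(1 + (-1)) ^ n`.
    have key : ∑ p ∈ antidiagonal n, ((-1 : ℂ) ^ p.2 * (n.choose p.1 : ℂ)) = 0 := by
      have := (Commute.all (1 : ℂ) (-1)).add_pow' n
      rw [add_neg_cancel, zero_pow hn] at this
      rw [this]
      refine sum_congr rfl fun p _ => ?_
      simp [mul_comm]
    rw [key, mul_zero, zero_smul]

theorem expo_neg_apply' {P : Ser →ₗ[ℂ] Ser} (hP : LocalOp P) (hP1 : Raises 1 P) (u : Ser) :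
    expo (-P) (expo P u) = u := by
  have := expo_neg_apply hP.neg hP1.neg u
  rwa [neg_neg] at this

/-- Operators intertwined by a local operator have intertwined exponentials. -/
theorem expo_intertwine {P Q C : Ser →ₗ[ℂ] Ser} (hP1 : Raises 1 P)
    (hQ : Raises 1 Q) (hC : LocalOp C) (h : ∀ u, C (P u) = Q (C u)) (u : Ser) :
    C (expo P u) = expo Q (C u) := by
  refine eq_of_ord_sub fun N => ?_
  refine Van.trans (ord_map_expPartial hP1 N u C hC) ?_
  have : C (expPartial P N u) = expPartial Q N (C u) := by
    unfold expPartial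
    rw [map_sum]
    refine sum_congr rfl fun n _ => ?_
    have hn : C ((P ^ n) u) = (Q ^ n) (C u) := by
      induction n with
      | zero => rfl
      | succ n ih =>
        rw [pow_succ', pow_succ', Module.End.mul_apply, Module.End.mul_apply, h]
        exact congrArg Q (ih (by grind))
    rw [map_smul, hn]
  rw [this]
  exact (expo_approx hQ N _).symm

/-- Telescoping: in each summand one of the `n + 1` factors is the difference, which raises the
degree by `m`, and each of the other `n` raises it by one. -/
theorem raises_pow_sub {m : ℕ} {P Q : Ser →ₗ[ℂ] Ser} (hP : Raises 1 P) (hQ : Raises 1 Q)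
    (h : Raises m (P - Q)) (n : ℕ) (u : Ser) : Ord (n + m) ((P ^ (n + 1)) u - (Q ^ (n + 1)) u) := by
  induction n with
  | zero => simpa using h 0 u (ord_zero u)
  | succ n ih =>
    rw [pow_succ' P, pow_succ' Q, Module.End.mul_apply, Module.End.mul_apply]
    refine Van.trans (v := P ((Q ^ (n + 1)) u)) ?_ ?_
    · rw [← map_sub, add_right_comm]
      exact hP _ _ ih
    · exact h (n + 1) _ (hQ.pow_apply (n + 1) u)

theorem expPartial_sub {m : ℕ} {P Q : Ser →ₗ[ℂ] Ser} (hP : Raises 1 P)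
    (hQ : Raises 1 Q) (h : Raises m (P - Q)) (N : ℕ) (hN : 2 ≤ N) (u : Ser) :
    Ord (m + 1) (expPartial P N u - expPartial Q N u - (P - Q) u) := by
  obtain ⟨N, rfl⟩ := Nat.exists_eq_add_of_le' hN
  unfold expPartial
  rw [← sum_sub_distrib, sum_range_succ', sum_range_succ']
  simp only [zero_add, pow_one, pow_zero, Nat.factorial_one, Nat.factorial_zero, Nat.cast_one,
    inv_one, one_smul, Module.End.one_apply, sub_self, add_zero, LinearMap.sub_apply,
    add_sub_cancel_right]
  refine Van.sum fun n _ => ?_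
  rw [← smul_sub]
  refine Van.smul _ ?_
  exact (raises_pow_sub hP hQ h (n + 1) u).mono (by omega)

/-- First-order perturbation: in powers beyond the first, the difference `P - Q` is accompanied by
at least one more factor that raises the degree. -/
theorem expo_sub {m : ℕ} (hm : 1 ≤ m) {P Q : Ser →ₗ[ℂ] Ser} (hP : Raises 1 P)
    (hQ : Raises 1 Q) (h : Raises m (P - Q)) (u : Ser) :
    Ord (m + 1) (expo P u - expo Q u - (P - Q) u) := by
  have h1 := expo_approx hP (m + 1) u
  have h2 := expo_approx hQ (m + 1) u
  -- Since `1 ≤ m`, the truncation at `m + 1` still contains the linear term.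
  have h3 := expPartial_sub hP hQ h (m + 1) (by omega) u
  have h4 := (h1.sub h2).add h3
  have e : expo P u - expo Q u - (P - Q) u = expo P u - expPartial P (m + 1) u -
      (expo Q u - expPartial Q (m + 1) u) +
      (expPartial P (m + 1) u - expPartial Q (m + 1) u - (P - Q) u) := by abel
  rw [e]
  exact h4

theorem expo_sub_self {P : Ser →ₗ[ℂ] Ser} (hP : Raises 1 P) {d : ℕ} {u : Ser} (hu : Ord d u) :
    Ord (d + 1) (expo P u - u) := by
  refine Van.trans (expo_approx hP (d + 1) u) ?_
  unfold expPartial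
  rw [sum_range_succ']
  simp only [pow_zero, Nat.factorial_zero, Nat.cast_one, inv_one, one_smul, Module.End.one_apply,
    add_sub_cancel_right]
  exact Van.sum fun n _ => ((hP.pow (n + 1) d hu).mono (by omega)).smul _

theorem expo_of_apply_eq_zero {P : Ser →ₗ[ℂ] Ser} {u : Ser} (h : P u = 0) : expo P u = u := by
  refine ser_ext fun s e => ?_
  rw [cf_expo, sum_range_succ', sum_eq_zero, zero_add]
  · simp
  · intro n _
    rw [pow_succ, Module.End.mul_apply, h, map_zero, cf_zero, smul_zero]

/-! ### Substitution homomorphisms -/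

/-- A local algebra endomorphism which fixes the scalars. -/
structure RHom (E : Ser →ₗ[ℂ] Ser) : Prop where
  loc : LocalOp E
  scalar : ∀ r, IsScalar r → E r = r
  mul : ∀ u v, E (u * v) = E u * E v

/-- A local even algebra endomorphism which fixes the scalars and is superconformal. -/
structure SCHom (E : Ser →ₗ[ℂ] Ser) : Prop extends RHom E where
  par : ∀ u, par (E u) = E (par u)
  superD : ∀ u, superD (E u) = superD (E phi) * E (superD u)

theorem RHom.comp {E E' : Ser →ₗ[ℂ] Ser} (h : RHom E) (h' : RHom E') : RHom (E ∘ₗ E') where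
  loc := h.loc.comp h'.loc
  scalar r hr := by rw [LinearMap.comp_apply, h'.scalar r hr, h.scalar r hr]
  mul u v := by simp only [LinearMap.comp_apply, h'.mul, h.mul]

theorem SCHom.comp {E E' : Ser →ₗ[ℂ] Ser} (h : SCHom E) (h' : SCHom E') : SCHom (E ∘ₗ E') where
  toRHom := h.toRHom.comp h'.toRHom
  par u := by simp only [LinearMap.comp_apply, h.par, h'.par]
  superD u := by
    simp only [LinearMap.comp_apply]
    rw [h.superD, h'.superD, h.mul, ← mul_assoc, ← h.superD]

theorem superD_eq_zero_of_isScalar {r : Ser} (h : IsScalar r) : superD r = 0 := by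
  rw [superD, dx_eq_zero_of_isScalar h, dphi_eq_zero_of_isScalar h, mul_zero, add_zero]

theorem isScalar_alpha (n : ℤ) : IsScalar (alpha n) := by
  intro s e k h
  unfold alpha at h
  rw [ofAlpha_eq, coef_eq, cf_ofX] at h
  split_ifs at h with hs
  · refine ⟨by simp [hs.1], ?_⟩
    by_contra hk
    exact h (by simp [hk])
  · exact absurd rfl h

theorem isScalar_ofAlpha (c : AlphaRing) : IsScalar (ofAlpha c) := by
  intro s e k h
  rw [ofAlpha_eq, coef_eq, cf_ofX] at h
  split_ifs at h with hs
  · refine ⟨by simp [hs.1], ?_⟩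
    by_contra hk
    exact h (by simp [hk])
  · exact absurd rfl h

theorem isScalar_mono {t : Finset OddVarPhi} (ht : ⊥ ∉ t) (a : EvenVar →₀ ℕ) :
    IsScalar (mono t (MvPowerSeries.monomial a 1)) := by
  classical
  intro s e k h
  rw [coef_eq, cf_mono] at h
  split_ifs at h with hs
  · refine ⟨hs ▸ ht, ?_⟩
    by_contra hk
    rw [MvPowerSeries.coeff_monomial] at h
    split_ifs at h
    · refine h ?_
      rw [AddMonoidAlgebra.one_def, AddMonoidAlgebra.coeff_single, Finsupp.single_apply,
        if_neg (Ne.symm hk)]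
    · exact h rfl
  · exact absurd rfl h

theorem isScalar_one : IsScalar 1 := by
  rw [← alpha_zero]; exact isScalar_alpha 0

theorem RHom.map_one {E : Ser →ₗ[ℂ] Ser} (h : RHom E) : E 1 = 1 := h.scalar 1 isScalar_one

theorem scHom_scale (n : ℤ) : SCHom (scaleL n) where
  loc := localOp_scale n
  scalar r hr := by rw [scaleL_apply, scale_scalar n hr]
  mul u v := by simp only [scaleL_apply, scale_mul]
  par u := by simp only [scaleL_apply, par_scale]
  superD u := by
    simp only [scaleL_apply, superD_scale, superD_phi]
    rw [← scaleL_apply n 1, ← ofX_one, scaleL_apply, scale_ofX, AddMonoidAlgebra.one_def,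
      laurentMap_single]
    simp [← AddMonoidAlgebra.one_def]

/-- The data of a vector field with even coefficient `a` and odd coefficient `b`, without
constant terms. -/
structure GoodVF (a b : Ser) : Prop extends IsVF a b where
  ord_even : Ord 1 a
  ord_odd : Ord 1 b

theorem GoodVF.raises {a b : Ser} (h : GoodVF a b) : Raises 1 (vf a b) :=
  raises_vf h.ord_even h.ord_odd

theorem GoodVF.neg {a b : Ser} (h : GoodVF a b) : GoodVF (-a) (-b) where
  toIsVF := h.toIsVF.neg
  ord_even := h.ord_even.neg
  ord_odd := h.ord_odd.neg

theorem vf_neg_eq (a b : Ser) : vf (-a) (-b) = -vf a b := LinearMap.ext fun u => vf_neg a b u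

/-- The exponential of a vector field. -/
def evf (a b : Ser) : Ser →ₗ[ℂ] Ser := expo (vf a b)

/-- The exponential of an even derivation is multiplicative and commutes with `par`. With `w` the
function in the commutator of `superD` and the field, `superD` intertwines the exponentials of the
field and of the field plus multiplication by `w`. -/
theorem scHom_evf {a b : Ser} (h : GoodVF a b) : SCHom (evf a b) := by
  have hmul : ∀ u v, evf a b (u * v) = evf a b u * evf a b v :=
    expo_mul h.raises h.raises h.raises (vf_mul h.toIsVF)
  set w : Ser := -((1 / 2 : ℂ) • dx a) - phi * dx b with hw
  have hw1 : Ord 1 w := by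
    have h1 : Ord 1 (dx a) := (lowerMon_deg 1).dx h.ord_even
    have h2 : Ord 1 (dx b) := (lowerMon_deg 1).dx h.ord_odd
    exact (h1.smul _).neg.sub ((lowerMon_deg 1).mul_left phi h2)
  have hQ : Raises 1 (vf a b + LinearMap.mulLeft ℂ w) := h.raises.add (raises_mulLeft hw1)
  have hD : ∀ u, superD (evf a b u) = expo (vf a b + LinearMap.mulLeft ℂ w) (superD u) :=
    expo_intertwine (C := superDL) h.raises hQ localOp_superD (superD_vf h.toIsVF)
  have hQmul : ∀ u v, (vf a b + LinearMap.mulLeft ℂ w) (u * v) =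
      (vf a b + LinearMap.mulLeft ℂ w) u * v + u * vf a b v := by
    intro u v
    simp only [LinearMap.add_apply, LinearMap.mulLeft_apply, vf_mul h.toIsVF, add_mul, mul_assoc]
    abel
  exact
    { loc := (localOp_vf a b).expo
      scalar := fun r hr => expo_of_apply_eq_zero (vf_scalar a b hr)
      mul := hmul
      par := expo_intertwine (C := par) h.raises h.raises localOp_par (par_vf h.toIsVF)
      superD := fun u => by
        rw [hD, hD, superD_phi]
        -- Since `superD phi = 1`, the factor `superD (evf a b phi)` is the twisted exponential of
        -- 1; the twisted Leibniz rule splits it off from `1 * superD u`.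
        have := expo_mul hQ hQ h.raises hQmul 1 (superD u)
        rwa [one_mul] at this }

theorem evf_neg_apply {a b : Ser} (h : GoodVF a b) (u : Ser) : evf a b (evf (-a) (-b) u) = u := by
  unfold evf
  rw [vf_neg_eq]
  exact expo_neg_apply (localOp_vf a b) h.raises u

theorem evf_neg_apply' {a b : Ser} (h : GoodVF a b) (u : Ser) : evf (-a) (-b) (evf a b u) = u := by
  unfold evf
  rw [vf_neg_eq]
  exact expo_neg_apply' (localOp_vf a b) h.raises u

/-! ### Substitution of series as application of homomorphisms. -/

/-- The pair of images of `x` and `φ`. -/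
def img (E : Ser →ₗ[ℂ] Ser) : Ser × Ser := (E (xpow 1), E phi)

/-- `ofX` as an additive map. -/
def ofXHom : XRing →+ Ser where
  toFun := ofX
  map_add' := ofX_add
  map_zero' := by
    have := ofX_add 0 0
    rw [add_zero] at this
    exact left_eq_add.1 this

theorem ofX_single (k : ℤ) (c : AlphaRing) :
    ofX (AddMonoidAlgebra.single k c) = ofAlpha c * xpow k := by
  rw [LaurentPolynomial.single_eq_C_mul_T, ofX_mul, ofAlpha_eq, xpow_eq]

theorem RHom.ipow {E : Ser →ₗ[ℂ] Ser} (h : RHom E) (k : ℤ) : ipow (E (xpow 1)) k = E (xpow k) := by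
  have hpow : ∀ (v : Ser) (n : ℕ), E v ^ n = E (v ^ n) := by
    intro v n
    induction n with
    | zero => rw [pow_zero, pow_zero, h.map_one]
    | succ n ih => rw [pow_succ, pow_succ, h.mul, ih]
  have xp : ∀ (m : ℤ) (n : ℕ), xpow m ^ n = xpow (m * n) := by
    intro m n
    induction n with
    | zero => simp
    | succ n ih => rw [pow_succ, ih, ← xpow_add]; push_cast; ring_nf
  have hinv : Ring.inverse (E (xpow 1)) = E (xpow (-1)) := by
    have e1 : E (xpow 1) * E (xpow (-1)) = 1 := by
      rw [← h.mul, ← xpow_add, add_neg_cancel, xpow_zero, h.map_one]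
    have e2 : E (xpow (-1)) * E (xpow 1) = 1 := by
      rw [← h.mul, ← xpow_add, neg_add_cancel, xpow_zero, h.map_one]
    exact Ring.inverse_unit (⟨E (xpow 1), E (xpow (-1)), e1, e2⟩ : Serˣ)
  cases k with
  | ofNat n =>
    change E (xpow 1) ^ n = _
    rw [hpow, xp]
    simp
  | negSucc n =>
    change Ring.inverse (E (xpow 1)) ^ (n + 1) = _
    rw [hinv, hpow, xp]
    congr 2
    rw [Int.negSucc_eq]
    push_cast
    ring

theorem RHom.evalX {E : Ser →ₗ[ℂ] Ser} (h : RHom E) (p : XRing) :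
    evalX p (E (xpow 1)) = E (ofX p) := by
  unfold NSNormalOrder.evalX
  have e : ofX p = p.coeff.sum fun k c => ofAlpha c * xpow k := by
    conv_lhs => rw [← AddMonoidAlgebra.sum_coeff_single p]
    change ofXHom _ = _
    rw [map_finsuppSum]
    exact Finsupp.sum_congr fun k _ => ofX_single k _
  rw [e, map_finsuppSum]
  refine Finsupp.sum_congr fun k _ => ?_
  rw [h.ipow, h.mul, h.scalar _ (isScalar_ofAlpha _)]

theorem cf_mul_mono_monomial (u : Ser) {t : Finset OddVarPhi}
    (a : EvenVar →₀ ℕ) (s e) : cf (u * mono t (MvPowerSeries.monomial a 1)) s e =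
      if t ⊆ s ∧ a ≤ e then sgn (s \ t) t • cf u (s \ t) (e - a) else 0 := by
  unfold cf
  rw [SuperSeries.mul_def]
  split_ifs with h
  · rw [sum_eq_single (s \ t), map_zsmul]
    · rw [Finset.sdiff_sdiff_eq_self h.1]
      simp only [mono, if_true, MvPowerSeries.coeff_mul_monomial, if_pos h.2, mul_one]
    · intro r hr hne
      have : s \ r ≠ t := by
        rintro rfl
        exact hne (Finset.sdiff_sdiff_eq_self (mem_powerset.1 hr)).symm
      simp [mono, this]
    · intro h'; exact absurd (mem_powerset.2 sdiff_subset) h'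
  · rw [map_sum]
    refine sum_eq_zero fun r hr => ?_
    rw [map_zsmul]
    by_cases hrt : s \ r = t
    · have ht : t ⊆ s := hrt ▸ sdiff_subset
      have ha : ¬ a ≤ e := fun h' => h ⟨ht, h'⟩
      simp only [mono, hrt, if_true, MvPowerSeries.coeff_mul_monomial, if_neg ha, smul_zero]
    · simp [mono, hrt]

/-- The term of a series which belongs to a monomial. -/
def serTerm (F : Ser) (t : Finset OddVarPhi) (a : EvenVar →₀ ℕ) : Ser :=
  (ofX (cf F t a) + phi * ofX (cf F (insert ⊥ t) a)) * mono t (MvPowerSeries.monomial a 1)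

theorem cf_serTerm (F : Ser) {t : Finset OddVarPhi} (ht : ⊥ ∉ t) (a : EvenVar →₀ ℕ) (s e) :
    cf (serTerm F t a) s e = if s.erase ⊥ = t ∧ e = a then cf F s e else 0 := by
  have hphi : ∀ (p : XRing) (r c), cf (phi * ofX p) r c = if r = {⊥} ∧ c = 0 then p else 0 := by
    intro p r c
    rw [← even_mul_comm (par_ofX p), cf_ofX_mul, cf_phi]
    split_ifs <;> simp
  unfold serTerm
  rw [cf_mul_mono_monomial]
  simp only [cf_add, cf_ofX, hphi]
  by_cases h : s.erase ⊥ = t ∧ e = a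
  · obtain ⟨rfl, rfl⟩ := h
    rw [if_pos ⟨erase_subset _ _, le_rfl⟩,
      if_pos (⟨rfl, rfl⟩ : s.erase ⊥ = s.erase ⊥ ∧ e = e)]
    by_cases hs : ⊥ ∈ s
    · have e1 : s \ s.erase ⊥ = {⊥} := by
        ext x
        simp only [mem_sdiff, mem_erase, mem_singleton, not_and]
        constructor
        · rintro ⟨h1, h2⟩; by_contra h3; exact h2 h3 h1
        · rintro rfl; exact ⟨hs, fun h => absurd rfl h⟩
      have e2 : sgn ({⊥} : Finset OddVarPhi) (s.erase ⊥) = 1 := by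
        rw [← insert_empty_eq, sgn_insert_bot_left (notMem_empty _), sgn_empty_left]
      rw [e1, e2, insert_erase hs]
      simp
    · have e1 : s \ s.erase ⊥ = ∅ := by rw [erase_eq_of_notMem hs, sdiff_self, bot_eq_empty]
      rw [e1, sgn_empty_left, erase_eq_of_notMem hs]
      simp
  · rw [if_neg h]
    by_cases h1 : t ⊆ s ∧ a ≤ e
    · rw [if_pos h1]
      have hne : ¬((s \ t = ∅) ∧ e - a = 0) := by
        rintro ⟨h2, h3⟩
        have : s = t := Subset.antisymm (sdiff_eq_empty_iff_subset.1 h2) h1.1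
        subst this
        exact h ⟨erase_eq_of_notMem ht, le_antisymm (tsub_eq_zero_iff_le.1 h3) h1.2⟩
      have hne' : ¬((s \ t = {⊥}) ∧ e - a = 0) := by
        rintro ⟨h2, h3⟩
        refine h ⟨?_, le_antisymm (tsub_eq_zero_iff_le.1 h3) h1.2⟩
        have : s = insert ⊥ t := by
          rw [insert_eq, ← h2, sdiff_union_of_subset h1.1]
        rw [this, erase_insert ht]
      rw [if_neg hne, if_neg hne', add_zero, smul_zero]
    · rw [if_neg h1]

/-- A series agrees with the sum of finitely many of its terms on the divisors of a monomial. -/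
theorem van_sub_sum_serTerm (F : Ser) (s : Finset OddVarPhi) (e : EvenVar →₀ ℕ) :
    Van (fun t a => t ⊆ insert ⊥ s ∧ a ≤ e)
      (F - ∑ t ∈ (s.erase ⊥).powerset, ∑ a ∈ Iic e, serTerm F t a) := by
  intro r c hr
  rw [cf_sub, sub_eq_zero, cf_sum]
  have hr' : r.erase ⊥ ∈ (s.erase ⊥).powerset := by
    rw [mem_powerset]
    intro x hx
    rw [mem_erase] at hx ⊢
    exact ⟨hx.1, (mem_insert.1 (hr.1 hx.2)).resolve_left hx.1⟩
  have hb : ∀ t ∈ (s.erase ⊥).powerset, ⊥ ∉ t := fun t ht h =>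
    (mem_erase.1 (mem_powerset.1 ht h)).1 rfl
  rw [sum_eq_single_of_mem _ hr']
  · rw [cf_sum, sum_eq_single_of_mem c (mem_Iic.2 hr.2)]
    · rw [cf_serTerm F (hb _ hr'), if_pos ⟨rfl, rfl⟩]
    · intro a _ ha
      rw [cf_serTerm F (hb _ hr'), if_neg fun h => ha h.2.symm]
  · intro t ht hne
    rw [cf_sum]
    refine sum_eq_zero fun a _ => ?_
    rw [cf_serTerm F (hb _ ht), if_neg fun h => hne h.1.symm]

/-- Substitution of the images of `x` and `φ` is the application of the homomorphism. -/
theorem RHom.substSer {E : Ser →ₗ[ℂ] Ser} (h : RHom E) (F : Ser) :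
    substSer F (E (xpow 1)) (E phi) = E F := by
  refine ser_ext fun s e => ?_
  -- Only the divisors of the monomial matter to the local operator `E`, and on them `F` is the
  -- finite sum of its terms.
  have h1 := h.loc.van (lowerMon_divisors s e) (van_sub_sum_serTerm F s e) s e
    ⟨subset_insert _ _, le_rfl⟩
  rw [map_sub, cf_sub, sub_eq_zero] at h1
  rw [h1, map_sum, cf_sum]
  change ∑ t ∈ (s.erase ⊥).powerset, ∑ a ∈ Iic e,
    cf (compTerm F (E (xpow 1)) (E phi) t a) s e = _
  refine sum_congr rfl fun t ht => ?_
  rw [map_sum, cf_sum]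
  refine sum_congr rfl fun a _ => ?_
  have hb : ⊥ ∉ t := fun h' => (mem_erase.1 (mem_powerset.1 ht h')).1 rfl
  unfold compTerm serTerm
  rw [h.evalX, h.evalX, h.mul, h.scalar _ (isScalar_mono hb a), map_add, h.mul]
  rfl

theorem RHom.comp_img {E : Ser →ₗ[ℂ] Ser} (h : RHom E) (F : Ser × Ser) :
    NSNormalOrder.comp F (img E) = (E F.1, E F.2) := by
  unfold NSNormalOrder.comp img
  rw [h.substSer, h.substSer]

/-- A local homomorphism over the scalars is the substitution of its values at x and φ. -/
theorem RHom.ext {E E' : Ser →ₗ[ℂ] Ser} (h : RHom E) (h' : RHom E') (hx : E (xpow 1) = E' (xpow 1))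
    (hp : E phi = E' phi) : E = E' :=
  LinearMap.ext fun u => by rw [← h.substSer, ← h'.substSer, hx, hp]

open Filter

/-! ### Powers of `x` -/

theorem coef_add (u v : Ser) (s e k) : coef (u + v) s e k = coef u s e k + coef v s e k := rfl
theorem coef_neg (u : Ser) (s e k) : coef (-u) s e k = -coef u s e k := rfl
theorem coef_sub (u v : Ser) (s e k) : coef (u - v) s e k = coef u s e k - coef v s e k := rfl
theorem coef_smul (c : ℂ) (u : Ser) (s e k) : coef (c • u) s e k = c • coef u s e k := rfl

theorem coef_sum {ι : Type*} (t : Finset ι) (f : ι → Ser) (s e k) :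
    coef (∑ i ∈ t, f i) s e k = ∑ i ∈ t, coef (f i) s e k := by
  rw [coef_eq, cf_sum, AddMonoidAlgebra.coeff_sum, Finsupp.finsetSum_apply]
  rfl

theorem xpow_comm (k : ℤ) (u : Ser) : xpow k * u = u * xpow k := even_mul_comm (par_xpow k) u

theorem coef_mul_xpow (u : Ser) (m : ℤ) (s e k) : coef (u * xpow m) s e k = coef u s e (k - m) := by
  rw [← xpow_comm, xpow_eq, coef_eq, cf_ofX_mul, coef_eq]
  have : LaurentPolynomial.T m * cf u s e = laurentMap (fun _ => 1) m (cf u s e) := by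
    have h := laurentMap_mul (fun _ => 1) (fun _ => 1) (fun _ => 1) m 0 (by simp)
      (AddMonoidAlgebra.single 0 1) (cf u s e)
    have h0 : laurentMap (fun _ => 1) 0 (cf u s e) = cf u s e :=
      LaurentPolynomial.ext fun k => by simp [coeff_laurentMap]
    rw [← AddMonoidAlgebra.one_def, one_mul, add_zero, h0] at h
    rw [h, AddMonoidAlgebra.one_def (R := AlphaRing), laurentMap_single, zero_add, mul_one,
      T_eq_single]
  rw [this, coeff_laurentMap, one_mul]

/-- The coefficient of `x^k` in a series without `φ`, as a series. -/
def xc (k : ℤ) : Ser →ₗ[ℂ] Ser :=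
  cmap
    { toFun := fun p => LaurentPolynomial.C (p.coeff k)
      map_add' := fun p q => by simp
      map_smul' := fun c p => by
        refine LaurentPolynomial.ext fun l => ?_
        simp only [AddMonoidAlgebra.coeff_smul_apply, LaurentPolynomial.C_apply, RingHom.id_apply]
        split_ifs <;> simp }
    0

theorem coef_xc (k : ℤ) (u : Ser) (s e l) :
    coef (xc k u) s e l = if ⊥ ∉ s ∧ l = 0 then coef u s e k else 0 := by
  unfold xc
  rw [coef_eq, cf_cmap]
  by_cases hs : ⊥ ∈ s
  · simp [hs]
  · simp [hs, coef_eq]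

theorem isScalar_xc (k : ℤ) (u : Ser) : IsScalar (xc k u) := by
  intro s e l h
  rw [coef_xc] at h
  by_contra h'
  exact h (if_neg h')

theorem par_xc (k : ℤ) (u : Ser) : par (xc k u) = xc k (par u) := par_cmap _ _ _

theorem van_xc {Λ : Finset OddVarPhi → (EvenVar →₀ ℕ) → Prop} (k : ℤ) {u : Ser} (h : Van Λ u) :
    Van Λ (xc k u) := by
  intro s e hs
  unfold xc
  rw [cf_cmap, h s e hs, map_zero, map_zero, ite_self]

/-- The part of a series which consists of the terms with `x^k` for `k` in a given set. -/
def xproj (p : ℤ → Prop) [DecidablePred p] : Ser →ₗ[ℂ] Ser :=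
  cmap (laurentMapL (fun k => if p k then 1 else 0) 0) (laurentMapL (fun k => if p k then 1 else 0) 0)

theorem coef_xproj (p : ℤ → Prop) [DecidablePred p] (u : Ser) (s e k) :
    coef (xproj p u) s e k = if p k then coef u s e k else 0 := by
  unfold xproj
  rw [coef_eq, cf_cmap, ite_self, laurentMapL_apply, coeff_laurentMap, sub_zero, ite_mul, one_mul,
    zero_mul, coef_eq]

theorem par_xproj (p : ℤ → Prop) [DecidablePred p] (u : Ser) :
    par (xproj p u) = xproj p (par u) := par_cmap _ _ _

theorem dphi_eq_zero_iff {u : Ser} : dphi u = 0 ↔ ∀ s e, ⊥ ∈ s → cf u s e = 0 := by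
  constructor
  · intro h s e hs
    have := congrArg (fun w => cf w (s.erase ⊥) e) h
    simpa [cf_dphi, insert_erase hs] using this
  · intro h
    refine ser_ext fun s e => ?_
    rw [cf_dphi, h _ _ (mem_insert_self _ _), ite_self, cf_zero]

theorem van_xproj {Λ : Finset OddVarPhi → (EvenVar →₀ ℕ) → Prop} (p : ℤ → Prop) [DecidablePred p]
    {u : Ser} (h : Van Λ u) : Van Λ (xproj p u) := by
  intro s e hs
  unfold xproj
  rw [cf_cmap, h s e hs, map_zero, ite_self]

theorem dphi_xproj (p : ℤ → Prop) [DecidablePred p] {u : Ser} (h : dphi u = 0) :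
    dphi (xproj p u) = 0 := by
  rw [dphi_eq_zero_iff] at h ⊢
  exact van_xproj (Λ := fun s _ => ⊥ ∈ s) p h

/-! ### Locally finite sums -/

/-- The sequence is eventually constant, equal to `a`, on each monomial. -/
def LocConv (f : ℕ+ → Ser) (a : Ser) : Prop := ∀ s e, ∀ᶠ J in atTop, cf (f J) s e = cf a s e

theorem LocConv.eq {f : ℕ+ → Ser} {a : Ser} (h : LocConv f a) (s e) :
    ∃ J, cf a s e = cf (f J) s e := by
  obtain ⟨J, hJ⟩ := (h s e).exists
  exact ⟨J, hJ.symm⟩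

theorem LocConv.van {f : ℕ+ → Ser} {a : Ser} (h : LocConv f a)
    {Λ : Finset OddVarPhi → (EvenVar →₀ ℕ) → Prop} (hf : ∀ J, Van Λ (f J)) : Van Λ a := by
  intro s e hs
  obtain ⟨J, hJ⟩ := h.eq s e
  rw [hJ, hf J s e hs]

theorem LocConv.par_even {f : ℕ+ → Ser} {a : Ser} (h : LocConv f a) (hf : ∀ J, par (f J) = f J) :
    par a = a := by
  refine ser_ext fun s e => ?_
  obtain ⟨J, hJ⟩ := h.eq s e
  rw [cf_par, hJ, ← cf_par, hf]

theorem LocConv.par_odd {f : ℕ+ → Ser} {a : Ser} (h : LocConv f a) (hf : ∀ J, par (f J) = -f J) :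
    par a = -a := by
  refine ser_ext fun s e => ?_
  obtain ⟨J, hJ⟩ := h.eq s e
  rw [cf_par, cf_neg, hJ, ← cf_par, hf, cf_neg]

theorem LocConv.dphi {f : ℕ+ → Ser} {a : Ser} (h : LocConv f a) (hf : ∀ J, dphi (f J) = 0) :
    dphi a = 0 :=
  dphi_eq_zero_iff.2 (h.van (Λ := fun s _ => ⊥ ∈ s) fun J => dphi_eq_zero_iff.1 (hf J))

theorem LocConv.neg {f : ℕ+ → Ser} {a : Ser} (h : LocConv f a) : LocConv (fun J => -f J) (-a) :=
  fun s e => (h s e).mono fun J hJ => by rw [cf_neg, cf_neg, hJ]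

/-- The partial sums of `∑ c_j x^(κ j)`. -/
def psum (c : ℕ+ → Ser) (κ : ℕ+ → ℤ) (J : ℕ+) : Ser := ∑ j ∈ Icc 1 J, c j * xpow (κ j)

theorem coef_psum {c : ℕ+ → Ser} (hc : ∀ j, IsScalar (c j)) (κ : ℕ+ → ℤ) (J : ℕ+) (s e k) :
    coef (psum c κ J) s e k = ∑ j ∈ Icc 1 J, if κ j = k then coef (c j) s e 0 else 0 := by
  unfold psum
  rw [coef_sum]
  refine sum_congr rfl fun j _ => ?_
  rw [coef_mul_xpow]
  split_ifs with h
  · rw [h, sub_self]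
  · by_contra h'
    exact h (by have := (hc j s e _ h').2; omega)

/-- For each monomial the coefficient is a Laurent polynomial in x, so only finitely many exponents
`κ j` occur in it and the partial sums become stationary. -/
theorem locConv_xproj {κ : ℕ+ → ℤ} (hκ : Function.Injective κ) (p : ℤ → Prop) [DecidablePred p]
    (hp : ∀ k, p k ↔ k ∈ Set.range κ) {a : Ser} (ha : dphi a = 0) :
    LocConv (psum (fun j => xc (κ j) a) κ) (xproj p a) := by
  intro s e
  have hfin : {j | κ j ∈ (cf a s e).coeff.support}.Finite :=
    (Finset.finite_toSet _).preimage hκ.injOn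
  obtain ⟨J₀, hJ₀⟩ := hfin.bddAbove
  filter_upwards [eventually_ge_atTop J₀] with J hJ
  refine LaurentPolynomial.ext fun k => ?_
  rw [← coef_eq, ← coef_eq, coef_psum (fun j => isScalar_xc _ _), coef_xproj]
  have h0 : ∀ j, coef (xc (κ j) a) s e 0 = coef a s e (κ j) := by
    intro j
    rw [coef_xc]
    by_cases hs : ⊥ ∈ s
    · simp [hs, coef_eq, dphi_eq_zero_iff.1 ha s e hs]
    · simp [hs]
  simp only [h0]
  split_ifs with hk
  · obtain ⟨j, rfl⟩ := (hp k).1 hk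
    by_cases hj : j ≤ J
    · rw [sum_eq_single_of_mem j (mem_Icc.2 ⟨one_le, hj⟩), if_pos rfl]
      intro i _ hi
      rw [if_neg fun h => hi (hκ h)]
    · have : coef a s e (κ j) = 0 := by
        by_contra h
        exact hj ((hJ₀ (Finsupp.mem_support_iff.2 h)).trans hJ)
      rw [this]
      refine sum_eq_zero fun i _ => ?_
      split_ifs with h
      · rw [h, this]
      · rfl
  · refine sum_eq_zero fun i _ => if_neg fun h => hk ((hp k).2 ⟨i, h⟩)

/-- The sum of a locally finite family `c_j x^(κ j)`. -/
def lsum (c : ℕ+ → Ser) (κ : ℕ+ → ℤ) : Ser := mkSer fun s e => ∑ᶠ j, cf (c j * xpow (κ j)) s e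

theorem locConv_lsum {c : ℕ+ → Ser} (hc : ∀ s e, {j | cf (c j) s e ≠ 0}.Finite) (κ : ℕ+ → ℤ) :
    LocConv (psum c κ) (lsum c κ) := by
  intro s e
  obtain ⟨J₀, hJ₀⟩ := (hc s e).bddAbove
  filter_upwards [eventually_ge_atTop J₀] with J hJ
  unfold psum lsum
  rw [cf_sum, cf_mkSer]
  refine (finsum_eq_sum_of_support_subset _ fun j hj => ?_).symm
  rw [coe_Icc, Set.mem_Icc]
  refine ⟨one_le, (hJ₀ ?_).trans hJ⟩
  intro h
  refine hj ?_
  change cf (c j * xpow (κ j)) s e = 0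
  rw [← xpow_comm, xpow_eq, cf_ofX_mul, h, mul_zero]

theorem xc_of_locConv {c : ℕ+ → Ser} (hc : ∀ j, IsScalar (c j)) {κ : ℕ+ → ℤ}
    (hκ : Function.Injective κ) {a : Ser} (h : LocConv (psum c κ) a) (j : ℕ+) :
    xc (κ j) a = c j := by
  refine ser_ext_coef fun s e k => ?_
  rw [coef_xc]
  by_cases hk : ⊥ ∉ s ∧ k = 0
  · rw [if_pos hk, hk.2]
    obtain ⟨J, hJ, hJ'⟩ := ((h s e).and (eventually_ge_atTop j)).exists
    rw [coef_eq, ← hJ, ← coef_eq, coef_psum hc,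
      sum_eq_single_of_mem j (mem_Icc.2 ⟨one_le, hJ'⟩), if_pos rfl]
    intro i _ hi
    rw [if_neg fun h => hi (hκ h)]
  · rw [if_neg hk]
    by_contra h'
    exact hk (hc j s e k (Ne.symm h'))

theorem coef_of_locConv {c : ℕ+ → Ser} (hc : ∀ j, IsScalar (c j)) {κ : ℕ+ → ℤ}
    {a : Ser} (h : LocConv (psum c κ) a) {k : ℤ} (hk : k ∉ Set.range κ) (s e) :
    coef a s e k = 0 := by
  obtain ⟨J, hJ⟩ := h.eq s e
  rw [coef_eq, hJ, ← coef_eq, coef_psum hc]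
  exact sum_eq_zero fun j _ => if_neg fun h => hk ⟨j, h⟩

/-! ### Exponentials of limits of operators -/

theorem HasExp.unique {T : ℕ+ → Ser → Ser} {u v v' : Ser} (h : HasExp T u v) (h' : HasExp T u v') :
    v = v' := by
  refine ser_ext_coef fun s e k => ?_
  obtain ⟨p, hp, hp'⟩ := ((h s e k).and (h' s e k)).exists
  rw [← hp, hp']

theorem HasExpPair.unique {T : ℕ+ → Ser → Ser} {u v v' : Ser × Ser} (h : HasExpPair T u v)
    (h' : HasExpPair T u v') : v = v' := Prod.ext (h.1.unique h'.1) (h.2.unique h'.2)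

/-- A coefficient of the exponential depends on the finitely many divisors of its monomial, so a
single `J` makes the partial operators agree with the limit on all of them; beyond the degree of the
monomial further powers contribute nothing. -/
theorem isExp_evf {T : ℕ+ → Ser → Ser} {f g : ℕ+ → Ser} {a b : Ser}
    (hT : ∀ J u, T J u = vf (f J) (g J) u) (hf : LocConv f a) (hg : LocConv g b)
    (hab : GoodVF a b) : IsExp T (evf a b) := by
  intro u s e k
  have hfin : ∀ᶠ J in atTop, ∀ t ∈ (insert ⊥ s).powerset, ∀ c ∈ Iic e,
      cf (f J) t c = cf a t c ∧ cf (g J) t c = cf b t c := by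
    rw [eventually_all_finset]
    intro t _
    rw [eventually_all_finset]
    intro c _
    exact (hf t c).and (hg t c)
  rw [← prod_atTop_atTop_eq]
  filter_upwards [(eventually_gt_atTop (deg s e)).prod_mk hfin] with p hp
  obtain ⟨hN, hJ⟩ := hp
  have hΛ := lowerMon_divisors s e
  have hvan : ∀ w, Van (fun t c => t ⊆ insert ⊥ s ∧ c ≤ e) (vf (f p.2) (g p.2) w - vf a b w) := by
    intro w
    rw [← vf_sub]
    refine hΛ.vf_left ?_ ?_ w
    · intro t c h
      rw [cf_sub, (hJ t (mem_powerset.2 h.1) c (mem_Iic.2 h.2)).1, sub_self]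
    · intro t c h
      rw [cf_sub, (hJ t (mem_powerset.2 h.1) c (mem_Iic.2 h.2)).2, sub_self]
  have hit : ∀ n, (T p.2)^[n] u = (vf (f p.2) (g p.2) ^ n) u := by
    intro n
    rw [Module.End.pow_apply]
    exact congrArg (fun F : Ser → Ser => F^[n] u) (funext (hT p.2))
  have h1 : cf (∑ n ∈ range p.1, ((n.factorial : ℂ)⁻¹) • (T p.2)^[n] u) s e =
      cf (expPartial (vf a b) p.1 u) s e := by
    unfold expPartial
    rw [cf_sum, cf_sum]
    refine sum_congr rfl fun n _ => ?_
    have := van_pow_sub hΛ (localOp_vf _ _) hvan n u s e ⟨subset_insert _ _, le_rfl⟩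
    rw [cf_sub, sub_eq_zero] at this
    rw [hit, cf_smul, cf_smul, this]
  rw [coef_eq, coef_eq, h1]
  have := expo_approx hab.raises p.1 u s e hN
  rw [cf_sub, sub_eq_zero] at this
  rw [← this]
  rfl

theorem vf_zero_left (u : Ser) : vf 0 0 u = 0 := by
  simp [vf_apply]

theorem vf_sum {ι : Type*} (t : Finset ι) (a b : ι → Ser) (u : Ser) :
    vf (∑ i ∈ t, a i) (∑ i ∈ t, b i) u = ∑ i ∈ t, vf (a i) (b i) u := by
  classical
  induction t using Finset.induction_on with
  | empty => simp [vf_zero_left]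
  | insert i t hi ih => rw [sum_insert hi, sum_insert hi, sum_insert hi, vf_add, ih]

theorem vf_monomial {c : Ser} (hc : IsScalar c) (d : Ser) (n : ℤ) (u : Ser) :
    vf (c * xpow (n + 1)) (d * xpow n) u = c * opL n u + d * opG n u := by
  have e1 : opL n u =
    -(xpow (n + 1) * dx u + (((n : ℂ) + 1) / 2) • (phi * xpow n * dphi u)) := rfl
  have e2 : opG n u = -(xpow n * (dphi u - phi * dx u)) := rfl
  rw [e1, e2, vf_apply, dx_mul, dx_eq_zero_of_isScalar hc, zero_mul, zero_add, dx_xpow,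
    add_sub_cancel_right]
  have f : ∀ w, phi * (xpow n * w) = xpow n * (phi * w) :=
    fun w => (mul_left_comm_even (par_xpow n) _ _).symm
  simp only [mul_neg, mul_add, mul_smul_comm, smul_mul_assoc, mul_assoc, smul_smul, f]
  push_cast
  module

/-- The pairing used for negative modes: L_{-j} goes with G_{-j+1/2}, so the even and the odd
coefficient carry the same power of x. -/
theorem vf_monomial' {c : Ser} (hc : IsScalar c) (d : Ser) (n : ℤ) (u : Ser) :
    vf (c * xpow (n + 1)) (d * xpow (n + 1)) u = c * opL n u + d * opG (n + 1) u := by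
  have h1 := vf_monomial hc 0 n u
  have h2 := vf_monomial (c := 0) (fun s e k h => absurd rfl h) d (n + 1) u
  have h3 := vf_add (c * xpow (n + 1)) (0 * xpow n) (0 * xpow (n + 1 + 1)) (d * xpow (n + 1)) u
  rw [h1, h2] at h3
  simpa using h3

theorem posOp_eq {c d : ℕ+ → Ser} (hc : ∀ j, IsScalar (c j)) (J : ℕ+) (u : Ser) :
    posOp c d J u =
      vf (psum c (fun j => ((j : ℕ) : ℤ) + 1) J) (psum d (fun j => ((j : ℕ) : ℤ)) J) u := by
  unfold posOp psum
  rw [vf_sum]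
  exact sum_congr rfl fun j _ => (vf_monomial (hc j) (d j) _ u).symm

theorem negOp_eq {c d : ℕ+ → Ser} (hc : ∀ j, IsScalar (c j)) (J : ℕ+) (u : Ser) :
    negOp c d J u =
      vf (psum c (fun j => 1 - ((j : ℕ) : ℤ)) J) (psum d (fun j => 1 - ((j : ℕ) : ℤ)) J) u := by
  unfold negOp psum
  rw [vf_sum]
  refine sum_congr rfl fun j _ => ?_
  have := vf_monomial' (hc j) (d j) (-((j : ℕ) : ℤ)) u
  rw [show -((j : ℕ) : ℤ) + 1 = 1 - ((j : ℕ) : ℤ) by ring] at this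
  exact this.symm

theorem zeroOp_eq {c : Ser} (hc : IsScalar c) (J : ℕ+) (u : Ser) :
    zeroOp c J u = vf ((2 : ℂ) • (c * xpow 1)) 0 u := by
  have h := vf_monomial hc 0 0 u
  rw [zero_mul, zero_mul, add_zero, zero_add] at h
  unfold zeroOp
  rw [mul_smul_comm, ← h, vf_apply, vf_apply]
  simp only [dx_smul, smul_mul_assoc, zero_mul, sub_zero]
  module

/-! ### The vector fields with coefficients `𝒜`, `ℳ` and `ℬ`, `𝒩` -/

theorem bot_ne_oddEmb (i : OddVar) : (⊥ : OddVarPhi) ≠ oddEmb i := (WithBot.coe_ne_bot (a := i)).symm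

theorem bot_notMem_idxM (j : ℕ+) : ⊥ ∉ ({idxM j} : Finset OddVarPhi) := fun h =>
  bot_ne_oddEmb _ (mem_singleton.1 h)

theorem bot_notMem_idxN (j : ℕ+) : ⊥ ∉ ({idxN j} : Finset OddVarPhi) := fun h =>
  bot_ne_oddEmb _ (mem_singleton.1 h)

theorem cf_varA (j : ℕ+) (s e) :
    cf (varA j) s e = if s = ∅ ∧ e = Finsupp.single (Sum.inl j) 1 then 1 else 0 := by
  classical
  unfold varA
  rw [cf_mono, MvPowerSeries.coeff_X]
  split_ifs <;> simp_all

theorem cf_varB (j : ℕ+) (s e) :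
    cf (varB j) s e = if s = ∅ ∧ e = Finsupp.single (Sum.inr j) 1 then 1 else 0 := by
  classical
  unfold varB
  rw [cf_mono, MvPowerSeries.coeff_X]
  split_ifs <;> simp_all

theorem cf_varM (j : ℕ+) (s e) : cf (varM j) s e = if s = {idxM j} ∧ e = 0 then 1 else 0 := by
  classical
  unfold varM
  rw [cf_mono, MvPowerSeries.coeff_one]
  split_ifs <;> simp_all

theorem cf_varN (j : ℕ+) (s e) : cf (varN j) s e = if s = {idxN j} ∧ e = 0 then 1 else 0 := by
  classical
  unfold varN
  rw [cf_mono, MvPowerSeries.coeff_one]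
  split_ifs <;> simp_all

theorem isScalar_varA (j : ℕ+) : IsScalar (varA j) := isScalar_mono (notMem_empty _) _
theorem isScalar_varB (j : ℕ+) : IsScalar (varB j) := isScalar_mono (notMem_empty _) _

theorem isScalar_varM (j : ℕ+) : IsScalar (varM j) := by
  have := isScalar_mono (t := {idxM j}) (bot_notMem_idxM j) 0
  rwa [MvPowerSeries.monomial_zero_one] at this

theorem isScalar_varN (j : ℕ+) : IsScalar (varN j) := by
  have := isScalar_mono (t := {idxN j}) (bot_notMem_idxN j) 0
  rwa [MvPowerSeries.monomial_zero_one] at this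

theorem par_varA (j : ℕ+) : par (varA j) = varA j := ser_ext fun s e => by
  rw [cf_par, cf_varA]
  split_ifs with h
  · simp [h.1]
  · simp

theorem par_varB (j : ℕ+) : par (varB j) = varB j := ser_ext fun s e => by
  rw [cf_par, cf_varB]
  split_ifs with h
  · simp [h.1]
  · simp

theorem par_varM (j : ℕ+) : par (varM j) = -varM j := ser_ext fun s e => by
  rw [cf_par, cf_neg, cf_varM]
  split_ifs with h
  · simp [h.1]
  · simp

theorem par_varN (j : ℕ+) : par (varN j) = -varN j := ser_ext fun s e => by
  rw [cf_par, cf_neg, cf_varN]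
  split_ifs with h
  · simp [h.1]
  · simp

theorem IsScalar.neg {r : Ser} (h : IsScalar r) : IsScalar (-r) := fun s e k hk =>
  h s e k fun h0 => hk (by rw [coef_neg, h0, neg_zero])

/-- A family of even or odd scalars without constant term, of which only finitely many involve a
given monomial. -/
structure LocFam (σ : ℤ) (c : ℕ+ → Ser) : Prop where
  scalar : ∀ j, IsScalar (c j)
  par : ∀ j, par (c j) = σ • c j
  ord : ∀ j, Ord 1 (c j)
  fin : ∀ s e, {j | cf (c j) s e ≠ 0}.Finite

theorem idxM_injective : Function.Injective idxM := fun i j h => by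
  simpa using oddEmb.injective h

theorem idxN_injective : Function.Injective idxN := fun i j h => by
  simpa using oddEmb.injective h

theorem locFam_A : LocFam 1 (fun j => -varA j) where
  scalar j := (isScalar_varA j).neg
  par j := by rw [map_neg, par_varA, one_smul]
  ord j := Van.neg fun s e h => by
    rw [cf_varA, if_neg]
    rintro ⟨rfl, rfl⟩
    simp [deg] at h
  fin s e := Set.Subsingleton.finite fun i hi j hj => by
    simp only [Set.mem_ofPred_eq, cf_neg, cf_varA, ne_eq, neg_eq_zero, ite_eq_right_iff, one_ne_zero,
      imp_false, not_not] at hi hj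
    have := hi.2.symm.trans hj.2
    simpa using Finsupp.single_left_injective one_ne_zero this

theorem locFam_B : LocFam 1 (fun j => -varB j) where
  scalar j := (isScalar_varB j).neg
  par j := by rw [map_neg, par_varB, one_smul]
  ord j := Van.neg fun s e h => by
    rw [cf_varB, if_neg]
    rintro ⟨rfl, rfl⟩
    simp [deg] at h
  fin s e := Set.Subsingleton.finite fun i hi j hj => by
    simp only [Set.mem_ofPred_eq, cf_neg, cf_varB, ne_eq, neg_eq_zero, ite_eq_right_iff, one_ne_zero,
      imp_false, not_not] at hi hj
    have := hi.2.symm.trans hj.2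
    simpa using Finsupp.single_left_injective one_ne_zero this

theorem locFam_M : LocFam (-1) (fun j => -varM j) where
  scalar j := (isScalar_varM j).neg
  par j := by rw [map_neg, par_varM, neg_smul, one_smul]
  ord j := Van.neg fun s e h => by
    rw [cf_varM, if_neg]
    rintro ⟨rfl, rfl⟩
    rw [deg, erase_eq_of_notMem (bot_notMem_idxM j)] at h
    simp at h
  fin s e := Set.Subsingleton.finite fun i hi j hj => by
    simp only [Set.mem_ofPred_eq, cf_neg, cf_varM, ne_eq, neg_eq_zero, ite_eq_right_iff, one_ne_zero,
      imp_false, not_not] at hi hj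
    exact idxM_injective (singleton_injective (hi.1.symm.trans hj.1))

theorem locFam_N : LocFam (-1) (fun j => -varN j) where
  scalar j := (isScalar_varN j).neg
  par j := by rw [map_neg, par_varN, neg_smul, one_smul]
  ord j := Van.neg fun s e h => by
    rw [cf_varN, if_neg]
    rintro ⟨rfl, rfl⟩
    rw [deg, erase_eq_of_notMem (bot_notMem_idxN j)] at h
    simp at h
  fin s e := Set.Subsingleton.finite fun i hi j hj => by
    simp only [Set.mem_ofPred_eq, cf_neg, cf_varN, ne_eq, neg_eq_zero, ite_eq_right_iff, one_ne_zero,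
      imp_false, not_not] at hi hj
    exact idxN_injective (singleton_injective (hi.1.symm.trans hj.1))

theorem par_psum {σ : ℤ} {c : ℕ+ → Ser} (h : ∀ j, par (c j) = σ • c j) (κ : ℕ+ → ℤ) (J : ℕ+) :
    par (psum c κ J) = σ • psum c κ J := by
  unfold psum
  rw [map_sum, smul_sum]
  refine sum_congr rfl fun j _ => ?_
  rw [par_mul, h, par_xpow, smul_mul_assoc]

theorem dphi_psum {c : ℕ+ → Ser} (h : ∀ j, IsScalar (c j)) (κ : ℕ+ → ℤ) (J : ℕ+) :
    dphi (psum c κ J) = 0 := by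
  unfold psum
  change dphiL _ = 0
  rw [map_sum]
  refine sum_eq_zero fun j _ => ?_
  change dphi _ = 0
  rw [dphi_mul, dphi_xpow, dphi_eq_zero_of_isScalar (h j), zero_mul, mul_zero, add_zero]

theorem van_psum {Λ : Finset OddVarPhi → (EvenVar →₀ ℕ) → Prop} (hΛ : LowerMon Λ) {c : ℕ+ → Ser}
    (h : ∀ j, Van Λ (c j)) (κ : ℕ+ → ℤ) (J : ℕ+) : Van Λ (psum c κ J) :=
  Van.sum fun j _ => hΛ.mul_right _ (h j)

theorem LocFam.goodVF {c d : ℕ+ → Ser} (hc : LocFam 1 c) (hd : LocFam (-1) d) (κ κ' : ℕ+ → ℤ) :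
    GoodVF (lsum c κ) (lsum d κ') where
  even := (locConv_lsum hc.fin κ).par_even fun J => by rw [par_psum hc.par, one_smul]
  odd := (locConv_lsum hd.fin κ').par_odd fun J => by rw [par_psum hd.par, neg_smul, one_smul]
  dphi_even := (locConv_lsum hc.fin κ).dphi (dphi_psum hc.scalar κ)
  dphi_odd := (locConv_lsum hd.fin κ').dphi (dphi_psum hd.scalar κ')
  ord_even := (locConv_lsum hc.fin κ).van (van_psum (lowerMon_deg 1) hc.ord κ)
  ord_odd := (locConv_lsum hd.fin κ').van (van_psum (lowerMon_deg 1) hd.ord κ')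

/-- `-∑ 𝒜_j x^(j+1)`. -/
def serA : Ser := lsum (fun j => -varA j) (fun j => ((j : ℕ) : ℤ) + 1)
/-- `-∑ ℳ_{j-1/2} x^j`. -/
def serM : Ser := lsum (fun j => -varM j) (fun j => ((j : ℕ) : ℤ))
/-- `-∑ ℬ_j x^(1-j)`. -/
def serB : Ser := lsum (fun j => -varB j) (fun j => 1 - ((j : ℕ) : ℤ))
/-- `-∑ 𝒩_{j-1/2} x^(1-j)`. -/
def serN : Ser := lsum (fun j => -varN j) (fun j => 1 - ((j : ℕ) : ℤ))

theorem goodVF_AM : GoodVF serA serM := locFam_A.goodVF locFam_M _ _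
theorem goodVF_BN : GoodVF serB serN := locFam_B.goodVF locFam_N _ _

theorem psum_neg (c : ℕ+ → Ser) (κ : ℕ+ → ℤ) (J : ℕ+) :
    psum (fun j => -c j) κ J = -psum c κ J := by
  unfold psum
  rw [← sum_neg_distrib]
  exact sum_congr rfl fun j _ => neg_mul _ _

theorem isExp_AM : IsExp (posOp (fun j => -varA j) (fun j => -varM j)) (evf serA serM) :=
  isExp_evf (fun J u => posOp_eq locFam_A.scalar J u) (locConv_lsum locFam_A.fin _)
    (locConv_lsum locFam_M.fin _) goodVF_AM

theorem isExp_AM_neg : IsExp (posOp varA varM) (evf (-serA) (-serM)) := by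
  refine isExp_evf (fun J u => posOp_eq isScalar_varA J u) ?_ ?_ goodVF_AM.neg
  · have := (locConv_lsum locFam_A.fin (fun j => ((j : ℕ) : ℤ) + 1)).neg
    simp only [psum_neg, neg_neg] at this
    exact this
  · have := (locConv_lsum locFam_M.fin (fun j => ((j : ℕ) : ℤ))).neg
    simp only [psum_neg, neg_neg] at this
    exact this

theorem isExp_BN : IsExp (negOp (fun j => -varB j) (fun j => -varN j)) (evf serB serN) :=
  isExp_evf (fun J u => negOp_eq locFam_B.scalar J u) (locConv_lsum locFam_B.fin _)
    (locConv_lsum locFam_N.fin _) goodVF_BN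

theorem isExp_BN_neg : IsExp (negOp varB varN) (evf (-serB) (-serN)) := by
  refine isExp_evf (fun J u => negOp_eq isScalar_varB J u) ?_ ?_ goodVF_BN.neg
  · have := (locConv_lsum locFam_B.fin (fun j => 1 - ((j : ℕ) : ℤ))).neg
    simp only [psum_neg, neg_neg] at this
    exact this
  · have := (locConv_lsum locFam_N.fin (fun j => 1 - ((j : ℕ) : ℤ))).neg
    simp only [psum_neg, neg_neg] at this
    exact this

/-! ### The inversion -/

/-- `p(x) ↦ p(1/x)`. -/
def invertL : XRing →ₗ[ℂ] XRing where
  toFun p := LaurentPolynomial.invert p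
  map_add' p q := map_add _ p q
  map_smul' c p := LaurentPolynomial.ext fun k => by
    simp only [LaurentPolynomial.invert_apply, AddMonoidAlgebra.coeff_smul_apply, RingHom.id_apply]

@[simp] theorem invertL_apply (p : XRing) : invertL p = LaurentPolynomial.invert p := rfl

/-- The substitution `x ↦ 1/x`, `φ ↦ c φ / x`. -/
def invSub (c : ℂ) : Ser →ₗ[ℂ] Ser :=
  cmap invertL (c • (LinearMap.mulLeft ℂ (LaurentPolynomial.T (-1) : XRing)) ∘ₗ invertL)

theorem rHom_invSub (c : ℂ) : RHom (invSub c) where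
  loc := localOp_cmap _ _
  scalar r hr := by
    refine ser_ext_coef fun s e k => ?_
    unfold invSub
    rw [coef_eq, cf_cmap]
    split_ifs with hs
    · have : cf r s e = 0 := LaurentPolynomial.ext fun l => by
        by_contra h
        exact (hr s e l h).1 hs
      rw [coef_eq, this, map_zero]
    · rw [invertL_apply, LaurentPolynomial.invert_apply, coef_eq]
      by_cases hk : k = 0
      · rw [hk, neg_zero]
      · have h1 : ∀ l, l ≠ 0 → (cf r s e).coeff l = 0 := fun l hl => by
          by_contra h
          exact hl (hr s e l h).2
        rw [h1 k hk, h1 (-k) (neg_ne_zero.2 hk)]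
  mul u v := by
    refine cmap_mul (fun p q => by simp) (fun p q => ?_) u v
    simp [mul_assoc]

/-- In particular the inversion with constant `i` is undone by the one with constant `-i`. -/
theorem invSub_invSub {c d : ℂ} (h : c * d = 1) (u : Ser) : invSub c (invSub d u) = u := by
  refine ser_ext fun s e => ?_
  unfold invSub
  simp only [cf_cmap]
  split_ifs with hs
  · simp only [LinearMap.smul_apply, LinearMap.comp_apply, invertL_apply, LinearMap.mulLeft_apply,
      map_smul]
    rw [map_mul, LaurentPolynomial.invert_T, ← mul_assoc, ← LaurentPolynomial.T_add, smul_smul,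
      mul_comm d, h, one_smul]
    simp [LaurentPolynomial.involutive_invert _]
  · simp [LaurentPolynomial.involutive_invert _]

theorem img_invSub : img (invSub Complex.I) = inversionI := by
  refine Prod.ext (ser_ext fun s e => ?_) (ser_ext fun s e => ?_)
  · change cf (invSub Complex.I (xpow 1)) s e = cf (xpow (-1)) s e
    unfold invSub
    rw [cf_cmap, xpow_eq, xpow_eq, cf_ofX, cf_ofX]
    by_cases h : s = ∅ ∧ e = 0
    · simp [h.1, h.2]
    · simp [h]
  · change cf (invSub Complex.I phi) s e = cf (Complex.I • (phi * xpow (-1))) s e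
    unfold invSub
    rw [cf_cmap, cf_smul, ← xpow_comm, xpow_eq, cf_ofX_mul, cf_phi]
    by_cases h : s = {⊥} ∧ e = 0
    · simp [h.1, h.2]
    · simp [h]

/-! ### The sewing equation -/

/-- The operator `exp(-∑ (𝒜_j L_j + ℳ_{j-1/2} G_{j-1/2})) (α₀^{1/2})^{-2L_0}
exp(-∑ (ℬ_j L_{-j} + 𝒩_{j-1/2} G_{-j+1/2}))`. -/
def sewOp : Ser →ₗ[ℂ] Ser := evf serA serM ∘ₗ scaleL 1 ∘ₗ evf serB serN

theorem scHom_sewOp : SCHom sewOp :=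
  (scHom_evf goodVF_AM).comp ((scHom_scale 1).comp (scHom_evf goodVF_BN))

theorem IsExp.hasExpPair {T : ℕ+ → Ser → Ser} {E : Ser →ₗ[ℂ] Ser} (h : IsExp T E) (u : Ser × Ser) :
    HasExpPair T u (E u.1, E u.2) := ⟨h u.1, h u.2⟩

theorem isH1_iff {H : Ser × Ser} : IsH1 H ↔ H = img (evf serA serM ∘ₗ scaleL 1) := by
  have h := isExp_AM.hasExpPair (scalePair 1 xphi)
  have e : (evf serA serM (scalePair 1 xphi).1, evf serA serM (scalePair 1 xphi).2) =
      img (evf serA serM ∘ₗ scaleL 1) := by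
    unfold img
    simp only [LinearMap.comp_apply, scaleL_apply]
    rfl
  rw [e] at h
  exact ⟨fun h' => h'.unique h, fun h' => h' ▸ h⟩

theorem isH2_iff {H : Ser × Ser} :
    IsH2 H ↔ H = img (evf (-serB) (-serN) ∘ₗ invSub Complex.I) := by
  have h := isExp_BN_neg.hasExpPair inversionI
  have e : (evf (-serB) (-serN) inversionI.1, evf (-serB) (-serN) inversionI.2) =
      img (evf (-serB) (-serN) ∘ₗ invSub Complex.I) := by
    rw [← img_invSub]
    rfl
  rw [e] at h
  exact ⟨fun h' => h'.unique h, fun h' => h' ▸ h⟩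

theorem I_mul_neg_I : Complex.I * -Complex.I = 1 := by simp
theorem neg_I_mul_I : -Complex.I * Complex.I = 1 := by simp

/-- Each substitution applies a homomorphism, so the operators appear in the order opposite to the
pairs. The inversion `I` meets the inverse of the one contained in H⁽²⁾, and what remains is
`sewOp`. -/
theorem comp_sewOp {K₂ : Ser × Ser} (hK : K₂ = img (invSub (-Complex.I) ∘ₗ evf serB serN))
    (F : Ser × Ser) :
    comp F (comp K₂ (comp inversionI (img (evf serA serM ∘ₗ scaleL 1)))) =
      (sewOp F.1, sewOp F.2) := by
  have hA : RHom (evf serA serM ∘ₗ scaleL 1) :=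
    (scHom_evf goodVF_AM).toRHom.comp (scHom_scale 1).toRHom
  have h1 : comp inversionI (img (evf serA serM ∘ₗ scaleL 1)) =
      img ((evf serA serM ∘ₗ scaleL 1) ∘ₗ invSub Complex.I) := by
    rw [hA.comp_img, ← img_invSub]; rfl
  have h2 : comp K₂ (img ((evf serA serM ∘ₗ scaleL 1) ∘ₗ invSub Complex.I)) = img sewOp := by
    rw [(hA.comp (rHom_invSub _)).comp_img, hK]
    unfold img sewOp
    simp only [LinearMap.comp_apply, invSub_invSub I_mul_neg_I]
  rw [h1, h2, scHom_sewOp.toRHom.comp_img]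

/-- The compositional inverse of H⁽²⁾ is given only as a pair of series. That it becomes (x, φ)
after substituting H⁽²⁾ is an equation for an invertible operator, which determines it; conversely
the inverse operator provides such a pair. -/
theorem sewing_iff {F₁ F₂ : Ser × Ser} :
    SewingEquation F₁ F₂ ↔ F₁ = (sewOp F₂.1, sewOp F₂.2) := by
  have hB : RHom (evf (-serB) (-serN) ∘ₗ invSub Complex.I) :=
    (scHom_evf goodVF_BN.neg).toRHom.comp (rHom_invSub _)
  have hB' : RHom (invSub (-Complex.I) ∘ₗ evf serB serN) :=
    (rHom_invSub _).comp (scHom_evf goodVF_BN).toRHom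
  constructor
  · rintro ⟨H₁, H₂, K₂, h1, h2, ⟨-, -, -, hK⟩, rfl⟩
    rw [isH1_iff] at h1
    rw [isH2_iff] at h2
    subst h1 h2
    refine comp_sewOp ?_ F₂
    rw [hB.comp_img] at hK
    have key : ∀ w z, (evf (-serB) (-serN) ∘ₗ invSub Complex.I) w = z →
        w = (invSub (-Complex.I) ∘ₗ evf serB serN) z := by
      rintro w z rfl
      simp only [LinearMap.comp_apply]
      rw [evf_neg_apply goodVF_BN, invSub_invSub neg_I_mul_I]
    exact Prod.ext (key _ _ (congrArg Prod.fst hK)) (key _ _ (congrArg Prod.snd hK))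
  · rintro rfl
    refine ⟨_, _, img (invSub (-Complex.I) ∘ₗ evf serB serN), isH1_iff.2 rfl, isH2_iff.2 rfl,
      ⟨?_, ?_, ?_, ?_⟩, (comp_sewOp rfl F₂).symm⟩
    · rw [isEvenSer_iff]
      change par (invSub _ (evf serB serN (xpow 1))) = _
      unfold invSub
      rw [par_cmap, (scHom_evf goodVF_BN).par, par_xpow]
      rfl
    · rw [isOddSer_iff]
      change par (invSub _ (evf serB serN phi)) = -(invSub _ (evf serB serN phi))
      unfold invSub
      rw [par_cmap, (scHom_evf goodVF_BN).par, par_phi, map_neg, map_neg]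
    · rw [hB'.comp_img]
      unfold img
      simp only [LinearMap.comp_apply]
      rw [evf_neg_apply goodVF_BN, evf_neg_apply goodVF_BN, invSub_invSub neg_I_mul_I,
        invSub_invSub neg_I_mul_I]
      rfl
    · rw [hB.comp_img]
      unfold img
      simp only [LinearMap.comp_apply]
      rw [invSub_invSub I_mul_neg_I, invSub_invSub I_mul_neg_I, evf_neg_apply' goodVF_BN,
        evf_neg_apply' goodVF_BN]
      rfl

/-! ### Linearized superconformality -/

/-- The part of a series without `φ`. -/
def free (u : Ser) : Ser := u - phi * dphi u

theorem free_add_phi_mul (u : Ser) : free u + phi * dphi u = u := by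
  unfold free; abel

theorem par_free (u : Ser) : par (free u) = free (par u) := by
  unfold free
  rw [map_sub, par_mul, par_phi, par_dphi, neg_mul_neg]

theorem dphi_free (u : Ser) : dphi (free u) = 0 := by
  unfold free
  rw [dphi_sub, dphi_mul, dphi_phi, dphi_dphi, one_mul, mul_zero, add_zero, sub_self]

theorem dx_free (u : Ser) : dx (free u) = dx u - phi * dphi (dx u) := by
  unfold free
  rw [dx_sub, dx_mul, dx_phi, zero_mul, zero_add, dx_dphi]

theorem van_free {Λ : Finset OddVarPhi → (EvenVar →₀ ℕ) → Prop} (hΛ : LowerMon Λ) {u : Ser}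
    (h : Van Λ u) : Van Λ (free u) := h.sub (hΛ.mul_left _ (hΛ.dphi h))

theorem ord_free {m : ℕ} {u : Ser} (h : Ord m u) : Ord m (free u) := van_free (lowerMon_deg m) h

theorem superD_alpha_mul (n : ℤ) (u : Ser) : superD (alpha n * u) = alpha n * superD u := by
  rw [superD_mul, superD_eq_zero_of_isScalar (isScalar_alpha n), zero_mul, zero_add, par_alpha]

theorem superD_sub (u v : Ser) : superD (u - v) = superD u - superD v := superDL.map_sub u v

/-- The difference of two superconformal pairs is to lowest order an infinitesimal superconformal
transformation. -/
theorem superconformal_difference {m : ℕ} {n : ℤ} {X₁ X₂ Z₁ Z₂ : Ser}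
    (hX : superD X₁ = X₂ * superD X₂) (hZ : superD Z₁ = Z₂ * superD Z₂)
    (h1 : Ord m (X₂ - Z₂)) (hX2 : Ord 1 (X₂ - alpha n * phi)) (hZ2 : Ord 1 (Z₂ - alpha n * phi)) :
    Ord (m + 1) (dphi (X₁ - Z₁) - alpha n * free (X₂ - Z₂)) ∧
    Ord (m + 1) (dx (free (X₁ - Z₁)) - (2 : ℂ) • (alpha n * dphi (X₂ - Z₂))) := by
  set Δ₁ := X₁ - Z₁ with hΔ1
  set Δ₂ := X₂ - Z₂ with hΔ2
  -- The remainder after linearizing the superconformality equation about the odd component `alpha n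
  -- * phi`. By `e` it is a sum of products of a factor of degree `m` with a factor of degree 1.
  set R := superD Δ₁ - (alpha n * Δ₂ + alpha n * (phi * superD Δ₂)) with hR
  have e : R = Δ₂ * superD (X₂ - alpha n * phi) + (Z₂ - alpha n * phi) * superD Δ₂ := by
    have hs : superD (X₂ - alpha n * phi) = superD X₂ - alpha n := by
      rw [superD_sub, superD_alpha_mul, superD_phi, mul_one]
    rw [hR, hs, hΔ1, superD_sub, hX, hZ, hΔ2, superD_sub, alpha_comm n (X₂ - Z₂)]
    simp only [mul_sub, sub_mul, mul_assoc]
    abel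
  have hRo : Ord (m + 1) R := by
    rw [e]
    refine (h1.mul ((lowerMon_deg 1).superD hX2)).add ?_
    rw [add_comm]
    exact hZ2.mul ((lowerMon_deg m).superD h1)
  have e2 : R = dphi Δ₁ + phi * dx Δ₁ - alpha n * Δ₂ - alpha n * (phi * dphi Δ₂) := by
    rw [hR, superD, superD, mul_add, phi_mul_phi_mul, add_zero]
    abel
  -- The coefficient of φ in `R` is the second quantity to be estimated, and the φ-free part of `R`
  -- is the first.
  have hd : dphi R = dx (free Δ₁) - (2 : ℂ) • (alpha n * dphi Δ₂) := by
    rw [e2, dx_free]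
    simp only [dphi_sub, dphi_add, dphi_mul, dphi_phi, dphi_dphi, dphi_alpha, zero_mul, zero_add,
      par_alpha, par_phi, one_mul, mul_zero, neg_mul, add_zero]
    module
  constructor
  · have hf : R - phi * dphi R = dphi Δ₁ - alpha n * free Δ₂ := by
      rw [hd, dx_free, e2]
      unfold free
      simp only [mul_sub, mul_smul_comm, phi_mul_phi_mul, alpha_left_comm n phi]
      module
    rw [← hf]
    exact hRo.sub ((lowerMon_deg _).mul_left _ ((lowerMon_deg _).dphi hRo))
  · rw [← hd]
    exact (lowerMon_deg _).dphi hRo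

/-! ### The operators attached to a pair of series -/

/-- The terms of `a` with nonpositive powers of `x`. -/
abbrev nonposPart : Ser →ₗ[ℂ] Ser := xproj fun k => k ≤ 0
/-- The terms of `a` with the first power of `x`. -/
abbrev onePart : Ser →ₗ[ℂ] Ser := xproj fun k => k = 1
/-- The terms of `a` with powers of `x` greater than one. -/
abbrev twoPart : Ser →ₗ[ℂ] Ser := xproj fun k => 2 ≤ k
/-- The terms of `a` with positive powers of `x`. -/
abbrev posPart : Ser →ₗ[ℂ] Ser := xproj fun k => 1 ≤ k

theorem GoodVF.xproj {a b : Ser} (h : GoodVF a b) (p q : ℤ → Prop) [DecidablePred p]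
    [DecidablePred q] : GoodVF (xproj p a) (xproj q b) where
  even := by rw [par_xproj, h.even]
  odd := by rw [par_xproj, h.odd, map_neg]
  dphi_even := dphi_xproj p h.dphi_even
  dphi_odd := dphi_xproj q h.dphi_odd
  ord_even := van_xproj p h.ord_even
  ord_odd := van_xproj q h.ord_odd

theorem GoodVF.zero_right {a b : Ser} (h : GoodVF a b) : GoodVF a 0 where
  even := h.even
  odd := by rw [map_zero, neg_zero]
  dphi_even := h.dphi_even
  dphi_odd := dphi_zero
  ord_even := h.ord_even
  ord_odd := Van.zero

/-- The exponential of the negative modes. -/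
def negExp (a b : Ser) : Ser →ₗ[ℂ] Ser := evf (nonposPart a) (nonposPart b)
/-- The exponential of the positive modes. -/
def posExp (a b : Ser) : Ser →ₗ[ℂ] Ser := evf (twoPart a) (posPart b)
/-- The exponential of the zero mode. -/
def zeroExp (a : Ser) : Ser →ₗ[ℂ] Ser := evf (onePart a) 0

/-- The product of the exponentials of the negative, the positive and the zero modes. -/
def facOp (a b : Ser) : Ser →ₗ[ℂ] Ser := negExp a b ∘ₗ posExp a b ∘ₗ scaleL 1 ∘ₗ zeroExp a

theorem GoodVF.scHom_negExp {a b : Ser} (h : GoodVF a b) : SCHom (negExp a b) :=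
  scHom_evf (h.xproj _ _)
theorem GoodVF.scHom_posExp {a b : Ser} (h : GoodVF a b) : SCHom (posExp a b) :=
  scHom_evf (h.xproj _ _)
theorem GoodVF.scHom_zeroExp {a b : Ser} (h : GoodVF a b) : SCHom (zeroExp a) :=
  scHom_evf (h.xproj _ fun k => k = 1).zero_right

theorem GoodVF.scHom_facOp {a b : Ser} (h : GoodVF a b) : SCHom (facOp a b) :=
  h.scHom_negExp.comp (h.scHom_posExp.comp ((scHom_scale 1).comp h.scHom_zeroExp))

theorem evf_zero (u : Ser) : evf 0 0 u = u := expo_of_apply_eq_zero (vf_zero_left u)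

theorem van_evf_sub {Λ : Finset OddVarPhi → (EvenVar →₀ ℕ) → Prop} (hΛ : LowerMon Λ)
    {a b a' b' u u' : Ser} (ha : Van Λ (a - a')) (hb : Van Λ (b - b')) (hu : Van Λ (u - u')) :
    Van Λ (evf a b u - evf a' b' u') := by
  refine Van.trans (v := evf a b u') ?_ ?_
  · rw [← map_sub]
    exact (localOp_vf a b).expo.van hΛ hu
  · refine van_expo_sub hΛ (localOp_vf a b) (fun w => ?_) u'
    rw [← vf_sub]
    exact hΛ.vf_left ha hb w

theorem van_scale_sub {Λ : Finset OddVarPhi → (EvenVar →₀ ℕ) → Prop} (hΛ : LowerMon Λ) (n : ℤ)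
    {u u' : Ser} (hu : Van Λ (u - u')) : Van Λ (scale n u - scale n u') := by
  rw [← scale_sub]; exact hΛ.scale n hu

theorem van_xproj_sub {Λ : Finset OddVarPhi → (EvenVar →₀ ℕ) → Prop} (p : ℤ → Prop)
    [DecidablePred p] {u u' : Ser} (h : Van Λ (u - u')) : Van Λ (xproj p u - xproj p u') := by
  rw [← map_sub]; exact van_xproj p h

theorem facOp_apply (a b u : Ser) :
    facOp a b u = evf (nonposPart a) (nonposPart b) (evf (twoPart a) (posPart b)
      (scale 1 (evf (onePart a) 0 u))) := by
  rw [← scaleL_apply]; rfl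

theorem sewOp_apply (u : Ser) : sewOp u = evf serA serM (scale 1 (evf serB serN u)) := by
  rw [← scaleL_apply]; rfl

theorem van_facOp_sub {Λ : Finset OddVarPhi → (EvenVar →₀ ℕ) → Prop} (hΛ : LowerMon Λ)
    {a b a' b' : Ser} (ha : Van Λ (a - a')) (hb : Van Λ (b - b')) (u : Ser) :
    Van Λ (facOp a b u - facOp a' b' u) := by
  rw [facOp_apply, facOp_apply]
  refine van_evf_sub hΛ (van_xproj_sub _ ha) (van_xproj_sub _ hb) ?_
  refine van_evf_sub hΛ (van_xproj_sub _ ha) (van_xproj_sub _ hb) ?_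
  refine van_scale_sub hΛ 1 ?_
  refine van_evf_sub hΛ (van_xproj_sub _ ha) ?_ ?_ <;> rw [sub_self] <;> exact Van.zero

/-- A change of the vector field and of the argument, to lowest order. -/
theorem evf_step {m : ℕ} (hm : 1 ≤ m) {a b a' b' : Ser} (h : GoodVF a b) (h' : GoodVF a' b')
    (ha : Ord m (a' - a)) (hb : Ord m (b' - b)) {w w' w₀ : Ser} (hw : Ord m (w' - w))
    (hw₀ : Ord 1 (w - w₀)) :
    Ord (m + 1) (evf a' b' w' - evf a b w - ((w' - w) + vf (a' - a) (b' - b) w₀)) := by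
  have hr : Raises m (vf a' b' - vf a b) := by
    have : vf a' b' - vf a b = vf (a' - a) (b' - b) := LinearMap.ext fun u => (vf_sub _ _ _ _ u).symm
    rw [this]
    exact raises_vf ha hb
  have h1 := expo_sub hm h'.raises h.raises hr w'
  have h2 := expo_sub_self h.raises hw
  have h3 : Ord (m + 1) (vf (a' - a) (b' - b) (w' - w₀)) := by
    rw [add_comm]
    refine raises_vf ha hb 1 _ ?_
    exact Van.trans (hw.mono hm) hw₀
  -- Three errors, each one degree higher: the nonlinear effect of changing the field, the action of
  -- the exponential on `w' - w`, and the replacement of `w'` by its leading term `w₀`.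
  have e : evf a' b' w' - evf a b w - ((w' - w) + vf (a' - a) (b' - b) w₀) =
      (expo (vf a' b') w' - expo (vf a b) w' - (vf a' b' - vf a b) w') +
      (expo (vf a b) (w' - w) - (w' - w)) + vf (a' - a) (b' - b) (w' - w₀) := by
    rw [map_sub, map_sub, LinearMap.sub_apply, vf_sub _ _ _ _ w']
    unfold evf
    abel
  rw [e]
  exact (h1.add h2).add h3

theorem ord_evf_sub {a b : Ser} (h : GoodVF a b) {w w₀ : Ser} (hw : Ord 1 (w - w₀)) :
    Ord 1 (evf a b w - w₀) :=
  Van.trans (expo_sub_self h.raises (ord_zero w)) hw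

/-- The zero mode is a multiple of L₀ and commutes with the scaling, so its increment passes through
unchanged. -/
theorem vf_onePart_scale {a : Ser} (ha : dphi a = 0) (u : Ser) :
    scale 1 (vf (onePart a) 0 u) = vf (onePart a) 0 (scale 1 u) := by
  rw [scale_vf]
  have e1 : alpha (-2 * 1) * scale 1 (onePart a) = onePart a := by
    refine ser_ext_coef fun s e k => ?_
    rw [coef_alpha_mul, coef_scale, coef_xproj]
    by_cases hk : k = 1
    · rw [if_pos hk]
      by_cases hs : ⊥ ∈ s
      · rw [coef_eq, dphi_eq_zero_iff.1 ha s e hs]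
        simp
      · rw [if_neg hs, hk, ← mul_assoc, ← LaurentPolynomial.T_add]
        simp
    · rw [if_neg hk, mul_zero, mul_zero]
  have e2 : alpha (-1) * scale 1 0 = 0 := by rw [← scaleL_apply, map_zero, mul_zero]
  rw [e1, e2]

theorem parts_add (a : Ser) : onePart a + twoPart a + nonposPart a = a := by
  refine ser_ext_coef fun s e k => ?_
  rw [coef_add, coef_add, coef_xproj, coef_xproj, coef_xproj]
  rcases lt_trichotomy k 1 with h | h | h
  · rw [if_neg (by omega), if_neg (by omega), if_pos (by omega), zero_add, zero_add]
  · rw [if_pos (by omega), if_neg (by omega), if_neg (by omega), add_zero, add_zero]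
  · rw [if_neg (by omega), if_pos (by omega), if_neg (by omega), zero_add, add_zero]

theorem parts_add' (b : Ser) : posPart b + nonposPart b = b := by
  refine ser_ext_coef fun s e k => ?_
  rw [coef_add, coef_xproj, coef_xproj]
  rcases lt_or_ge k 1 with h | h
  · rw [if_neg (by omega), if_pos (by omega), zero_add]
  · rw [if_pos (by omega), if_neg (by omega), add_zero]

/-- A change of the pair of series changes the product to lowest order by a vector field. -/
theorem facOp_step {m : ℕ} (hm : 1 ≤ m) {a b a' b' : Ser} (h : GoodVF a b) (h' : GoodVF a' b')
    (ha : Ord m (a' - a)) (hb : Ord m (b' - b)) (g : Ser) :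
    Ord (m + 1) (facOp a' b' g - facOp a b g - vf (a' - a) (b' - b) (scale 1 g)) := by
  rw [facOp_apply, facOp_apply]
  have z1 : Ord 1 (g - g) := by rw [sub_self]; exact Van.zero
  have z2 : ∀ n, Ord n (g - g) := fun n => by rw [sub_self]; exact Van.zero
  have z3 : ∀ n, Ord n ((0 : Ser) - 0) := fun n => by rw [sub_self]; exact Van.zero
  have hz := (h.xproj (fun k => k = 1) fun k => k = 1).zero_right
  have hz' := (h'.xproj (fun k => k = 1) fun k => k = 1).zero_right
  have hd : ∀ (p : ℤ → Prop) [DecidablePred p] {c c' : Ser}, Ord m (c' - c) →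
      Ord m (xproj p c' - xproj p c) := fun p _ _ _ hc => van_xproj_sub p hc
  -- From the innermost factor outwards, each exponential passes on the increment received so far
  -- and adds that of its own modes, up to degree `m + 1`.
  have s1 := evf_step hm hz hz' (hd _ ha) (z3 m) (z2 m) z1
  rw [sub_self g, zero_add, sub_self (0 : Ser), ← map_sub] at s1
  set w₁ := evf (onePart a) 0 g
  set w₁' := evf (onePart a') 0 g
  have d1 : Ord m (w₁' - w₁) := by
    have := (s1.mono (Nat.le_succ m)).add (raises_vf (m := m) (a := onePart (a' - a)) (b := 0)
      (van_xproj _ ha) Van.zero 0 g (ord_zero g) |>.mono (Nat.le_add_left _ _))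
    rwa [sub_add_cancel] at this
  have o1 : Ord 1 (w₁ - g) := ord_evf_sub hz z1
  have s2 : Ord (m + 1) (scale 1 w₁' - scale 1 w₁ - vf (onePart (a' - a)) 0 (scale 1 g)) := by
    have hda : dphi (a' - a) = 0 := by rw [dphi_sub, h.dphi_even, h'.dphi_even, sub_zero]
    rw [← vf_onePart_scale hda, ← scale_sub, ← scale_sub]
    exact (lowerMon_deg _).scale 1 s1
  have d2 : Ord m (scale 1 w₁' - scale 1 w₁) := van_scale_sub (lowerMon_deg m) 1 d1
  have o2 : Ord 1 (scale 1 w₁ - scale 1 g) := van_scale_sub (lowerMon_deg 1) 1 o1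
  set w₂ := scale 1 w₁
  set w₂' := scale 1 w₁'
  have hp := h.xproj (fun k => 2 ≤ k) fun k => 1 ≤ k
  have hp' := h'.xproj (fun k => 2 ≤ k) fun k => 1 ≤ k
  have s3 := evf_step hm hp hp' (hd _ ha) (hd _ hb) d2 o2
  have d3 : Ord m (evf (twoPart a') (posPart b') w₂' - evf (twoPart a) (posPart b) w₂) :=
    van_evf_sub (lowerMon_deg m) (hd _ ha) (hd _ hb) d2
  have o3 : Ord 1 (evf (twoPart a) (posPart b) w₂ - scale 1 g) := ord_evf_sub hp o2
  set w₃ := evf (twoPart a) (posPart b) w₂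
  set w₃' := evf (twoPart a') (posPart b') w₂'
  have s4 := evf_step hm (h.xproj (fun k => k ≤ 0) fun k => k ≤ 0)
    (h'.xproj (fun k => k ≤ 0) fun k => k ≤ 0) (hd _ ha) (hd _ hb) d3 o3
  rw [← map_sub, ← map_sub] at s3 s4
  -- The zero, positive and negative modes together make up the whole change of the field.
  have e : vf (a' - a) (b' - b) (scale 1 g) = vf (onePart (a' - a)) 0 (scale 1 g) +
      vf (twoPart (a' - a)) (posPart (b' - b)) (scale 1 g) +
      vf (nonposPart (a' - a)) (nonposPart (b' - b)) (scale 1 g) := by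
    rw [← vf_add, ← vf_add, parts_add, zero_add, parts_add']
  have := (s4.add s3).add s2
  rw [e]
  refine (congrArg (Ord (m + 1)) ?_).mp this
  abel

theorem ord_facOp_sub_scale {a b : Ser} (h : GoodVF a b) (g : Ser) :
    Ord 1 (facOp a b g - scale 1 g) := by
  rw [facOp_apply]
  refine ord_evf_sub (h.xproj _ _) (ord_evf_sub (h.xproj _ _) ?_)
  refine van_scale_sub (lowerMon_deg 1) 1 (ord_evf_sub (h.xproj _ fun k => k = 1).zero_right ?_)
  rw [sub_self]; exact Van.zero

theorem ord_sewOp_sub_scale (g : Ser) : Ord 1 (sewOp g - scale 1 g) := by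
  rw [sewOp_apply]
  refine ord_evf_sub goodVF_AM (van_scale_sub (lowerMon_deg 1) 1 (ord_evf_sub goodVF_BN ?_))
  rw [sub_self]; exact Van.zero

/-! ### The factorization of the sewing operator -/

/-- The monomial contains none of the `𝒜_j`, `ℳ_{j-1/2}`. -/
def noAM (s : Finset OddVarPhi) (e : EvenVar →₀ ℕ) : Prop := ¬HasAM s e

/-- The monomial contains none of the `ℬ_j`, `𝒩_{j-1/2}`. -/
def noBN (s : Finset OddVarPhi) (e : EvenVar →₀ ℕ) : Prop := ¬HasBN s e

theorem lowerMon_noAM : LowerMon noAM := by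
  rintro s e t a h hts hae ⟨j, hj⟩
  refine h ⟨j, hj.imp (fun hm => ?_) fun hm h0 => hm (Nat.le_zero.1 (h0 ▸ hae (Sum.inl j)))⟩
  exact (mem_insert.1 (hts hm)).resolve_left (bot_ne_oddEmb _).symm

theorem lowerMon_noBN : LowerMon noBN := by
  rintro s e t a h hts hae ⟨j, hj⟩
  refine h ⟨j, hj.imp (fun hm => ?_) fun hm h0 => hm (Nat.le_zero.1 (h0 ▸ hae (Sum.inr j)))⟩
  exact (mem_insert.1 (hts hm)).resolve_left (bot_ne_oddEmb _).symm

theorem van_varA (j : ℕ+) : Van noAM (varA j) := fun s e h => by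
  rw [cf_varA, if_neg]
  rintro ⟨rfl, rfl⟩
  exact h ⟨j, Or.inr (by simp)⟩

theorem van_varB (j : ℕ+) : Van noBN (varB j) := fun s e h => by
  rw [cf_varB, if_neg]
  rintro ⟨rfl, rfl⟩
  exact h ⟨j, Or.inr (by simp)⟩

theorem van_varM (j : ℕ+) : Van noAM (varM j) := fun s e h => by
  rw [cf_varM, if_neg]
  rintro ⟨rfl, rfl⟩
  exact h ⟨j, Or.inl (mem_singleton_self _)⟩

theorem van_varN (j : ℕ+) : Van noBN (varN j) := fun s e h => by
  rw [cf_varN, if_neg]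
  rintro ⟨rfl, rfl⟩
  exact h ⟨j, Or.inl (mem_singleton_self _)⟩

theorem van_serA : Van noAM serA :=
  (locConv_lsum locFam_A.fin _).van fun J => van_psum lowerMon_noAM (fun j => (van_varA j).neg) _ J
theorem van_serM : Van noAM serM :=
  (locConv_lsum locFam_M.fin _).van fun J => van_psum lowerMon_noAM (fun j => (van_varM j).neg) _ J
theorem van_serB : Van noBN serB :=
  (locConv_lsum locFam_B.fin _).van fun J => van_psum lowerMon_noBN (fun j => (van_varB j).neg) _ J
theorem van_serN : Van noBN serN :=
  (locConv_lsum locFam_N.fin _).van fun J => van_psum lowerMon_noBN (fun j => (van_varN j).neg) _ J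

theorem coef_serA (s e) {k : ℤ} (h : k < 2) : coef serA s e k = 0 :=
  coef_of_locConv locFam_A.scalar (locConv_lsum locFam_A.fin _) (by
    rintro ⟨j, hj⟩
    have := j.pos
    simp only at hj
    omega) s e

theorem coef_serM (s e) {k : ℤ} (h : k < 1) : coef serM s e k = 0 :=
  coef_of_locConv locFam_M.scalar (locConv_lsum locFam_M.fin _) (by
    rintro ⟨j, hj⟩
    have := j.pos
    simp only at hj
    omega) s e

theorem coef_serB (s e) {k : ℤ} (h : 0 < k) : coef serB s e k = 0 :=
  coef_of_locConv locFam_B.scalar (locConv_lsum locFam_B.fin _) (by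
    rintro ⟨j, hj⟩
    have := j.pos
    simp only at hj
    omega) s e

theorem coef_serN (s e) {k : ℤ} (h : 0 < k) : coef serN s e k = 0 :=
  coef_of_locConv locFam_N.scalar (locConv_lsum locFam_N.fin _) (by
    rintro ⟨j, hj⟩
    have := j.pos
    simp only at hj
    omega) s e

/-- `-∑ α₀^(-j) ℬ_j x^(1-j)`. -/
def serB' : Ser := alpha (-2) * scale 1 serB
/-- `-∑ α₀^(-j+1/2) 𝒩_{j-1/2} x^(1-j)`. -/
def serN' : Ser := alpha (-1) * scale 1 serN

theorem coef_serB' (s e) {k : ℤ} (h : 0 < k) : coef serB' s e k = 0 := by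
  unfold serB'
  rw [coef_alpha_mul, coef_scale, coef_serB s e h, mul_zero, mul_zero]

theorem coef_serN' (s e) {k : ℤ} (h : 0 < k) : coef serN' s e k = 0 := by
  unfold serN'
  rw [coef_alpha_mul, coef_scale, coef_serN s e h, mul_zero, mul_zero]

theorem van_serB' : Van noBN serB' := lowerMon_noBN.mul_left _ (lowerMon_noBN.scale 1 van_serB)
theorem van_serN' : Van noBN serN' := lowerMon_noBN.mul_left _ (lowerMon_noBN.scale 1 van_serN)

theorem goodVF_BN' : GoodVF serB' serN' where
  toIsVF := isVF_scale goodVF_BN.toIsVF _ _ _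
  ord_even := (lowerMon_deg 1).mul_left _ ((lowerMon_deg 1).scale 1 goodVF_BN.ord_even)
  ord_odd := (lowerMon_deg 1).mul_left _ ((lowerMon_deg 1).scale 1 goodVF_BN.ord_odd)

theorem GoodVF.add {a b a' b' : Ser} (h : GoodVF a b) (h' : GoodVF a' b') :
    GoodVF (a + a') (b + b') where
  toIsVF := h.toIsVF.add h'.toIsVF
  ord_even := h.ord_even.add h'.ord_even
  ord_odd := h.ord_odd.add h'.ord_odd

theorem goodVF_lin : GoodVF (serA + serB') (serM + serN') := goodVF_AM.add goodVF_BN'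

/-- Moving the ℬ, 𝒩 exponential to the left of the scaling rescales its coefficients; this is the
origin of the powers of α₀ in the leading terms of the negative modes of Ψ. -/
theorem scale_evf_BN (u : Ser) : scale 1 (evf serB serN u) = evf serB' serN' (scale 1 u) := by
  have := expo_intertwine goodVF_BN.raises goodVF_BN'.raises (localOp_scale 1) (fun w => by
    rw [scaleL_apply, scaleL_apply, scale_vf]; rfl) u
  rwa [scaleL_apply, scaleL_apply] at this

theorem xproj_eq_self {p : ℤ → Prop} [DecidablePred p] {u : Ser}
    (h : ∀ s e k, ¬p k → coef u s e k = 0) : xproj p u = u := ser_ext_coef fun s e k => by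
  rw [coef_xproj]
  split_ifs with hk
  · rfl
  · exact (h s e k hk).symm

theorem xproj_eq_zero {p : ℤ → Prop} [DecidablePred p] {u : Ser}
    (h : ∀ s e k, p k → coef u s e k = 0) : xproj p u = 0 := ser_ext_coef fun s e k => by
  rw [coef_xproj]
  split_ifs with hk
  · exact h s e k hk
  · rfl

/-- The field built from 𝒜 and ℳ has only positive modes, so the other exponentials are trivial. -/
theorem facOp_AM (u : Ser) : facOp serA serM u = evf serA serM (scale 1 u) := by
  have h1 : nonposPart serA = 0 := xproj_eq_zero fun s e k hk => coef_serA s e (by omega)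
  have h2 : nonposPart serM = 0 := xproj_eq_zero fun s e k hk => coef_serM s e (by omega)
  have h3 : twoPart serA = serA := xproj_eq_self fun s e k hk => coef_serA s e (by omega)
  have h4 : posPart serM = serM := xproj_eq_self fun s e k hk => coef_serM s e (by omega)
  have h5 : onePart serA = 0 := xproj_eq_zero fun s e k hk => coef_serA s e (by omega)
  rw [facOp_apply, h1, h2, h3, h4, h5, evf_zero, evf_zero]

theorem facOp_BN (u : Ser) : facOp serB' serN' u = evf serB' serN' (scale 1 u) := by
  have h1 : nonposPart serB' = serB' := xproj_eq_self fun s e k hk => coef_serB' s e (by omega)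
  have h2 : nonposPart serN' = serN' := xproj_eq_self fun s e k hk => coef_serN' s e (by omega)
  have h3 : twoPart serB' = 0 := xproj_eq_zero fun s e k hk => coef_serB' s e (by omega)
  have h4 : posPart serN' = 0 := xproj_eq_zero fun s e k hk => coef_serN' s e (by omega)
  have h5 : onePart serB' = 0 := xproj_eq_zero fun s e k hk => coef_serB' s e (by omega)
  rw [facOp_apply, h1, h2, h3, h4, h5, evf_zero, evf_zero]

theorem van_of_sub_zero {Λ : Finset OddVarPhi → (EvenVar →₀ ℕ) → Prop} {u : Ser} (h : Van Λ u) :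
    Van Λ (u - 0) := by rwa [sub_zero]

theorem van_self_sub {Λ : Finset OddVarPhi → (EvenVar →₀ ℕ) → Prop} (u : Ser) :
    Van Λ (u - u) := by rw [sub_self]; exact Van.zero

/-- At (𝒜, ℳ) = 0 only the ℬ, 𝒩 part of the linear field is left. It has only negative modes, and
`scale_evf_BN` identifies both sides. At (ℬ, 𝒩) = 0 the same happens with positive modes. -/
theorem van_noAM_lin (u : Ser) : Van noAM (sewOp u - facOp (serA + serB') (serM + serN') u) := by
  refine Van.trans (v := facOp serB' serN' u) ?_ ?_
  · rw [sewOp_apply, facOp_BN, scale_evf_BN]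
    conv in _ - _ => rw [← evf_zero (evf serB' serN' (scale 1 u))]
    exact van_evf_sub lowerMon_noAM (van_of_sub_zero van_serA) (van_of_sub_zero van_serM)
      (by rw [evf_zero]; exact van_self_sub _)
  · refine van_facOp_sub lowerMon_noAM ?_ ?_ u
    · rw [sub_add_cancel_right]; exact van_serA.neg
    · rw [sub_add_cancel_right]; exact van_serM.neg

theorem van_noBN_lin (u : Ser) : Van noBN (sewOp u - facOp (serA + serB') (serM + serN') u) := by
  refine Van.trans (v := facOp serA serM u) ?_ ?_
  · rw [sewOp_apply, facOp_AM]
    refine van_evf_sub lowerMon_noBN (van_self_sub _) (van_self_sub _)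
      (van_scale_sub lowerMon_noBN 1 ?_)
    have := van_evf_sub lowerMon_noBN (van_of_sub_zero van_serB) (van_of_sub_zero van_serN)
      (van_self_sub u)
    rwa [evf_zero] at this
  · refine van_facOp_sub lowerMon_noBN ?_ ?_ u
    · rw [sub_add_cancel_left]; exact van_serB'.neg
    · rw [sub_add_cancel_left]; exact van_serN'.neg

theorem superD_xpow_one : superD (xpow 1) = phi := by
  unfold superD
  rw [dphi_xpow, dx_xpow, zero_add]
  simp [xpow_zero]

theorem par_superD (u : Ser) : par (superD u) = -superD (par u) := by
  unfold superD
  rw [map_add, par_mul, par_phi, par_dphi, par_dx, neg_mul, neg_add]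

theorem SCHom.superD_xpow_one {E : Ser →ₗ[ℂ] Ser} (h : SCHom E) :
    NSNormalOrder.superD (E (xpow 1)) = E phi * NSNormalOrder.superD (E phi) := by
  have he : NSNormalOrder.par (NSNormalOrder.superD (E phi)) = NSNormalOrder.superD (E phi) := by
    rw [par_superD, h.par, par_phi, map_neg]
    exact (congrArg Neg.neg (superDL.map_neg (E phi))).trans (neg_neg _)
  rw [h.superD, NSNormalOrder.superD_xpow_one, even_mul_comm he]

theorem SCHom.isSuperconformal {E : Ser →ₗ[ℂ] Ser} (h : SCHom E) {n : ℤ}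
    (hE : Ord 1 (E phi - alpha n * phi)) : IsSuperconformal (img E) := by
  refine ⟨isEvenSer_iff.2 ?_, isOddSer_iff.2 ?_, h.superD_xpow_one, fun h0 => ?_⟩
  · exact (h.par _).trans (congrArg E (par_xpow 1))
  · exact (h.par _).trans ((congrArg E par_phi).trans (map_neg E _))
  -- In degree zero `superD (E phi)` is the unit `alpha n`, so it cannot vanish.
  · have h1 := (lowerMon_deg 1).superD hE
    have h0' : NSNormalOrder.superD (E phi) = 0 := h0
    rw [superD_sub, superD_alpha_mul, superD_phi, mul_one, h0', zero_sub] at h1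
    have h2 := h1.neg ∅ 0 (by simp [deg])
    rw [neg_neg] at h2
    have h3 : coef (alpha n * 1) ∅ 0 0 = 0 := by rw [mul_one, coef_eq, h2]; rfl
    rw [coef_alpha_mul, coef_eq, cf_one] at h3
    simp only [and_self, if_true] at h3
    exact (LaurentPolynomial.isUnit_T n).ne_zero (by simpa using h3)

theorem scale_xpow_one (n : ℤ) : scale n (xpow 1) = alpha (2 * n) * xpow 1 := by
  rw [scale_xpow, mul_one]

/-! ### Degree-by-degree construction of the factorization. -/

/-- `(a, b)` solves the factorization problem up to degree `n`, and differs from the linear terms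
by mixed terms only. -/
structure IsApproxFac (n : ℕ) (a b : Ser) : Prop where
  good : GoodVF a b
  even_noAM : Van noAM (a - (serA + serB'))
  even_noBN : Van noBN (a - (serA + serB'))
  odd_noAM : Van noAM (b - (serM + serN'))
  odd_noBN : Van noBN (b - (serM + serN'))
  ord_x : Ord (n + 1) (sewOp (xpow 1) - facOp a b (xpow 1))
  ord_phi : Ord (n + 1) (sewOp phi - facOp a b phi)

theorem isApproxFac_lin : IsApproxFac 0 (serA + serB') (serM + serN') where
  good := goodVF_lin
  even_noAM := van_self_sub _
  even_noBN := van_self_sub _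
  odd_noAM := van_self_sub _
  odd_noBN := van_self_sub _
  ord_x := (ord_sewOp_sub_scale _).trans (ord_facOp_sub_scale goodVF_lin _).symm
  ord_phi := (ord_sewOp_sub_scale _).trans (ord_facOp_sub_scale goodVF_lin _).symm

/-- The next approximation, even part. -/
def nextEven (a b : Ser) : Ser := a - alpha (-2) * free (sewOp (xpow 1) - facOp a b (xpow 1))
/-- The next approximation, odd part. -/
def nextOdd (a b : Ser) : Ser := b - alpha (-1) * free (sewOp phi - facOp a b phi)

theorem dphi_alpha_mul (n : ℤ) (u : Ser) : dphi (alpha n * u) = alpha n * dphi u := by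
  rw [dphi_mul, dphi_alpha, zero_mul, zero_add, par_alpha]

theorem dx_alpha_mul (n : ℤ) (u : Ser) : dx (alpha n * u) = alpha n * dx u := by
  rw [dx_mul, dx_alpha, zero_mul, zero_add]

theorem vf_alpha_mul (a b : Ser) (n : ℤ) (u : Ser) : vf a b (alpha n * u) = alpha n * vf a b u := by
  rw [vf_apply, vf_apply, dphi_alpha_mul, dx_alpha_mul]
  simp only [alpha_left_comm, mul_sub, mul_add, mul_neg, mul_smul_comm]

/-- In lowest degree the error at x and φ is the effect of a superconformal vector field on the
scaled coordinates. The new fields incorporate this field, read off from the φ-free parts of the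
error; its φ-parts are then removed automatically by `superconformal_difference`. -/
theorem IsApproxFac.next {n : ℕ} {a b : Ser} (h : IsApproxFac n a b) :
    IsApproxFac (n + 1) (nextEven a b) (nextOdd a b) := by
  set δ₁ := sewOp (xpow 1) - facOp a b (xpow 1) with hδ1
  set δ₂ := sewOp phi - facOp a b phi with hδ2
  have hZ := h.good.scHom_facOp
  have p1 : par δ₁ = δ₁ := by
    rw [hδ1, map_sub, scHom_sewOp.par, hZ.par, par_xpow]
  have p2 : par δ₂ = -δ₂ := by
    rw [hδ2, map_sub, scHom_sewOp.par, hZ.par, par_phi, map_neg, map_neg]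
    abel
  have ea : nextEven a b - a = -(alpha (-2) * free δ₁) := by
    unfold nextEven; rw [← hδ1]; abel
  have eb : nextOdd a b - b = -(alpha (-1) * free δ₂) := by
    unfold nextOdd; rw [← hδ2]; abel
  have oa : Ord (n + 1) (nextEven a b - a) := by
    rw [ea]; exact ((lowerMon_deg _).mul_left _ (ord_free h.ord_x)).neg
  have ob : Ord (n + 1) (nextOdd a b - b) := by
    rw [eb]; exact ((lowerMon_deg _).mul_left _ (ord_free h.ord_phi)).neg
  -- The error of `(a, b)` vanishes on `Λ` because the linear field is exact there and `(a, b)`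
  -- agrees with it there. The correction, made from this error, vanishes there too.
  have mixed : ∀ {Λ : Finset OddVarPhi → (EvenVar →₀ ℕ) → Prop}, LowerMon Λ →
      Van Λ (a - (serA + serB')) → Van Λ (b - (serM + serN')) →
      (∀ u, Van Λ (sewOp u - facOp (serA + serB') (serM + serN') u)) →
      Van Λ (nextEven a b - (serA + serB')) ∧ Van Λ (nextOdd a b - (serM + serN')) := by
    intro Λ hΛ ha hb hl
    have hd : ∀ u, Van Λ (sewOp u - facOp a b u) := fun u =>
      (hl u).trans (van_facOp_sub hΛ ha hb u).symm
    constructor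
    · refine Van.trans (v := a) ?_ ha
      rw [ea]; exact (hΛ.mul_left _ (van_free hΛ (hd _))).neg
    · refine Van.trans (v := b) ?_ hb
      rw [eb]; exact (hΛ.mul_left _ (van_free hΛ (hd _))).neg
  obtain ⟨ma, mb⟩ := mixed lowerMon_noAM h.even_noAM h.odd_noAM van_noAM_lin
  obtain ⟨ma', mb'⟩ := mixed lowerMon_noBN h.even_noBN h.odd_noBN van_noBN_lin
  have good : GoodVF (nextEven a b) (nextOdd a b) := by
    refine ⟨⟨?_, ?_, ?_, ?_⟩, ?_, ?_⟩
    · unfold nextEven; rw [← hδ1, map_sub, par_mul, par_alpha, par_free, p1, h.good.even]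
    · unfold nextOdd
      rw [← hδ2, map_sub, par_mul, par_alpha, par_free, p2, h.good.odd]
      have : free (-δ₂) = -free δ₂ := by unfold free; rw [dphi_neg, mul_neg]; abel
      rw [this, mul_neg]; abel
    · unfold nextEven
      rw [dphi_sub, dphi_alpha_mul, dphi_free, h.good.dphi_even, mul_zero, sub_zero]
    · unfold nextOdd
      rw [dphi_sub, dphi_alpha_mul, dphi_free, h.good.dphi_odd, mul_zero, sub_zero]
    · have := (oa.mono (Nat.le_add_left 1 n)).add h.good.ord_even
      rwa [sub_add_cancel] at this
    · have := (ob.mono (Nat.le_add_left 1 n)).add h.good.ord_odd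
      rwa [sub_add_cancel] at this
  have hs : scale 1 phi = alpha 1 * phi := scale_phi 1
  have o1 := ord_sewOp_sub_scale phi
  have o2 := ord_facOp_sub_scale h.good phi
  rw [hs] at o1 o2
  obtain ⟨d1, d2⟩ := superconformal_difference scHom_sewOp.superD_xpow_one hZ.superD_xpow_one
    h.ord_phi o1 o2
  rw [← hδ1, ← hδ2] at d1 d2
  have pf2 : par (free δ₂) = -free δ₂ := by
    rw [par_free, p2]; unfold free; rw [dphi_neg, mul_neg]; abel
  refine ⟨good, ma, ma', mb, mb', ?_, ?_⟩
  · have st := facOp_step (Nat.le_add_left 1 n) h.good good oa ob (xpow 1)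
    -- The scaling multiplies x by `alpha 2`, which the factor `alpha (-2)` in the even correction
    -- compensates. What is left of the error is φ times the quantity in `d1`.
    rw [scale_xpow_one, vf_alpha_mul, vf_xpow_one, ea, eb] at st
    have := (((lowerMon_deg _).mul_left phi d1).sub st)
    refine (congrArg (Ord (n + 1 + 1)) ?_).mp this
    have e1 : alpha (-1) * free δ₂ * phi = -(alpha (-1) * (phi * free δ₂)) := by
      rw [mul_assoc, odd_mul_comm pf2, par_phi, neg_mul, mul_neg]
    have e2 : sewOp (xpow 1) = free δ₁ + phi * dphi δ₁ + facOp a b (xpow 1) := by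
      rw [free_add_phi_mul, hδ1, sub_add_cancel]
    rw [neg_mul, e1, e2]
    simp only [neg_neg, mul_add, mul_sub, alpha_mul_alpha_mul, alpha_left_comm _ phi]
    rw [show (2 * 1 + -2 : ℤ) = 0 by norm_num, show (2 * 1 + -1 : ℤ) = 1 by norm_num, alpha_zero,
      one_mul]
    abel
  · have st := facOp_step (Nat.le_add_left 1 n) h.good good oa ob phi
    -- Here φ is multiplied by `alpha 1`, compensated in the odd correction. The remaining
    -- coefficient of φ is a multiple of the quantity in `d2`.
    rw [hs, vf_alpha_mul, vf_phi, ea, eb] at st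
    have := (((lowerMon_deg _).mul_left phi
      ((lowerMon_deg _).mul_left (alpha (-1)) d2)).smul (1 / 2)).neg.sub st
    refine (congrArg (Ord (n + 1 + 1)) ?_).mp this
    have e1 : dx (free δ₁) * phi = phi * dx (free δ₁) :=
      even_mul_comm (par_dx_even (by rw [par_free, p1])) _
    have e2 : sewOp phi = free δ₂ + phi * dphi δ₂ + facOp a b phi := by
      rw [free_add_phi_mul, hδ2, sub_add_cancel]
    rw [e2, dx_neg, dx_alpha_mul, neg_mul, mul_assoc, e1]
    simp only [neg_neg, mul_sub, mul_neg, mul_smul_comm, alpha_mul_alpha_mul, smul_neg]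
    rw [show (1 + -2 : ℤ) = -1 by norm_num, show (1 + -1 : ℤ) = 0 by norm_num,
      show (-1 + 1 : ℤ) = 0 by norm_num, alpha_zero, one_mul, one_mul, alpha_left_comm _ phi]
    module

/-- The sequence of approximate factorizations. -/
def facSeq : ℕ → Ser × Ser
  | 0 => (serA + serB', serM + serN')
  | n + 1 => (nextEven (facSeq n).1 (facSeq n).2, nextOdd (facSeq n).1 (facSeq n).2)

theorem isApproxFac_facSeq (n : ℕ) : IsApproxFac n (facSeq n).1 (facSeq n).2 := by
  induction n with
  | zero => exact isApproxFac_lin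
  | succ n ih => exact ih.next

theorem ord_facSeq_succ (n : ℕ) : Ord (n + 1) ((facSeq (n + 1)).1 - (facSeq n).1) ∧
    Ord (n + 1) ((facSeq (n + 1)).2 - (facSeq n).2) := by
  have h := isApproxFac_facSeq n
  constructor
  · change Ord (n + 1) (nextEven _ _ - _)
    unfold nextEven
    rw [sub_sub_cancel_left]
    exact ((lowerMon_deg _).mul_left _ (ord_free h.ord_x)).neg
  · change Ord (n + 1) (nextOdd _ _ - _)
    unfold nextOdd
    rw [sub_sub_cancel_left]
    exact ((lowerMon_deg _).mul_left _ (ord_free h.ord_phi)).neg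

theorem ord_facSeq {m n : ℕ} (h : m ≤ n) : Ord (m + 1) ((facSeq n).1 - (facSeq m).1) ∧
    Ord (m + 1) ((facSeq n).2 - (facSeq m).2) := by
  induction n, h using Nat.le_induction with
  | base => exact ⟨van_self_sub _, van_self_sub _⟩
  | succ n hn ih =>
    have := ord_facSeq_succ n
    exact ⟨Van.trans (this.1.mono (by omega)) ih.1, Van.trans (this.2.mono (by omega)) ih.2⟩

/-- The even part of the exact factorization. -/
def facEven : Ser := mkSer fun s e => cf (facSeq (deg s e)).1 s e
/-- The odd part of the exact factorization. -/
def facOdd : Ser := mkSer fun s e => cf (facSeq (deg s e)).2 s e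

/-- The correction after stage `n` starts in degree `n + 1`, so a coefficient of degree `d` has its
final value from stage `d` on. -/
theorem ord_facEven_sub (n : ℕ) : Ord (n + 1) (facEven - (facSeq n).1) := fun s e h => by
  have := (ord_facSeq (Nat.le_of_lt_succ h)).1 s e (Nat.lt_succ_self _)
  rw [cf_sub, sub_eq_zero] at this
  rw [cf_sub, sub_eq_zero, this]
  exact cf_mkSer _ _ _

theorem ord_facOdd_sub (n : ℕ) : Ord (n + 1) (facOdd - (facSeq n).2) := fun s e h => by
  have := (ord_facSeq (Nat.le_of_lt_succ h)).2 s e (Nat.lt_succ_self _)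
  rw [cf_sub, sub_eq_zero] at this
  rw [cf_sub, sub_eq_zero, this]
  exact cf_mkSer _ _ _

theorem locConv_of_ord {f : ℕ → Ser} {a : Ser} (h : ∀ n, Ord (n + 1) (a - f n)) :
    LocConv (fun J : ℕ+ => f J) a := fun s e => by
  filter_upwards [eventually_ge_atTop (⟨deg s e + 1, Nat.succ_pos _⟩ : ℕ+)] with J hJ
  have hJ' : deg s e + 1 ≤ (J : ℕ) := hJ
  have := h J s e (show deg s e < J + 1 by omega)
  rw [cf_sub, sub_eq_zero] at this
  exact this.symm

theorem locConv_facEven : LocConv (fun J : ℕ+ => (facSeq J).1) facEven :=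
  locConv_of_ord ord_facEven_sub

theorem locConv_facOdd : LocConv (fun J : ℕ+ => (facSeq J).2) facOdd :=
  locConv_of_ord ord_facOdd_sub

theorem goodVF_fac : GoodVF facEven facOdd where
  even := locConv_facEven.par_even fun J => (isApproxFac_facSeq J).good.even
  odd := locConv_facOdd.par_odd fun J => (isApproxFac_facSeq J).good.odd
  dphi_even := locConv_facEven.dphi fun J => (isApproxFac_facSeq J).good.dphi_even
  dphi_odd := locConv_facOdd.dphi fun J => (isApproxFac_facSeq J).good.dphi_odd
  ord_even := locConv_facEven.van fun J => (isApproxFac_facSeq J).good.ord_even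
  ord_odd := locConv_facOdd.van fun J => (isApproxFac_facSeq J).good.ord_odd

theorem LocConv.sub_const {f : ℕ+ → Ser} {a : Ser} (h : LocConv f a) (b : Ser) :
    LocConv (fun J => f J - b) (a - b) :=
  fun s e => (h s e).mono fun J hJ => by rw [cf_sub, cf_sub, hJ]

theorem van_noAM_facEven : Van noAM (facEven - (serA + serB')) :=
  (locConv_facEven.sub_const _).van fun J => (isApproxFac_facSeq J).even_noAM
theorem van_noBN_facEven : Van noBN (facEven - (serA + serB')) :=
  (locConv_facEven.sub_const _).van fun J => (isApproxFac_facSeq J).even_noBN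
theorem van_noAM_facOdd : Van noAM (facOdd - (serM + serN')) :=
  (locConv_facOdd.sub_const _).van fun J => (isApproxFac_facSeq J).odd_noAM
theorem van_noBN_facOdd : Van noBN (facOdd - (serM + serN')) :=
  (locConv_facOdd.sub_const _).van fun J => (isApproxFac_facSeq J).odd_noBN

/-- The sewing operator is the product of the exponentials of the negative, the positive and the
zero modes of a vector field. -/
theorem sewOp_eq_facOp : sewOp = facOp facEven facOdd := by
  have hd : ∀ (n : ℕ) (u : Ser), Ord (n + 1) (facOp (facSeq n).1 (facSeq n).2 u -
      facOp facEven facOdd u) := fun n u =>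
    (van_facOp_sub (lowerMon_deg _) (ord_facEven_sub n) (ord_facOdd_sub n) u).symm
  refine RHom.ext scHom_sewOp.toRHom goodVF_fac.scHom_facOp.toRHom ?_ ?_
  · exact eq_of_ord_sub fun N => Ord.mono (Nat.le_succ N)
      (Van.trans (isApproxFac_facSeq N).ord_x (hd N _))
  · exact eq_of_ord_sub fun N => Ord.mono (Nat.le_succ N)
      (Van.trans (isApproxFac_facSeq N).ord_phi (hd N _))

/-! ### The coefficient sequences of a vector field -/

/-- The coefficients of `a = ∑_{j ≠ 0} Ψ_j x^(j+1) + 2 Ψ_0 x` and `b = ∑ Ψ_{j-1/2} x^j`. -/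
def psiSeq (a b : Ser) : PsiSeq where
  even j := if j = 0 then (1 / 2 : ℂ) • xc 1 a else xc (j + 1) a
  odd j := xc j b

theorem IsScalar.smul {r : Ser} (h : IsScalar r) (c : ℂ) : IsScalar (c • r) := fun s e k hk =>
  h s e k fun h0 => hk (by rw [coef_smul, h0, smul_zero])

theorem isScalar_psiSeq_even (a b : Ser) (j : ℤ) : IsScalar ((psiSeq a b).even j) := by
  unfold psiSeq
  dsimp only
  split_ifs
  · exact (isScalar_xc _ _).smul _
  · exact isScalar_xc _ _

theorem isScalar_psiSeq_odd (a b : Ser) (j : ℤ) : IsScalar ((psiSeq a b).odd j) := isScalar_xc _ _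

theorem par_psiSeq_even {a b : Ser} (h : par a = a) (j : ℤ) :
    par ((psiSeq a b).even j) = (psiSeq a b).even j := by
  unfold psiSeq
  dsimp only
  split_ifs
  · rw [map_smul, par_xc, h]
  · rw [par_xc, h]

theorem par_psiSeq_odd {a b : Ser} (h : par b = -b) (j : ℤ) :
    par ((psiSeq a b).odd j) = -(psiSeq a b).odd j := by
  unfold psiSeq
  rw [par_xc, h, map_neg]

theorem psiSeq_even_neg (a b : Ser) :
    (fun j : ℕ+ => (psiSeq a b).even (-((j : ℕ) : ℤ))) = fun j : ℕ+ => xc (1 - ((j : ℕ) : ℤ)) a := by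
  funext j
  have := j.pos
  unfold psiSeq
  dsimp only
  rw [if_neg (by omega), neg_add_eq_sub]

theorem psiSeq_even_pos (a b : Ser) :
    (fun j : ℕ+ => (psiSeq a b).even ((j : ℕ) : ℤ)) = fun j : ℕ+ => xc (((j : ℕ) : ℤ) + 1) a := by
  funext j
  have := j.pos
  unfold psiSeq
  dsimp only
  rw [if_neg (by omega)]

theorem injective_one_sub : Function.Injective fun j : ℕ+ => 1 - ((j : ℕ) : ℤ) := fun i j h => by
  have : (i : ℕ) = j := by simp only at h; omega
  exact PNat.coe_injective this

theorem injective_add_one : Function.Injective fun j : ℕ+ => ((j : ℕ) : ℤ) + 1 := fun i j h => by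
  have : (i : ℕ) = j := by simp only at h; omega
  exact PNat.coe_injective this

theorem injective_coe : Function.Injective fun j : ℕ+ => ((j : ℕ) : ℤ) := fun i j h => by
  have : (i : ℕ) = j := by simp only at h; omega
  exact PNat.coe_injective this

theorem range_one_sub (k : ℤ) : k ≤ 0 ↔ k ∈ Set.range fun j : ℕ+ => 1 - ((j : ℕ) : ℤ) :=
  ⟨fun h => ⟨⟨(1 - k).toNat, by omega⟩, by simp only [PNat.mk_coe]; omega⟩,
    fun ⟨j, hj⟩ => by have := j.pos; simp only at hj; omega⟩

theorem range_add_one (k : ℤ) : 2 ≤ k ↔ k ∈ Set.range fun j : ℕ+ => ((j : ℕ) : ℤ) + 1 :=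
  ⟨fun h => ⟨⟨(k - 1).toNat, by omega⟩, by simp only [PNat.mk_coe]; omega⟩,
    fun ⟨j, hj⟩ => by have := j.pos; simp only at hj; omega⟩

theorem range_coe (k : ℤ) : 1 ≤ k ↔ k ∈ Set.range fun j : ℕ+ => ((j : ℕ) : ℤ) :=
  ⟨fun h => ⟨⟨k.toNat, by omega⟩, by simp only [PNat.mk_coe]; omega⟩,
    fun ⟨j, hj⟩ => by have := j.pos; simp only at hj; omega⟩

theorem isExp_psiNeg {a b : Ser} (h : GoodVF a b) : IsExp (psiNeg (psiSeq a b)) (negExp a b) := by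
  unfold psiNeg
  rw [psiSeq_even_neg]
  exact isExp_evf (negOp_eq fun j => isScalar_xc _ _)
    (locConv_xproj injective_one_sub _ range_one_sub h.dphi_even)
    (locConv_xproj injective_one_sub _ range_one_sub h.dphi_odd) (h.xproj _ _)

theorem isExp_psiPos {a b : Ser} (h : GoodVF a b) : IsExp (psiPos (psiSeq a b)) (posExp a b) := by
  unfold psiPos
  rw [psiSeq_even_pos]
  exact isExp_evf (posOp_eq fun j => isScalar_xc _ _)
    (locConv_xproj injective_add_one _ range_add_one h.dphi_even)
    (locConv_xproj injective_coe _ range_coe h.dphi_odd) (h.xproj _ _)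

theorem isExp_neg_psiPos {a b : Ser} (h : GoodVF a b) :
    IsExp (fun J u => -psiPos (psiSeq a b) J u) (evf (-twoPart a) (-posPart b)) := by
  unfold psiPos
  rw [psiSeq_even_pos]
  refine isExp_evf (fun J u => ?_)
    (locConv_xproj injective_add_one _ range_add_one h.dphi_even).neg
    (locConv_xproj injective_coe _ range_coe h.dphi_odd).neg (h.xproj _ _).neg
  rw [posOp_eq fun j => isScalar_xc _ _, vf_neg]
  rfl

theorem xc_mul_xpow {a : Ser} (ha : dphi a = 0) : xc 1 a * xpow 1 = onePart a := by
  refine ser_ext_coef fun s e k => ?_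
  rw [coef_mul_xpow, coef_xc, coef_xproj]
  by_cases hs : ⊥ ∈ s
  · rw [if_neg (fun h => h.1 hs), coef_eq, dphi_eq_zero_iff.1 ha s e hs]
    simp
  · by_cases hk : k = 1
    · rw [if_pos ⟨hs, by omega⟩, if_pos hk, hk]
    · rw [if_neg (fun h => hk (by omega)), if_neg hk]

theorem locConv_const (a : Ser) : LocConv (fun _ => a) a := fun _ _ => Eventually.of_forall fun _ => rfl

theorem two_smul_psiSeq_zero {a b : Ser} (h : dphi a = 0) :
    (2 : ℂ) • ((psiSeq a b).even 0 * xpow 1) = onePart a := by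
  have e : (psiSeq a b).even 0 = (1 / 2 : ℂ) • xc 1 a := by simp [psiSeq]
  rw [e, smul_mul_assoc, xc_mul_xpow h, smul_smul]
  norm_num

theorem isExp_psiZero {a b : Ser} (h : GoodVF a b) :
    IsExp (zeroOp ((psiSeq a b).even 0)) (zeroExp a) := by
  refine isExp_evf (fun J u => ?_) (locConv_const (onePart a)) (locConv_const 0)
    (h.xproj _ fun k => k = 1).zero_right
  rw [zeroOp_eq (isScalar_psiSeq_even a b 0), two_smul_psiSeq_zero h.dphi_even]

theorem isExp_neg_psiZero {a b : Ser} (h : GoodVF a b) :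
    IsExp (zeroOp (-(psiSeq a b).even 0)) (evf (-onePart a) 0) := by
  refine isExp_evf (fun J u => ?_) (locConv_const (-onePart a)) (locConv_const 0) ?_
  · rw [zeroOp_eq (isScalar_psiSeq_even a b 0).neg, neg_mul, smul_neg,
      two_smul_psiSeq_zero h.dphi_even]
  · have := (h.xproj (fun k => k = 1) fun k => k = 1).zero_right.neg
    rwa [neg_zero] at this

/-! ### Mixed terms -/

theorem isMixed_of_van {u : Ser} (h : Van noAM u) (h' : Van noBN u) : IsMixed u := by
  intro s e k hk
  constructor <;> by_contra hc
  · exact hk (by rw [coef_eq, h s e hc]; rfl)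
  · exact hk (by rw [coef_eq, h' s e hc]; rfl)

theorem isMixed_xc_facEven (k : ℤ) : IsMixed (xc k (facEven - (serA + serB'))) :=
  isMixed_of_van (van_xc k van_noAM_facEven) (van_xc k van_noBN_facEven)

theorem isMixed_xc_facOdd (k : ℤ) : IsMixed (xc k (facOdd - (serM + serN'))) :=
  isMixed_of_van (van_xc k van_noAM_facOdd) (van_xc k van_noBN_facOdd)

theorem xc_eq_zero {u : Ser} {k : ℤ} (h : ∀ s e, coef u s e k = 0) : xc k u = 0 :=
  ser_ext_coef fun s e l => by rw [coef_xc, h, ite_self]; rfl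

theorem xc_alpha_mul_scale (m n k : ℤ) (u : Ser) :
    xc k (alpha m * scale n u) = alpha (m + 2 * n * k) * xc k u := by
  refine ser_ext_coef fun s e l => ?_
  rw [coef_xc, coef_alpha_mul, coef_alpha_mul, coef_scale, coef_xc]
  by_cases h : ⊥ ∉ s ∧ l = 0
  · rw [if_pos h, if_pos h, if_neg h.1, ← mul_assoc, ← LaurentPolynomial.T_add]
    congr 2
    ring
  · rw [if_neg h, if_neg h, mul_zero]

theorem xc_serA (j : ℕ+) : xc (((j : ℕ) : ℤ) + 1) serA = -varA j :=
  xc_of_locConv locFam_A.scalar injective_add_one (locConv_lsum locFam_A.fin _) j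
theorem xc_serM (j : ℕ+) : xc ((j : ℕ) : ℤ) serM = -varM j :=
  xc_of_locConv locFam_M.scalar injective_coe (locConv_lsum locFam_M.fin _) j
theorem xc_serB (j : ℕ+) : xc (1 - ((j : ℕ) : ℤ)) serB = -varB j :=
  xc_of_locConv locFam_B.scalar injective_one_sub (locConv_lsum locFam_B.fin _) j
theorem xc_serN (j : ℕ+) : xc (1 - ((j : ℕ) : ℤ)) serN = -varN j :=
  xc_of_locConv locFam_N.scalar injective_one_sub (locConv_lsum locFam_N.fin _) j

/-- The exponents -2, from ∂/∂x, and 2(1 - j), from the power of x, add up to -2j, which stands for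
α₀^{-j}. -/
theorem xc_serB' (j : ℕ+) :
    xc (1 - ((j : ℕ) : ℤ)) serB' = -(alpha (-2 * (j : ℕ)) * varB j) := by
  unfold serB'
  rw [xc_alpha_mul_scale, xc_serB, mul_neg]
  congr 3
  ring

theorem xc_serN' (j : ℕ+) :
    xc (1 - ((j : ℕ) : ℤ)) serN' = -(alpha (-2 * (j : ℕ) + 1) * varN j) := by
  unfold serN'
  rw [xc_alpha_mul_scale, xc_serN, mul_neg]
  congr 3
  ring

/-- The coefficients of the factorization of the sewing operator. -/
def facPsi : PsiSeq := psiSeq facEven facOdd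

theorem isMixed_facPsi (j : ℕ+) :
    IsMixed (facPsi.even (j : ℕ) + varA j) ∧
    IsMixed (facPsi.odd (j : ℕ) + varM j) ∧
    IsMixed (facPsi.even (-((j : ℕ) : ℤ)) + alpha (-2 * (j : ℕ)) * varB j) ∧
    IsMixed (facPsi.odd (1 - (j : ℕ)) + alpha (-2 * (j : ℕ) + 1) * varN j) := by
  have hj := j.pos
  refine ⟨?_, ?_, ?_, ?_⟩
  · have h := isMixed_xc_facEven (((j : ℕ) : ℤ) + 1)
    rw [map_sub, map_add, xc_serA, xc_eq_zero fun s e => coef_serB' s e (by omega), add_zero,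
      sub_neg_eq_add] at h
    rwa [show facPsi.even (j : ℕ) = _ from congrFun (psiSeq_even_pos _ _) j]
  · have h := isMixed_xc_facOdd ((j : ℕ) : ℤ)
    rw [map_sub, map_add, xc_serM, xc_eq_zero fun s e => coef_serN' s e (by omega), add_zero,
      sub_neg_eq_add] at h
    exact h
  · have h := isMixed_xc_facEven (1 - ((j : ℕ) : ℤ))
    rw [map_sub, map_add, xc_serB', xc_eq_zero fun s e => coef_serA s e (by omega), zero_add,
      sub_neg_eq_add] at h
    rwa [show facPsi.even (-((j : ℕ) : ℤ)) = _ from congrFun (psiSeq_even_neg _ _) j]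
  · have h := isMixed_xc_facOdd (1 - ((j : ℕ) : ℤ))
    rw [map_sub, map_add, xc_serN', xc_eq_zero fun s e => coef_serM s e (by omega), zero_add,
      sub_neg_eq_add] at h
    exact h

theorem isMixed_facPsi_zero : IsMixed (facPsi.even 0) := by
  have h : IsMixed ((1 / 2 : ℂ) • xc 1 (facEven - (serA + serB'))) :=
    isMixed_of_van ((van_xc 1 van_noAM_facEven).smul _) ((van_xc 1 van_noBN_facEven).smul _)
  rw [map_sub, map_add, xc_eq_zero fun s e => coef_serA s e (by omega),
    xc_eq_zero fun s e => coef_serB' s e (by omega), add_zero, sub_zero] at h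
  exact h

/-! ### Supports -/

/-- The coefficient of `x^k (α₀^{1/2})^l`. -/
def coeff₂ (k l : ℤ) : XRing →ₗ[ℂ] ℂ where
  toFun p := (p.coeff k).coeff l
  map_add' _ _ := rfl
  map_smul' _ _ := rfl

theorem coeff₂_apply (k l : ℤ) (p : XRing) : coeff₂ k l p = (p.coeff k).coeff l := rfl

/-- The coefficient of a single monomial. -/
def coef₂ (u : Ser) (s : Finset OddVarPhi) (e : EvenVar →₀ ℕ) (k l : ℤ) : ℂ := coeff₂ k l (cf u s e)

theorem coef₂_eq (u : Ser) (s e k l) : coef₂ u s e k l = (coef u s e k).coeff l := rfl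

theorem eq_zero_of_coeff₂_one {k l : ℤ} (h : coeff₂ k l 1 ≠ 0) : k = 0 ∧ l = 0 := by
  have h1 : (1 : XRing).coeff k = if k = 0 then 1 else 0 := by
    rw [AddMonoidAlgebra.one_def, AddMonoidAlgebra.coeff_single, Finsupp.single_apply]
    simp only [eq_comm]
  rw [coeff₂_apply, h1] at h
  split_ifs at h with hk
  · refine ⟨hk, ?_⟩
    by_contra hl
    refine h ?_
    rw [AddMonoidAlgebra.one_def, AddMonoidAlgebra.coeff_single, Finsupp.single_apply,
      if_neg (Ne.symm hl)]
  · exact absurd rfl h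

theorem exists_coeff₂_mul_ne_zero {p q : XRing} {k l : ℤ} (h : coeff₂ k l (p * q) ≠ 0) :
    ∃ i i' j j', i + i' = k ∧ j + j' = l ∧ coeff₂ i j p ≠ 0 ∧ coeff₂ i' j' q ≠ 0 := by
  have key : ∀ {S : Type} [Semiring S] (p q : LaurentPolynomial S) (k : ℤ) (π : S →+ ℂ),
      π ((p * q).coeff k) ≠ 0 → ∃ i j, i + j = k ∧ π (p.coeff i * q.coeff j) ≠ 0 := by
    intro S _ p q k π h
    rw [AddMonoidAlgebra.coeff_mul] at h
    unfold Finsupp.sum at h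
    rw [map_sum] at h
    obtain ⟨i, _, hi⟩ := exists_ne_zero_of_sum_ne_zero h
    rw [map_sum] at hi
    obtain ⟨j, _, hj⟩ := exists_ne_zero_of_sum_ne_zero hi
    refine ⟨i, j, ?_⟩
    by_cases hij : i + j = k
    · exact ⟨hij, by simpa only [if_pos hij] using hj⟩
    · exact absurd (by simp only [if_neg hij, map_zero]) hj
  obtain ⟨i, i', hi, h1⟩ := key p q k
    { toFun := fun c : AlphaRing => c.coeff l, map_zero' := rfl, map_add' := fun _ _ => rfl } h
  obtain ⟨j, j', hj, h2⟩ := key (p.coeff i) (q.coeff i') l (AddMonoidHom.id ℂ) h1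
  exact ⟨i, i', j, j', hi, hj, left_ne_zero_of_mul h2, right_ne_zero_of_mul h2⟩

theorem exists_coef₂_mul_ne_zero {u v : Ser} {s : Finset OddVarPhi} {e : EvenVar →₀ ℕ} {k l : ℤ}
    (h : coef₂ (u * v) s e k l ≠ 0) : ∃ t t' a a' i i' j j', Disjoint t t' ∧ t ∪ t' = s ∧
      a + a' = e ∧ i + i' = k ∧ j + j' = l ∧ coef₂ u t a i j ≠ 0 ∧ coef₂ v t' a' i' j' ≠ 0 := by
  unfold coef₂ at h
  rw [cf_mul, map_sum] at h
  obtain ⟨t, ht, h2⟩ := exists_ne_zero_of_sum_ne_zero h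
  rw [map_sum] at h2
  obtain ⟨p, hp, h3⟩ := exists_ne_zero_of_sum_ne_zero h2
  rw [map_zsmul] at h3
  obtain ⟨i, i', j, j', hi, hj, h4, h5⟩ := exists_coeff₂_mul_ne_zero (right_ne_zero_of_smul h3)
  exact ⟨t, s \ t, p.1, p.2, i, i', j, j', disjoint_sdiff, union_sdiff_of_subset (mem_powerset.1 ht),
    mem_antidiagonal.1 hp, hi, hj, h4, h5⟩

/-- Filtrations of the set of all monomials which are compatible with products and derivatives;
`σ` is the change of the filtration index under multiplication with `φ`. -/
structure SuppFam (σ : ℤ) (Q : ℤ → Finset OddVarPhi → (EvenVar →₀ ℕ) → ℤ → ℤ → Prop) : Prop where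
  mul : ∀ {w w' t t' a a' i i' j j'}, Disjoint t t' → Q w t a i j → Q w' t' a' i' j' →
    Q (w + w') (t ∪ t') (a + a') (i + i') (j + j')
  index_dx : ∀ {w s e k l}, Q w s e (k + 1) l → Q (w - 2 * σ) s e k l
  index_dphi : ∀ {w s e k l}, ⊥ ∉ s → Q w (insert ⊥ s) e k l → Q (w - σ) s e k l
  index_phi : Q σ {⊥} 0 0 0

/-- All monomials of the series satisfy the condition. -/
def Supp (P : Finset OddVarPhi → (EvenVar →₀ ℕ) → ℤ → ℤ → Prop) (u : Ser) : Prop :=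
  ∀ s e k l, coef₂ u s e k l ≠ 0 → P s e k l

section Supp
variable {P : Finset OddVarPhi → (EvenVar →₀ ℕ) → ℤ → ℤ → Prop} {u v : Ser}

theorem Supp.add (hu : Supp P u) (hv : Supp P v) : Supp P (u + v) := fun s e k l h => by
  by_cases h1 : coef₂ u s e k l = 0
  · refine hv s e k l fun h2 => h ?_
    unfold coef₂ at h1 h2 ⊢
    rw [cf_add, map_add, h1, h2, add_zero]
  · exact hu s e k l h1

theorem Supp.smul (c : ℂ) (hu : Supp P u) : Supp P (c • u) := fun s e k l h => by
  refine hu s e k l fun h2 => h ?_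
  unfold coef₂ at h2 ⊢
  rw [cf_smul, map_smul, h2, smul_zero]

theorem Supp.neg (hu : Supp P u) : Supp P (-u) := by
  rw [← neg_one_smul ℂ u]; exact hu.smul _

theorem Supp.sub (hu : Supp P u) (hv : Supp P v) : Supp P (u - v) := by
  rw [sub_eq_add_neg]; exact hu.add hv.neg

theorem supp_zero : Supp P 0 := fun _ _ _ _ h => absurd rfl h

theorem Supp.sum {ι : Type*} {t : Finset ι} {f : ι → Ser} (h : ∀ i ∈ t, Supp P (f i)) :
    Supp P (∑ i ∈ t, f i) := sum_induction f (Supp P) (fun _ _ => Supp.add) supp_zero h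

theorem Supp.mono {P' : Finset OddVarPhi → (EvenVar →₀ ℕ) → ℤ → ℤ → Prop} (hu : Supp P u)
    (h : ∀ s e k l, P s e k l → P' s e k l) : Supp P' u := fun s e k l hc => h s e k l (hu s e k l hc)

end Supp

section SuppFam
variable {σ : ℤ} {Q : ℤ → Finset OddVarPhi → (EvenVar →₀ ℕ) → ℤ → ℤ → Prop}

theorem SuppFam.supp_mul (hQ : SuppFam σ Q) {w w' : ℤ} {u v : Ser} (hu : Supp (Q w) u)
    (hv : Supp (Q w') v) : Supp (Q (w + w')) (u * v) := fun s e k l h => by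
  obtain ⟨t, t', a, a', i, i', j, j', hd, rfl, rfl, rfl, rfl, h1, h2⟩ := exists_coef₂_mul_ne_zero h
  exact hQ.mul hd (hu _ _ _ _ h1) (hv _ _ _ _ h2)

theorem SuppFam.supp_dx (hQ : SuppFam σ Q) {w : ℤ} {u : Ser} (hu : Supp (Q w) u) :
    Supp (Q (w - 2 * σ)) (dx u) := fun s e k l h => by
  refine hQ.index_dx (hu s e (k + 1) l fun h0 => h ?_)
  rw [coef₂_eq] at h0 ⊢
  rw [coef_dx, ← zsmul_eq_mul, AddMonoidAlgebra.coeff_smul, Finsupp.smul_apply, h0, smul_zero]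

theorem SuppFam.supp_dphi (hQ : SuppFam σ Q) {w : ℤ} {u : Ser} (hu : Supp (Q w) u) :
    Supp (Q (w - σ)) (dphi u) := fun s e k l h => by
  unfold coef₂ at h
  rw [cf_dphi] at h
  split_ifs at h with hs
  · exact absurd (map_zero _) h
  · exact hQ.index_dphi hs (hu _ _ _ _ h)

theorem SuppFam.supp_phi (hQ : SuppFam σ Q) : Supp (Q σ) phi := fun s e k l h => by
  unfold coef₂ at h
  rw [cf_phi] at h
  split_ifs at h with hs
  · obtain ⟨rfl, rfl⟩ := hs
    obtain ⟨rfl, rfl⟩ := eq_zero_of_coeff₂_one h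
    exact hQ.index_phi
  · exact absurd (map_zero _) h

/-- The derivatives ∂/∂x and ∂/∂φ shift the index by `-2σ` and `-σ`. So `c` is the net shift caused
by the field, the same for all of its terms. -/
theorem SuppFam.supp_vf (hQ : SuppFam σ Q) {w c : ℤ} {a b u : Ser} (ha : Supp (Q (2 * σ + c)) a)
    (hb : Supp (Q (σ + c)) b) (hu : Supp (Q w) u) : Supp (Q (w + c)) (vf a b u) := by
  have h1 := hQ.supp_mul ha (hQ.supp_dx hu)
  have h2 := hQ.supp_mul (hQ.supp_dx ha) (hQ.supp_mul hQ.supp_phi (hQ.supp_dphi hu))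
  have h3 := hQ.supp_mul hb (hQ.supp_dphi hu)
  have h4 := hQ.supp_mul hb (hQ.supp_mul hQ.supp_phi (hQ.supp_dx hu))
  rw [show 2 * σ + c + (w - 2 * σ) = w + c by ring] at h1
  rw [show 2 * σ + c - 2 * σ + (σ + (w - σ)) = w + c by ring] at h2
  rw [show σ + c + (w - σ) = w + c by ring] at h3
  rw [show σ + c + (σ + (w - 2 * σ)) = w + c by ring] at h4
  have e := vf_apply a b u
  rw [mul_sub] at e
  rw [e]
  exact (h1.add (h2.smul _)).neg.sub (h3.sub h4)

theorem SuppFam.supp_vf_pow (hQ : SuppFam σ Q) {w c : ℤ} {a b u : Ser}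
    (ha : Supp (Q (2 * σ + c)) a) (hb : Supp (Q (σ + c)) b) (hu : Supp (Q w) u) (n : ℕ) :
    Supp (Q (w + n * c)) ((vf a b ^ n) u) := by
  induction n with
  | zero => simpa using hu
  | succ n ih =>
    rw [pow_succ', Module.End.mul_apply]
    have := hQ.supp_vf ha hb ih
    rwa [show w + n * c + c = w + (n + 1 : ℕ) * c by push_cast; ring] at this

/-- At a monomial of degree `d` only the powers up to `d` of the field contribute. Besides support
conditions this bound on `n` later yields the bound on powers of α₀^{1/2}. -/
theorem SuppFam.exists_of_evf (hQ : SuppFam σ Q) {w c : ℤ} {a b u : Ser}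
    (ha : Supp (Q (2 * σ + c)) a) (hb : Supp (Q (σ + c)) b) (hu : Supp (Q w) u) :
    Supp (fun s e k l => ∃ n ≤ deg s e, Q (w + n * c) s e k l) (evf a b u) := fun s e k l h => by
  unfold coef₂ evf at h
  rw [cf_expo, map_sum] at h
  obtain ⟨n, hn, h1⟩ := exists_ne_zero_of_sum_ne_zero h
  rw [map_smul] at h1
  exact ⟨n, Nat.lt_succ_iff.1 (mem_range.1 hn),
    hQ.supp_vf_pow ha hb hu n s e k l (right_ne_zero_of_smul h1)⟩

end SuppFam

/-! ### Weights -/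

/-- The weight of `x^k φ^ε` is `2k + ε`. -/
def wt (s : Finset OddVarPhi) (k : ℤ) : ℤ := 2 * k + if ⊥ ∈ s then 1 else 0

/-- The filtration by `σ` times the weight. -/
def WtLe (σ w : ℤ) (s : Finset OddVarPhi) (_ : EvenVar →₀ ℕ) (k _ : ℤ) : Prop := σ * wt s k ≤ w

/-- For `σ = 1` this bounds the weight from above and for `σ = -1` from below, so negative and
positive modes are treated together. -/
theorem suppFam_wtLe (σ : ℤ) : SuppFam σ (WtLe σ) where
  mul {w w' t t' a a' i i' j j'} hd h h' := by
    have : wt (t ∪ t') (i + i') = wt t i + wt t' i' := by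
      unfold wt
      by_cases h1 : ⊥ ∈ t
      · have h2 : ⊥ ∉ t' := disjoint_left.1 hd h1
        rw [if_pos (mem_union_left _ h1), if_pos h1, if_neg h2]; ring
      · by_cases h2 : ⊥ ∈ t'
        · rw [if_pos (mem_union_right _ h2), if_neg h1, if_pos h2]; ring
        · rw [if_neg (fun h => (mem_union.1 h).elim h1 h2), if_neg h1, if_neg h2]; ring
    unfold WtLe at *
    rw [this, mul_add]
    exact add_le_add h h'
  index_dx {w s e k l} h := by
    unfold WtLe wt at *
    linarith
  index_dphi {w s e k l} hs h := by
    unfold WtLe wt at *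
    rw [if_pos (mem_insert_self _ _)] at h
    rw [if_neg hs]
    linarith
  index_phi := by simp [WtLe, wt]

theorem supp_xpow {P : Finset OddVarPhi → (EvenVar →₀ ℕ) → ℤ → ℤ → Prop} {k : ℤ} (h : P ∅ 0 k 0) :
    Supp P (xpow k) := fun s e i l hc => by
  rw [coef₂_eq] at hc
  have h1 : xpow k = 1 * xpow k := (one_mul _).symm
  rw [h1, coef_mul_xpow, coef_eq, cf_one] at hc
  split_ifs at hc with hs
  · obtain ⟨rfl, rfl⟩ := hs
    obtain ⟨h2, rfl⟩ := eq_zero_of_coeff₂_one hc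
    rwa [sub_eq_zero.1 h2]
  · exact absurd rfl hc

theorem supp_scale {P : Finset OddVarPhi → (EvenVar →₀ ℕ) → ℤ → ℤ → Prop}
    (hP : ∀ s e k l l', P s e k l → P s e k l') {u : Ser} (hu : Supp P u) (n : ℤ) :
    Supp P (scale n u) := fun s e k l hc => by
  rw [coef₂_eq, coef_scale] at hc
  by_contra h
  refine hc ?_
  have : coef u s e k = 0 := by
    refine LaurentPolynomial.ext fun l' => ?_
    by_contra h'
    exact h (hP s e k l' l (hu s e k l' h'))
  rw [this, mul_zero]
  rfl

theorem supp_of_coef {P : Finset OddVarPhi → (EvenVar →₀ ℕ) → ℤ → ℤ → Prop} {u : Ser}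
    (h : ∀ s e k l, coef u s e k ≠ 0 → P s e k l) : Supp P u := fun s e k l hc =>
  h s e k l fun h0 => hc (by rw [coef₂_eq, h0]; rfl)

theorem supp_xproj_even {σ w : ℤ} (p : ℤ → Prop) [DecidablePred p] {a : Ser} (ha : dphi a = 0)
    (h : ∀ k, p k → σ * (2 * k) ≤ w) : Supp (WtLe σ w) (xproj p a) := supp_of_coef fun s e k l hc => by
  rw [coef_xproj] at hc
  split_ifs at hc with hk
  · have hs : ⊥ ∉ s := fun hs => hc (by rw [coef_eq, dphi_eq_zero_iff.1 ha s e hs]; rfl)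
    unfold WtLe wt
    rw [if_neg hs, add_zero]
    exact h k hk
  · exact absurd rfl hc

theorem supp_evf {σ c w : ℤ} (hc : c ≤ 0) {a b u : Ser} (ha : Supp (WtLe σ (2 * σ + c)) a)
    (hb : Supp (WtLe σ (σ + c)) b) (hu : Supp (WtLe σ w) u) : Supp (WtLe σ w) (evf a b u) :=
  ((suppFam_wtLe σ).exists_of_evf ha hb hu).mono fun s e k l ⟨n, _, hn⟩ =>
    hn.trans (by nlinarith [Int.natCast_nonneg n])

theorem supp_evf_sub_self {σ c w : ℤ} (hc : c ≤ 0) {a b u : Ser} (ha : Supp (WtLe σ (2 * σ + c)) a)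
    (hb : Supp (WtLe σ (σ + c)) b) (hu : Supp (WtLe σ w) u) :
    Supp (WtLe σ (w + c)) (evf a b u - u) := fun s e k l h => by
  unfold coef₂ evf at h
  rw [cf_sub, cf_expo, sum_range_succ', map_sub, map_add, map_sum] at h
  simp only [Nat.factorial_zero, Nat.cast_one, inv_one, one_smul, pow_zero, Module.End.one_apply,
    add_sub_cancel_right] at h
  obtain ⟨n, _, h1⟩ := exists_ne_zero_of_sum_ne_zero h
  rw [map_smul] at h1
  have := (suppFam_wtLe σ).supp_vf_pow ha hb hu (n + 1) s e k l (right_ne_zero_of_smul h1)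
  refine this.trans ?_
  push_cast
  nlinarith [Int.natCast_nonneg n]

theorem Supp.coef_eq_zero {P : Finset OddVarPhi → (EvenVar →₀ ℕ) → ℤ → ℤ → Prop} {u : Ser}
    (h : Supp P u) {s e k} (hn : ∀ l, ¬P s e k l) : coef u s e k = 0 :=
  LaurentPolynomial.ext fun l => by
    by_contra hc
    exact hn l (h s e k l hc)

/-! ### Series without `𝒜`, `ℳ` or without `ℬ`, `𝒩` -/

/-- The filtration is constant here: only closure under products and derivatives matters. -/
theorem suppFam_noAM : SuppFam 0 (fun _ s e _ _ => noAM s e) where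
  mul {w w' t t' a a' i i' j j'} _ h h' := by
    rintro ⟨r, hr | hr⟩
    · rcases mem_union.1 hr with h1 | h1
      · exact h ⟨r, Or.inl h1⟩
      · exact h' ⟨r, Or.inl h1⟩
    · by_cases h1 : a (Sum.inl r) = 0
      · exact h' ⟨r, Or.inr fun h2 => hr (by rw [Finsupp.add_apply, h1, h2])⟩
      · exact h ⟨r, Or.inr h1⟩
  index_dx h := h
  index_dphi _ h := fun ⟨r, hr⟩ => h ⟨r, hr.imp_left fun h1 => mem_insert_of_mem h1⟩
  index_phi := by
    rintro ⟨r, hr | hr⟩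
    · exact bot_ne_oddEmb _ (mem_singleton.1 hr).symm
    · exact hr rfl

theorem suppFam_noBN : SuppFam 0 (fun _ s e _ _ => noBN s e) where
  mul {w w' t t' a a' i i' j j'} _ h h' := by
    rintro ⟨r, hr | hr⟩
    · rcases mem_union.1 hr with h1 | h1
      · exact h ⟨r, Or.inl h1⟩
      · exact h' ⟨r, Or.inl h1⟩
    · by_cases h1 : a (Sum.inr r) = 0
      · exact h' ⟨r, Or.inr fun h2 => hr (by rw [Finsupp.add_apply, h1, h2])⟩
      · exact h ⟨r, Or.inr h1⟩
  index_dx h := h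
  index_dphi _ h := fun ⟨r, hr⟩ => h ⟨r, hr.imp_left fun h1 => mem_insert_of_mem h1⟩
  index_phi := by
    rintro ⟨r, hr | hr⟩
    · exact bot_ne_oddEmb _ (mem_singleton.1 hr).symm
    · exact hr rfl

theorem noAM_empty : noAM ∅ 0 := by
  rintro ⟨r, hr | hr⟩
  · exact notMem_empty _ hr
  · exact hr rfl

theorem noBN_empty : noBN ∅ 0 := by
  rintro ⟨r, hr | hr⟩
  · exact notMem_empty _ hr
  · exact hr rfl

theorem LocConv.supp {f : ℕ+ → Ser} {a : Ser} (h : LocConv f a)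
    {P : Finset OddVarPhi → (EvenVar →₀ ℕ) → ℤ → ℤ → Prop} (hf : ∀ J, Supp P (f J)) : Supp P a := by
  intro s e k l hc
  obtain ⟨J, hJ⟩ := h.eq s e
  unfold coef₂ at hc
  rw [hJ] at hc
  exact hf J s e k l hc

theorem supp_lsum {P : Finset OddVarPhi → (EvenVar →₀ ℕ) → Prop}
    (hQ : SuppFam 0 (fun _ s e _ _ => P s e)) (h0 : P ∅ 0) {c : ℕ+ → Ser} (κ : ℕ+ → ℤ)
    (hc : ∀ s e, {j | cf (c j) s e ≠ 0}.Finite) (h : ∀ j, Supp (fun s e _ _ => P s e) (c j)) :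
    Supp (fun s e _ _ => P s e) (lsum c κ) :=
  (locConv_lsum hc κ).supp fun _ => Supp.sum fun j _ =>
    hQ.supp_mul (w := 0) (w' := 0) (h j) (supp_xpow h0)

theorem supp_varA (j : ℕ+) : Supp (fun s e _ _ => noBN s e) (varA j) := fun s e k l hc => by
  unfold coef₂ at hc
  rw [cf_varA] at hc
  split_ifs at hc with h
  · obtain ⟨rfl, rfl⟩ := h
    rintro ⟨r, hr | hr⟩
    · exact notMem_empty _ hr
    · exact hr (by simp)
  · exact absurd (map_zero _) hc

theorem supp_varB (j : ℕ+) : Supp (fun s e _ _ => noAM s e) (varB j) := fun s e k l hc => by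
  unfold coef₂ at hc
  rw [cf_varB] at hc
  split_ifs at hc with h
  · obtain ⟨rfl, rfl⟩ := h
    rintro ⟨r, hr | hr⟩
    · exact notMem_empty _ hr
    · exact hr (by simp)
  · exact absurd (map_zero _) hc

theorem idxM_ne_idxN (i j : ℕ+) : idxM i ≠ idxN j := fun h => by
  have h1 := oddEmb.injective h
  exact Sum.inl_ne_inr (toLex.injective h1)

theorem supp_varM (j : ℕ+) : Supp (fun s e _ _ => noBN s e) (varM j) := fun s e k l hc => by
  unfold coef₂ at hc
  rw [cf_varM] at hc
  split_ifs at hc with h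
  · obtain ⟨rfl, rfl⟩ := h
    rintro ⟨r, hr | hr⟩
    · exact idxM_ne_idxN _ _ (mem_singleton.1 hr).symm
    · exact hr rfl
  · exact absurd (map_zero _) hc

theorem supp_varN (j : ℕ+) : Supp (fun s e _ _ => noAM s e) (varN j) := fun s e k l hc => by
  unfold coef₂ at hc
  rw [cf_varN] at hc
  split_ifs at hc with h
  · obtain ⟨rfl, rfl⟩ := h
    rintro ⟨r, hr | hr⟩
    · exact idxM_ne_idxN _ _ (mem_singleton.1 hr)
    · exact hr rfl
  · exact absurd (map_zero _) hc

theorem supp_serA : Supp (fun s e _ _ => noBN s e) serA :=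
  supp_lsum suppFam_noBN noBN_empty _ locFam_A.fin fun j => (supp_varA j).neg
theorem supp_serM : Supp (fun s e _ _ => noBN s e) serM :=
  supp_lsum suppFam_noBN noBN_empty _ locFam_M.fin fun j => (supp_varM j).neg
theorem supp_serB : Supp (fun s e _ _ => noAM s e) serB :=
  supp_lsum suppFam_noAM noAM_empty _ locFam_B.fin fun j => (supp_varB j).neg
theorem supp_serN : Supp (fun s e _ _ => noAM s e) serN :=
  supp_lsum suppFam_noAM noAM_empty _ locFam_N.fin fun j => (supp_varN j).neg

open Classical in
theorem setAMZero_eq {u v : Ser} (h : Van noAM (u - v)) (hv : Supp (fun s e _ _ => noAM s e) v) :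
    setAMZero u = v := by
  refine ser_ext fun s e => ?_
  change (if HasAM s e then 0 else cf u s e) = cf v s e
  split_ifs with hs
  · exact LaurentPolynomial.ext fun k => (hv.coef_eq_zero fun _ hn => hn hs).symm
  · have := h s e hs
    rwa [cf_sub, sub_eq_zero] at this

open Classical in
theorem setBNZero_eq {u v : Ser} (h : Van noBN (u - v)) (hv : Supp (fun s e _ _ => noBN s e) v) :
    setBNZero u = v := by
  refine ser_ext fun s e => ?_
  change (if HasBN s e then 0 else cf u s e) = cf v s e
  split_ifs with hs
  · exact LaurentPolynomial.ext fun k => (hv.coef_eq_zero fun _ hn => hn hs).symm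
  · have := h s e hs
    rwa [cf_sub, sub_eq_zero] at this

theorem supp_evf_of_fam {P : Finset OddVarPhi → (EvenVar →₀ ℕ) → Prop}
    (hQ : SuppFam 0 (fun _ s e _ _ => P s e)) {a b u : Ser} (ha : Supp (fun s e _ _ => P s e) a)
    (hb : Supp (fun s e _ _ => P s e) b) (hu : Supp (fun s e _ _ => P s e) u) :
    Supp (fun s e _ _ => P s e) (evf a b u) :=
  (hQ.exists_of_evf (w := 0) (c := 0) ha hb hu).mono fun _ _ _ _ ⟨_, _, h⟩ => h

/-! ### The solution of the sewing equation -/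

/-- The inverse of the exponentials of the positive and the zero modes. -/
def invPosOp (a b : Ser) : Ser →ₗ[ℂ] Ser :=
  evf (-onePart a) 0 ∘ₗ scaleL (-1) ∘ₗ evf (-twoPart a) (-posPart b)

theorem invPosOp_apply (a b u : Ser) : invPosOp a b u =
    evf (-onePart a) 0 (scale (-1) (evf (-twoPart a) (-posPart b) u)) := by
  rw [← scaleL_apply]; rfl

theorem GoodVF.neg_onePart {a b : Ser} (h : GoodVF a b) : GoodVF (-onePart a) 0 := by
  have := (h.xproj (fun k => k = 1) fun k => k = 1).zero_right.neg
  rwa [neg_zero] at this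

theorem GoodVF.scHom_invPosOp {a b : Ser} (h : GoodVF a b) : SCHom (invPosOp a b) :=
  (scHom_evf h.neg_onePart).comp ((scHom_scale (-1)).comp (scHom_evf (h.xproj _ _).neg))

/-- Cancelling the positive, scaling and zero factors leaves the negative ones. Applied at x and φ,
this is the sewing equation for `facF`. -/
theorem GoodVF.facOp_invPosOp {a b : Ser} (h : GoodVF a b) (u : Ser) :
    facOp a b (invPosOp a b u) = negExp a b u := by
  have h1 := evf_neg_apply (h.xproj (fun k => k = 1) fun k => k = 1).zero_right
  rw [neg_zero] at h1
  rw [facOp_apply, invPosOp_apply, h1, scale_scale_neg, evf_neg_apply (h.xproj _ _)]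
  rfl

theorem ord_invPosOp_sub {a b : Ser} (h : GoodVF a b) (u : Ser) :
    Ord 1 (invPosOp a b u - scale (-1) u) := by
  rw [invPosOp_apply]
  exact ord_evf_sub h.neg_onePart (van_scale_sub (lowerMon_deg 1) (-1)
    (ord_evf_sub (h.xproj _ _).neg (van_self_sub _)))

theorem van_negExp_sub {Λ : Finset OddVarPhi → (EvenVar →₀ ℕ) → Prop} (hΛ : LowerMon Λ)
    {a b a' b' : Ser} (ha : Van Λ (a - a')) (hb : Van Λ (b - b')) (u : Ser) :
    Van Λ (negExp a b u - negExp a' b' u) :=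
  van_evf_sub hΛ (van_xproj_sub _ ha) (van_xproj_sub _ hb) (van_self_sub _)

theorem van_neg_sub {Λ : Finset OddVarPhi → (EvenVar →₀ ℕ) → Prop} {u v : Ser} (h : Van Λ (u - v)) :
    Van Λ (-u - -v) := by
  rw [neg_sub_neg]; exact h.symm

theorem van_invPosOp_sub {Λ : Finset OddVarPhi → (EvenVar →₀ ℕ) → Prop} (hΛ : LowerMon Λ)
    {a b a' b' : Ser} (ha : Van Λ (a - a')) (hb : Van Λ (b - b')) (u : Ser) :
    Van Λ (invPosOp a b u - invPosOp a' b' u) := by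
  rw [invPosOp_apply, invPosOp_apply]
  exact van_evf_sub hΛ (van_neg_sub (van_xproj_sub _ ha)) (van_self_sub _)
    (van_scale_sub hΛ (-1) (van_evf_sub hΛ (van_neg_sub (van_xproj_sub _ ha))
      (van_neg_sub (van_xproj_sub _ hb)) (van_self_sub _)))

theorem negExp_AM (u : Ser) : negExp serA serM u = u := by
  have h1 : nonposPart serA = 0 := xproj_eq_zero fun s e k hk => coef_serA s e (by omega)
  have h2 : nonposPart serM = 0 := xproj_eq_zero fun s e k hk => coef_serM s e (by omega)
  unfold negExp
  rw [h1, h2, evf_zero]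

theorem negExp_BN (u : Ser) : negExp serB' serN' u = evf serB' serN' u := by
  have h1 : nonposPart serB' = serB' := xproj_eq_self fun s e k hk => coef_serB' s e (by omega)
  have h2 : nonposPart serN' = serN' := xproj_eq_self fun s e k hk => coef_serN' s e (by omega)
  unfold negExp
  rw [h1, h2]

theorem invPosOp_AM (u : Ser) :
    invPosOp serA serM u = scale (-1) (evf (-serA) (-serM) u) := by
  have h3 : twoPart serA = serA := xproj_eq_self fun s e k hk => coef_serA s e (by omega)
  have h4 : posPart serM = serM := xproj_eq_self fun s e k hk => coef_serM s e (by omega)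
  have h5 : onePart serA = 0 := xproj_eq_zero fun s e k hk => coef_serA s e (by omega)
  rw [invPosOp_apply, h3, h4, h5, neg_zero, evf_zero]

theorem invPosOp_BN (u : Ser) : invPosOp serB' serN' u = scale (-1) u := by
  have h3 : twoPart serB' = 0 := xproj_eq_zero fun s e k hk => coef_serB' s e (by omega)
  have h4 : posPart serN' = 0 := xproj_eq_zero fun s e k hk => coef_serN' s e (by omega)
  have h5 : onePart serB' = 0 := xproj_eq_zero fun s e k hk => coef_serB' s e (by omega)
  rw [invPosOp_apply, h3, h4, h5, neg_zero, evf_zero, evf_zero]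

theorem van_fac_AM : Van noAM (facEven - serB') ∧ Van noAM (facOdd - serN') := by
  constructor
  · refine van_noAM_facEven.trans ?_
    rw [add_sub_cancel_right]; exact van_serA
  · refine van_noAM_facOdd.trans ?_
    rw [add_sub_cancel_right]; exact van_serM

theorem van_fac_BN : Van noBN (facEven - serA) ∧ Van noBN (facOdd - serM) := by
  constructor
  · refine van_noBN_facEven.trans ?_
    rw [add_sub_cancel_left]; exact van_serB'
  · refine van_noBN_facOdd.trans ?_
    rw [add_sub_cancel_left]; exact van_serN'

/-- The solution of the sewing equation. -/
def facF : (Ser × Ser) × (Ser × Ser) := (img (negExp facEven facOdd), img (invPosOp facEven facOdd))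

theorem supp_xpow_one_wt (σ : ℤ) : Supp (WtLe σ (2 * σ)) (xpow 1) :=
  supp_xpow (by simp [WtLe, wt, mul_comm])

theorem supp_phi_wt (σ : ℤ) : Supp (WtLe σ σ) phi := (suppFam_wtLe σ).supp_phi

section
variable {a b : Ser}

theorem GoodVF.supp_nonpos (h : GoodVF a b) : Supp (WtLe 1 (2 * 1 + -1)) (nonposPart a) ∧
    Supp (WtLe 1 (1 + -1)) (nonposPart b) :=
  ⟨supp_xproj_even _ h.dphi_even fun k hk => by linarith,
    supp_xproj_even _ h.dphi_odd fun k hk => by linarith⟩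

theorem GoodVF.supp_pos (h : GoodVF a b) : Supp (WtLe (-1) (2 * (-1) + -1)) (twoPart a) ∧
    Supp (WtLe (-1) (-1 + -1)) (posPart b) :=
  ⟨supp_xproj_even _ h.dphi_even fun k hk => by linarith,
    supp_xproj_even _ h.dphi_odd fun k hk => by linarith⟩

theorem GoodVF.supp_negExp (h : GoodVF a b) {w : ℤ} {u : Ser} (hu : Supp (WtLe 1 w) u) :
    Supp (WtLe 1 w) (negExp a b u) :=
  supp_evf (by norm_num) h.supp_nonpos.1 h.supp_nonpos.2 hu

theorem GoodVF.supp_negExp_sub (h : GoodVF a b) {w : ℤ} {u : Ser} (hu : Supp (WtLe 1 w) u) :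
    Supp (WtLe 1 (w + -1)) (negExp a b u - u) :=
  supp_evf_sub_self (by norm_num) h.supp_nonpos.1 h.supp_nonpos.2 hu

theorem GoodVF.supp_invPosOp (h : GoodVF a b) {w : ℤ} {u : Ser} (hu : Supp (WtLe (-1) w) u) :
    Supp (WtLe (-1) w) (invPosOp a b u) := by
  rw [invPosOp_apply]
  refine supp_evf (c := 0) le_rfl ?_ supp_zero (supp_scale (fun _ _ _ _ _ h => h)
    (supp_evf (c := -1) (by norm_num) h.supp_pos.1.neg h.supp_pos.2.neg hu) _)
  exact (supp_xproj_even _ h.dphi_even fun k hk => by linarith).neg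

end

theorem cf_xpow_of_hasAM {k : ℤ} {s : Finset OddVarPhi} {e : EvenVar →₀ ℕ} (h : HasAM s e) (i : ℤ) :
    coef (xpow k) s e i = 0 :=
  Supp.coef_eq_zero (P := fun s e _ _ => noAM s e) (supp_xpow noAM_empty) fun _ hn => hn h

open Classical in
theorem inftyNormalized_of {f : Ser}
    (h : ∀ s e k, HasAM s e → ⊥ ∉ s → 1 ≤ k → coef f s e k = 0) : InftyNormalized f := by
  intro s e k hs hk
  have : coef (setAMZero f) s e k = (if HasAM s e then 0 else cf f s e : XRing).coeff k := rfl
  rw [this]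
  split_ifs with hA
  · exact h s e k hA hs hk
  · rfl

theorem supp_serBN' : Supp (fun s e _ _ => noAM s e) serB' ∧ Supp (fun s e _ _ => noAM s e) serN' := by
  have hα : ∀ n u, Supp (fun s e _ _ => noAM s e) u → Supp (fun s e _ _ => noAM s e) (alpha n * u) :=
    fun n u hu => supp_of_coef fun s e k l hc hA => hc (by
      rw [coef_alpha_mul, hu.coef_eq_zero fun _ hn => hn hA, mul_zero])
  exact ⟨hα _ _ (supp_scale (fun _ _ _ _ _ h => h) supp_serB 1),
    hα _ _ (supp_scale (fun _ _ _ _ _ h => h) supp_serN 1)⟩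

/-- The boundary conditions hold because, at (𝒜, ℳ) = 0 or (ℬ, 𝒩) = 0, the field reduces to its
linear part. The spaces and the normalization come from the weights, and the sewing equation from
the factorization. -/
theorem isSewingSolution_facF : IsSewingSolution facF := by
  have g := goodVF_fac
  have x1 := g.supp_negExp (supp_xpow_one_wt 1)
  have p1 := g.supp_negExp (supp_phi_wt 1)
  have x2 := g.supp_invPosOp (supp_xpow_one_wt (-1))
  have p2 := g.supp_invPosOp (supp_phi_wt (-1))
  have bAM := fun u => (van_negExp_sub lowerMon_noAM van_fac_AM.1 van_fac_AM.2 u)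
  have bBN := fun u => (van_negExp_sub lowerMon_noBN van_fac_BN.1 van_fac_BN.2 u)
  have cAM := fun u => (van_invPosOp_sub lowerMon_noAM van_fac_AM.1 van_fac_AM.2 u)
  have cBN := fun u => (van_invPosOp_sub lowerMon_noBN van_fac_BN.1 van_fac_BN.2 u)
  refine ⟨⟨fun s e k hc => ?_, fun s e k hc => ?_⟩, ⟨fun s e k hc => ?_, fun s e k hc => ?_⟩,
    ?_, ?_, ?_, ?_, ?_, ?_, ⟨?_, ?_⟩, ?_⟩
  · by_contra hk
    refine hc (x1.coef_eq_zero fun l hl => ?_)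
    unfold WtLe wt at hl
    split_ifs at hl <;> omega
  · by_contra hk
    refine hc (p1.coef_eq_zero fun l hl => ?_)
    unfold WtLe wt at hl
    split_ifs at hl <;> omega
  · by_contra hk
    refine hc (x2.coef_eq_zero fun l hl => ?_)
    unfold WtLe wt at hl
    split_ifs at hl with hs
    · exact hk ⟨by omega, fun h => absurd hs h⟩
    · exact hk ⟨by omega, fun _ => by omega⟩
  · by_contra hk
    refine hc (p2.coef_eq_zero fun l hl => ?_)
    unfold WtLe wt at hl
    split_ifs at hl with hs
    · exact hk ⟨by omega, fun h => absurd hs h⟩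
    · exact hk ⟨by omega, fun _ => by omega⟩
  · refine g.scHom_negExp.isSuperconformal (n := 0) ?_
    rw [alpha_zero, one_mul]
    exact ord_evf_sub (g.xproj _ _) (van_self_sub _)
  · refine g.scHom_invPosOp.isSuperconformal (n := -1) ?_
    rw [← scale_phi]
    exact ord_invPosOp_sub g phi
  · refine ⟨_, isExp_BN.hasExpPair _, Prod.ext ?_ ?_⟩
    · change setAMZero _ = scale 1 (evf serB serN (scale (-1) (xpow 1)))
      -- The conjugation by the scaling in the boundary condition turns the ℬ, 𝒩 field into its
      -- rescaled form.
      rw [scale_evf_BN, scale_scale_neg, ← negExp_BN]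
      refine setAMZero_eq (bAM _) ?_
      rw [negExp_BN]
      exact supp_evf_of_fam suppFam_noAM supp_serBN'.1 supp_serBN'.2 (supp_xpow noAM_empty)
    · change setAMZero _ = scale 1 (evf serB serN (scale (-1) phi))
      rw [scale_evf_BN, scale_scale_neg, ← negExp_BN]
      refine setAMZero_eq (bAM _) ?_
      rw [negExp_BN]
      exact supp_evf_of_fam suppFam_noAM supp_serBN'.1 supp_serBN'.2 suppFam_noAM.supp_phi
  · refine Prod.ext (setBNZero_eq ?_ (supp_xpow noBN_empty)) (setBNZero_eq ?_ suppFam_noBN.supp_phi)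
    · have := bBN (xpow 1)
      rwa [negExp_AM] at this
    · have := bBN phi
      rwa [negExp_AM] at this
  · refine Prod.ext ?_ ?_
    · change setAMZero _ = alpha (2 * (-1)) * xpow 1
      rw [← scale_xpow_one, ← invPosOp_BN]
      refine setAMZero_eq (cAM _) ?_
      rw [invPosOp_BN]
      exact supp_scale (fun _ _ _ _ _ h => h) (supp_xpow noAM_empty) _
    · change setAMZero _ = alpha (-1) * phi
      rw [← scale_phi, ← invPosOp_BN]
      refine setAMZero_eq (cAM _) ?_
      rw [invPosOp_BN]
      exact supp_scale (fun _ _ _ _ _ h => h) suppFam_noAM.supp_phi _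
  · refine ⟨_, isExp_AM_neg.hasExpPair _, Prod.ext ?_ ?_⟩
    · change setBNZero _ = scale (-1) (evf (-serA) (-serM) (xpow 1))
      rw [← invPosOp_AM]
      refine setBNZero_eq (cBN _) ?_
      rw [invPosOp_AM]
      exact supp_scale (fun _ _ _ _ _ h => h)
        (supp_evf_of_fam suppFam_noBN supp_serA.neg supp_serM.neg (supp_xpow noBN_empty)) _
    · change setBNZero _ = scale (-1) (evf (-serA) (-serM) phi)
      rw [← invPosOp_AM]
      refine setBNZero_eq (cBN _) ?_
      rw [invPosOp_AM]
      exact supp_scale (fun _ _ _ _ _ h => h)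
        (supp_evf_of_fam suppFam_noBN supp_serA.neg supp_serM.neg suppFam_noBN.supp_phi) _
  -- A φ-free term with a positive power of x has weight at least 2, while negative modes change x
  -- only by terms of weight at most 1.
  · refine inftyNormalized_of fun s e k hA hs hk => ?_
    have h1 := (g.supp_negExp_sub (supp_xpow_one_wt 1)).coef_eq_zero (s := s) (e := e) (k := k)
      fun l hl => by
        unfold WtLe wt at hl
        rw [if_neg hs] at hl
        omega
    rw [coef_sub, cf_xpow_of_hasAM hA, sub_zero] at h1
    exact h1
  -- The image of φ has weight at most 1, too little for a positive power of x.
  · refine inftyNormalized_of fun s e k hA hs hk => p1.coef_eq_zero fun l hl => ?_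
    unfold WtLe wt at hl
    rw [if_neg hs] at hl
    omega
  · refine sewing_iff.2 ?_
    rw [sewOp_eq_facOp]
    exact Prod.ext (g.facOp_invPosOp _).symm (g.facOp_invPosOp _).symm

theorem isPsi_facPsi : IsPsi facF facPsi where
  even j := ⟨isScalar_psiSeq_even _ _ j, isEvenSer_iff.2 (par_psiSeq_even goodVF_fac.even j)⟩
  odd j := ⟨isScalar_psiSeq_odd _ _ j, isOddSer_iff.2 (par_psiSeq_odd goodVF_fac.odd j)⟩
  eq₁ := (isExp_psiNeg goodVF_fac).hasExpPair _
  eq₂ := by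
    refine ⟨_, (isExp_neg_psiPos goodVF_fac).hasExpPair _, ?_⟩
    have := (isExp_neg_psiZero goodVF_fac).hasExpPair
      (scalePair (-1) (evf (-twoPart facEven) (-posPart facOdd) (xpow 1),
        evf (-twoPart facEven) (-posPart facOdd) phi))
    unfold facF img
    rw [invPosOp_apply, invPosOp_apply]
    exact this

/-! ### Uniqueness of the solution of the sewing equation -/

theorem cf_mul_phi {s : Finset OddVarPhi} (hs : ⊥ ∉ s) (u : Ser) (e) : cf (u * phi) s e = 0 :=
  cf_mul_eq_zero fun t a b _ _ => Or.inr (by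
    rw [cf_phi, if_neg]
    rintro ⟨h, -⟩
    exact hs (sdiff_subset (h ▸ mem_singleton_self _)))

theorem ord_sewOp_sub {m : ℕ} {u : Ser} (hu : Ord m u) : Ord (m + 1) (sewOp u - scale 1 u) := by
  rw [sewOp_apply]
  have h1 : Ord (m + 1) (evf serB serN u - u) := expo_sub_self goodVF_BN.raises hu
  have h2 : Ord m (scale 1 (evf serB serN u)) :=
    (lowerMon_deg m).scale 1 ((localOp_vf _ _).expo.ord hu)
  exact Van.trans (expo_sub_self goodVF_AM.raises h2) (van_scale_sub (lowerMon_deg _) 1 h1)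

theorem not_hasAM_of_deg {s : Finset OddVarPhi} {e : EvenVar →₀ ℕ} (h : deg s e < 1) :
    ¬HasAM s e := by
  unfold deg at h
  have h1 : (s.erase ⊥).card = 0 := by omega
  have h2 : e = 0 := (Finsupp.degree_eq_zero_iff e).1 (by omega)
  rintro ⟨j, hj | hj⟩
  · have : idxM j ∈ s.erase ⊥ := mem_erase.2 ⟨(bot_ne_oddEmb _).symm, hj⟩
    rw [card_eq_zero.1 h1] at this
    exact notMem_empty _ this
  · exact hj (by rw [h2]; rfl)

open Classical in
theorem cf_setAMZero (u : Ser) (s e) : cf (setAMZero u) s e = if HasAM s e then 0 else cf u s e := rfl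

theorem IsSewingSolution.ord_phi {F : (Ser × Ser) × (Ser × Ser)} (h : IsSewingSolution F) :
    Ord 1 (F.2.2 - alpha (-1) * phi) := fun s e hs => by
  classical
  have h1 := congrArg (fun u => cf u s e) (congrArg Prod.snd h.boundary₂')
  simp only [cf_setAMZero, if_neg (not_hasAM_of_deg hs)] at h1
  rw [cf_sub, h1, sub_self]

theorem IsSewingSolution.setAMZero_eq {F F' : (Ser × Ser) × (Ser × Ser)} (h : IsSewingSolution F)
    (h' : IsSewingSolution F') :
    setAMZero F.1.1 = setAMZero F'.1.1 ∧ setAMZero F.1.2 = setAMZero F'.1.2 := by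
  obtain ⟨U, hU, e⟩ := h.boundary₁
  obtain ⟨U', hU', e'⟩ := h'.boundary₁
  rw [hU.unique hU', ← e'] at e
  exact Prod.mk.inj e

/-- For positive powers of x the normalization and the boundary condition determine `sewOp f`, and
in lowest degree `sewOp` is the invertible scaling. Nonpositive powers do not occur without φ in
`ZeroSpace`. -/
theorem ord_free_difference {m : ℕ} {f f' : Ser} (hm : Ord m (f - f')) (hz : ZeroSpace f)
    (hz' : ZeroSpace f') (hn : InftyNormalized (sewOp f)) (hn' : InftyNormalized (sewOp f'))
    (hA : setAMZero (sewOp f) = setAMZero (sewOp f')) : Ord (m + 1) (free (f - f')) := by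
  intro s e hs
  refine LaurentPolynomial.ext fun k => ?_
  by_cases hb : ⊥ ∈ s
  · rw [dphi_eq_zero_iff.1 (dphi_free _) s e hb]
  have h1 : cf (free (f - f')) s e = cf (f - f') s e := by
    have : cf (phi * dphi (f - f')) s e = 0 := by rw [phi_mul, cf_mul_phi hb]
    unfold free
    rw [cf_sub, this, sub_zero]
  rw [h1, ← coef_eq]
  by_cases hk : 1 ≤ k
  · have h2 : coef (sewOp f - sewOp f') s e k = 0 := by
      rw [coef_sub, hn s e k hb hk, hn' s e k hb hk, hA, sub_self]
    have h3 : coef (sewOp (f - f') - scale 1 (f - f')) s e k = 0 := by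
      rw [coef_eq, ord_sewOp_sub hm s e hs]; rfl
    rw [coef_sub, map_sub, h2, zero_sub, neg_eq_zero, coef_scale] at h3
    exact ((LaurentPolynomial.isUnit_T _).mul_right_eq_zero).1 h3
  · rw [coef_sub, not_not.1 fun h => hk ((hz s e k h).2 hb),
      not_not.1 fun h => hk ((hz' s e k h).2 hb), sub_zero]
    rfl

/-- Induction on the degree in which the second pairs may differ; the sewing equation then
determines the first pair from the second. -/
theorem IsSewingSolution.unique {F F' : (Ser × Ser) × (Ser × Ser)} (h : IsSewingSolution F)
    (h' : IsSewingSolution F') : F = F' := by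
  have s := sewing_iff.1 h.sewing
  have s' := sewing_iff.1 h'.sewing
  have key : ∀ m, Ord m (F.2.1 - F'.2.1) ∧ Ord m (F.2.2 - F'.2.2) := by
    intro m
    induction m with
    | zero => exact ⟨ord_zero _, ord_zero _⟩
    | succ m ih =>
      have n := h.normalized
      have n' := h'.normalized
      have A := h.setAMZero_eq h'
      rw [s] at n A
      rw [s'] at n' A
      have f1 := ord_free_difference ih.1 h.space₂.1 h'.space₂.1 n.1 n'.1 A.1
      have f2 := ord_free_difference ih.2 h.space₂.2 h'.space₂.2 n.2 n'.2 A.2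
      -- In lowest degree the coefficients of φ in the differences are determined by the φ-free
      -- parts, which vanish by `f1` and `f2`.
      obtain ⟨d1, d2⟩ := superconformal_difference h.superconformal₂.2.2.1
        h'.superconformal₂.2.2.1 ih.2 h.ord_phi h'.ord_phi
      have d1' : Ord (m + 1) (dphi (F.2.1 - F'.2.1)) := by
        have := d1.add ((lowerMon_deg (m + 1)).mul_left (alpha (-1)) f2)
        rwa [sub_add_cancel] at this
      have d2' : Ord (m + 1) (dphi (F.2.2 - F'.2.2)) := by
        have h1 := (((lowerMon_deg (m + 1)).dx f1).sub d2).smul (1 / 2)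
        rw [sub_sub_cancel, smul_smul] at h1
        have h2 := (lowerMon_deg (m + 1)).mul_left (alpha 1) h1
        rw [show (1 / 2 * 2 : ℂ) = 1 by norm_num, one_smul, alpha_mul_alpha_mul,
          show (1 + -1 : ℤ) = 0 by norm_num, alpha_zero, one_mul] at h2
        exact h2
      constructor
      · rw [← free_add_phi_mul (F.2.1 - F'.2.1)]
        exact f1.add ((lowerMon_deg (m + 1)).mul_left phi d1')
      · rw [← free_add_phi_mul (F.2.2 - F'.2.2)]
        exact f2.add ((lowerMon_deg (m + 1)).mul_left phi d2')
  have e1 := eq_of_ord_sub fun m => (key m).1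
  have e2 := eq_of_ord_sub fun m => (key m).2
  have e : F.2 = F'.2 := Prod.ext e1 e2
  refine Prod.ext ?_ e
  rw [s, s', e]

/-! ### Uniqueness of the exponential coordinates -/

/-- The weight analogue of `raises_pow_sub`, for operators which are not known to raise the degree.
-/
theorem supp_pow_sub {σ w w₀ : ℤ} {P P' : Ser →ₗ[ℂ] Ser}
    (hP : ∀ w u, Supp (WtLe σ w) u → Supp (WtLe σ (w - 1)) (P u))
    (hP' : ∀ w u, Supp (WtLe σ w) u → Supp (WtLe σ (w - 1)) (P' u))
    (hd : ∀ w' u, Supp (WtLe σ w') u → Supp (WtLe σ (w' - w)) (P u - P' u)) {u : Ser}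
    (hu : Supp (WtLe σ w₀) u) (n : ℕ) :
    Supp (WtLe σ (w₀ - n)) ((P' ^ n) u) ∧
      Supp (WtLe σ (w₀ - w - n)) ((P ^ (n + 1)) u - (P' ^ (n + 1)) u) := by
  induction n with
  | zero =>
    refine ⟨by simpa using hu, ?_⟩
    simpa using hd w₀ u hu
  | succ n ih =>
    have h1 : Supp (WtLe σ (w₀ - (n + 1 : ℕ))) ((P' ^ (n + 1)) u) := by
      rw [pow_succ', Module.End.mul_apply]
      have := hP' _ _ ih.1
      rwa [show w₀ - (n : ℤ) - 1 = w₀ - (n + 1 : ℕ) by push_cast; ring] at this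
    refine ⟨h1, ?_⟩
    have h2 := hP _ _ ih.2
    have h3 := hd _ _ h1
    rw [show w₀ - w - (n : ℤ) - 1 = w₀ - w - (n + 1 : ℕ) by push_cast; ring] at h2
    rw [show w₀ - ((n + 1 : ℕ) : ℤ) - w = w₀ - w - (n + 1 : ℕ) by ring] at h3
    have e : (P ^ (n + 1 + 1)) u - (P' ^ (n + 1 + 1)) u = P ((P ^ (n + 1)) u - (P' ^ (n + 1)) u) +
        (P ((P' ^ (n + 1)) u) - P' ((P' ^ (n + 1)) u)) := by
      rw [pow_succ' P (n + 1), pow_succ' P' (n + 1), Module.End.mul_apply, Module.End.mul_apply,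
        map_sub]
      abel
    rw [e]
    exact h2.add h3

theorem supp_expPartial_sub {σ w w₀ : ℤ} {P P' : Ser →ₗ[ℂ] Ser}
    (hP : ∀ w u, Supp (WtLe σ w) u → Supp (WtLe σ (w - 1)) (P u))
    (hP' : ∀ w u, Supp (WtLe σ w) u → Supp (WtLe σ (w - 1)) (P' u))
    (hd : ∀ w' u, Supp (WtLe σ w') u → Supp (WtLe σ (w' - w)) (P u - P' u)) {u : Ser}
    (hu : Supp (WtLe σ w₀) u) {N : ℕ} (hN : 2 ≤ N) :
    Supp (WtLe σ (w₀ - w - 1)) (expPartial P N u - expPartial P' N u - (P u - P' u)) := by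
  obtain ⟨N, rfl⟩ := Nat.exists_eq_add_of_le' hN
  unfold expPartial
  rw [← sum_sub_distrib, sum_range_succ', sum_range_succ']
  simp only [← smul_sub]
  have e : ∀ A B C : Ser, A + B + C - B = A + C := fun A B C => by abel
  have h1 : ((((0 + 1 : ℕ).factorial : ℂ)⁻¹) • ((P ^ (0 + 1)) u - (P' ^ (0 + 1)) u)) = P u - P' u := by
    simp
  have h0 : ((((0 : ℕ).factorial : ℂ)⁻¹) • ((P ^ 0) u - (P' ^ 0) u)) = 0 := by
    simp
  rw [h1, h0, e, add_zero]
  refine Supp.sum fun n _ => Supp.smul _ ?_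
  refine ((supp_pow_sub hP hP' hd hu (n + 1)).2).mono fun s e k l h => ?_
  unfold WtLe at *
  push_cast at h
  linarith [Int.natCast_nonneg n]

theorem coef_psum_apply {c : ℕ+ → Ser} (hc : ∀ j, IsScalar (c j)) {κ : ℕ+ → ℤ}
    (hκ : Function.Injective κ) {j J : ℕ+} (hJ : j ≤ J) (s e) :
    coef (psum c κ J) s e (κ j) = coef (c j) s e 0 := by
  rw [coef_psum hc, sum_eq_single j]
  · rw [if_pos rfl]
  · intro i _ hi
    exact if_neg fun h => hi (hκ h)
  · intro h
    exact absurd (mem_Icc.2 ⟨one_le, hJ⟩) h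

theorem supp_psum {σ w : ℤ} {c : ℕ+ → Ser} (hc : ∀ j, IsScalar (c j)) {κ : ℕ+ → ℤ}
    (h : ∀ j, c j ≠ 0 → σ * (2 * κ j) ≤ w) (J : ℕ+) : Supp (WtLe σ w) (psum c κ J) := by
  refine supp_of_coef fun s e k l hk => ?_
  rw [coef_psum hc] at hk
  obtain ⟨j, _, hj⟩ := exists_ne_zero_of_sum_ne_zero hk
  split_ifs at hj with hkj
  · have hs := (hc j s e 0 hj).1
    have h0 : c j ≠ 0 := fun h0 => hj (by rw [h0]; rfl)
    unfold WtLe wt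
    rw [if_neg hs, add_zero, ← hkj]
    exact h j h0
  · exact absurd rfl hj

theorem psum_sub (c c' : ℕ+ → Ser) (κ : ℕ+ → ℤ) (J : ℕ+) :
    psum c κ J - psum c' κ J = psum (fun j => c j - c' j) κ J := by
  unfold psum
  rw [← sum_sub_distrib]
  exact sum_congr rfl fun j _ => (sub_mul _ _ _).symm

theorem IsScalar.sub {r r' : Ser} (h : IsScalar r) (h' : IsScalar r') : IsScalar (r - r') :=
  fun s e k hk => by
    by_cases h0 : coef r s e k = 0
    · exact h' s e k fun h1 => hk (by rw [coef_sub, h0, h1, sub_zero])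
    · exact h s e k h0

theorem IsScalar.eq_of_coef {r r' : Ser} (h : IsScalar r) (h' : IsScalar r')
    (he : ∀ s e, ⊥ ∉ s → coef r s e 0 = coef r' s e 0) : r = r' :=
  ser_ext_coef fun s e k => by
    by_cases hc : ⊥ ∉ s ∧ k = 0
    · rw [hc.2, he s e hc.1]
    · rw [not_not.1 fun h0 => hc (h s e k h0), not_not.1 fun h0 => hc (h' s e k h0)]

theorem coef_eq_zero_of_mul_phi {b : Ser} (hb : dphi b = 0) {s : Finset OddVarPhi} (hs : ⊥ ∉ s)
    {e k} (h : coef (b * phi) (insert ⊥ s) e k = 0) : coef b s e k = 0 := by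
  have h1 : dphi (b * phi) = par b := by
    rw [dphi_mul, hb, zero_mul, zero_add, dphi_phi, mul_one]
  have h2 := congrArg (fun u => cf u s e) h1
  simp only [cf_dphi, if_neg hs, cf_par] at h2
  rw [coef_eq, h2] at h
  rcases Nat.even_or_odd s.card with hc | hc
  · rw [hc.neg_one_pow, one_smul] at h
    exact h
  · rw [hc.neg_one_pow, neg_one_smul] at h
    exact neg_eq_zero.1 h

/-- Induction on the weight: the j-th even coefficient shifts `σ` times the weight by `-2j` and the
j-th odd one by `-(2j - 1)`. If the coordinates agree up to shifts smaller than `w`, the images of x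
differ at shift `w` only by the linear term of the exponentials. Its φ-free part shows the even and
its φ-part the odd coefficients, so the image of φ is not needed. -/
theorem exp_coords_unique {σ : ℤ} {κ κ' : ℕ+ → ℤ}
    (hκ : ∀ j : ℕ+, σ * (2 * κ j) = 2 * σ - 2 * (j : ℕ))
    (hκ' : ∀ j : ℕ+, σ * (2 * κ' j) = σ - (2 * (j : ℕ) - 1))
    {c c' d d' : ℕ+ → Ser} (hc : ∀ j, IsScalar (c j)) (hc' : ∀ j, IsScalar (c' j))
    (hd : ∀ j, IsScalar (d j)) (hd' : ∀ j, IsScalar (d' j)) {T T' : ℕ+ → Ser → Ser}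
    (hT : ∀ J u, T J u = vf (psum c κ J) (psum d κ' J) u)
    (hT' : ∀ J u, T' J u = vf (psum c' κ J) (psum d' κ' J) u) {v : Ser}
    (h : HasExp T (xpow 1) v) (h' : HasExp T' (xpow 1) v) : c = c' ∧ d = d' := by
  have iκ : Function.Injective κ := fun i j hij => by
    have h1 := hκ i
    rw [hij, hκ j] at h1
    exact PNat.coe_injective (by omega)
  have iκ' : Function.Injective κ' := fun i j hij => by
    have h1 := hκ' i
    rw [hij, hκ' j] at h1
    exact PNat.coe_injective (by omega)
  have low : ∀ {c d : ℕ+ → Ser}, (∀ j, IsScalar (c j)) → (∀ j, IsScalar (d j)) → ∀ (J : ℕ+) w u,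
      Supp (WtLe σ w) u → Supp (WtLe σ (w - 1)) (vf (psum c κ J) (psum d κ' J) u) := by
    intro c d hc hd J w u hu
    refine (suppFam_wtLe σ).supp_vf (c := -1) (supp_psum hc (fun j _ => ?_) J)
      (supp_psum hd (fun j _ => ?_) J) hu
    · have := j.pos; rw [hκ]; omega
    · have := j.pos; rw [hκ']; omega
  have key : ∀ w : ℕ, ∀ j : ℕ+, (2 * (j : ℕ) < w → c j = c' j) ∧ (2 * (j : ℕ) - 1 < w → d j = d' j) := by
    intro w
    induction w with
    | zero => exact fun j => ⟨fun h => absurd h (Nat.not_lt_zero _), fun h => absurd h (Nat.not_lt_zero _)⟩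
    | succ w ih =>
      have sa : ∀ J, Supp (WtLe σ (2 * σ + -w)) (psum c κ J - psum c' κ J) := fun J => by
        rw [psum_sub]
        refine supp_psum (fun j => (hc j).sub (hc' j)) (fun j hj => ?_) J
        have : ¬(2 * (j : ℕ) < w) := fun h => hj (sub_eq_zero.2 ((ih j).1 h))
        rw [hκ]; omega
      have sb : ∀ J, Supp (WtLe σ (σ + -w)) (psum d κ' J - psum d' κ' J) := fun J => by
        rw [psum_sub]
        refine supp_psum (fun j => (hd j).sub (hd' j)) (fun j hj => ?_) J
        have : ¬(2 * (j : ℕ) - 1 < w) := fun h => hj (sub_eq_zero.2 ((ih j).2 h))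
        have := j.pos
        rw [hκ']; omega
      -- At a finite stage with equal coefficients, the nonlinear part of the difference has
      -- strictly greater shift. So the difference of the two fields applied to x vanishes at shift
      -- exactly `w`.
      have main : ∀ s e k (j : ℕ+), σ * wt s k = 2 * σ - w → ∃ J, j ≤ J ∧
          coef (-(psum c κ J - psum c' κ J) + (psum d κ' J - psum d' κ' J) * phi) s e k = 0 := by
        intro s e k j hw
        obtain ⟨p, ⟨h1, h2⟩, h3⟩ := (((h s e k).and (h' s e k)).and
          (eventually_ge_atTop ((2, j) : ℕ × ℕ+))).exists
        have hN : 2 ≤ p.1 := h3.1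
        refine ⟨p.2, h3.2, ?_⟩
        have it : ∀ {T : ℕ+ → Ser → Ser} {c d : ℕ+ → Ser},
            (∀ J u, T J u = vf (psum c κ J) (psum d κ' J) u) →
            ∑ n ∈ range p.1, ((n.factorial : ℂ)⁻¹) • (T p.2)^[n] (xpow 1) =
              expPartial (vf (psum c κ p.2) (psum d κ' p.2)) p.1 (xpow 1) := by
          intro T c d hT
          refine sum_congr rfl fun n _ => ?_
          rw [Module.End.pow_apply]
          exact congrArg (fun F : Ser → Ser => ((n.factorial : ℂ)⁻¹) • F^[n] (xpow 1)) (funext (hT p.2))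
        rw [it hT] at h1
        rw [it hT'] at h2
        have h4 := supp_expPartial_sub (low hc hd p.2) (low hc' hd' p.2) (w := w)
          (fun w' u hu => by
            rw [← vf_sub]
            exact (suppFam_wtLe σ).supp_vf (sa p.2) (sb p.2) hu) (supp_xpow_one_wt σ) hN
        have h5 := h4.coef_eq_zero (s := s) (e := e) (k := k) fun l hl => by
          unfold WtLe at hl
          omega
        rw [coef_sub, coef_sub, h1, h2, sub_self, zero_sub, neg_eq_zero, ← vf_sub, vf_xpow_one] at h5
        exact h5
      have da : ∀ J, dphi (psum c κ J - psum c' κ J) = 0 := fun J => by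
        rw [dphi_sub, dphi_psum hc, dphi_psum hc', sub_zero]
      have db : ∀ J, dphi (psum d κ' J - psum d' κ' J) = 0 := fun J => by
        rw [dphi_sub, dphi_psum hd, dphi_psum hd', sub_zero]
      intro j
      constructor
      · intro hj
        rcases Nat.lt_succ_iff_lt_or_eq.1 hj with hj | hj
        · exact (ih j).1 hj
        refine (hc j).eq_of_coef (hc' j) fun s e hs => ?_
        obtain ⟨J, hJ, h0⟩ := main s e (κ j) j (by
          unfold wt; rw [if_neg hs, add_zero, hκ]; omega)
        have hb : coef ((psum d κ' J - psum d' κ' J) * phi) s e (κ j) = 0 := by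
          rw [coef_eq, cf_mul_phi hs]; rfl
        rw [coef_add, hb, add_zero, coef_neg, neg_eq_zero, coef_sub, coef_psum_apply hc iκ hJ,
          coef_psum_apply hc' iκ hJ, sub_eq_zero] at h0
        exact h0
      · intro hj
        rcases Nat.lt_succ_iff_lt_or_eq.1 hj with hj | hj
        · exact (ih j).2 hj
        refine (hd j).eq_of_coef (hd' j) fun s e hs => ?_
        have := j.pos
        obtain ⟨J, hJ, h0⟩ := main (insert ⊥ s) e (κ' j) j (by
          unfold wt; rw [if_pos (mem_insert_self _ _), mul_add, hκ']; omega)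
        have ha : coef (-(psum c κ J - psum c' κ J)) (insert ⊥ s) e (κ' j) = 0 := by
          rw [coef_neg, coef_eq, dphi_eq_zero_iff.1 (da J) _ _ (mem_insert_self _ _)]
          simp
        rw [coef_add, ha, zero_add] at h0
        have h1 := coef_eq_zero_of_mul_phi (db J) hs h0
        rw [coef_sub, coef_psum_apply hd iκ' hJ, coef_psum_apply hd' iκ' hJ, sub_eq_zero] at h1
        exact h1
  exact ⟨funext fun j => (key (2 * j + 1) j).1 (by omega), funext fun j => (key (2 * j + 1) j).2 (by omega)⟩

/-! ### Uniqueness of the coefficient of the zero mode -/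

theorem IsScalar.cf_eq {r : Ser} (h : IsScalar r) (s e) :
    cf r s e = LaurentPolynomial.C (coef r s e 0) := by
  refine LaurentPolynomial.ext fun k => ?_
  rw [LaurentPolynomial.C_apply, ← coef_eq]
  split_ifs with hk
  · rw [hk]
  · exact not_not.1 fun h0 => hk (h s e k h0).2

theorem coef_scalar_mul {r : Ser} (h : IsScalar r) (v : Ser) (s e k) : coef (r * v) s e k =
    ∑ t ∈ s.powerset, ∑ p ∈ antidiagonal e,
      sgn t (s \ t) • (coef r t p.1 0 * coef v (s \ t) p.2 k) := by
  let L : XRing →+ AlphaRing :=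
    { toFun := fun p => p.coeff k, map_zero' := rfl, map_add' := fun _ _ => rfl }
  change L (cf (r * v) s e) = _
  rw [cf_mul, map_sum]
  refine sum_congr rfl fun t _ => ?_
  rw [map_sum]
  refine sum_congr rfl fun p _ => ?_
  rw [map_zsmul]
  refine congrArg (fun z => sgn t (s \ t) • z) ?_
  change (cf r t p.1 * cf v (s \ t) p.2).coeff k = _
  rw [h.cf_eq, ← LaurentPolynomial.smul_eq_C_mul, AddMonoidAlgebra.coeff_smul_apply]
  rfl

theorem IsScalar.mul {r r' : Ser} (h : IsScalar r) (h' : IsScalar r') : IsScalar (r * r') :=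
  fun s e k hk => by
    rw [coef_scalar_mul h] at hk
    obtain ⟨t, ht, h1⟩ := exists_ne_zero_of_sum_ne_zero hk
    obtain ⟨p, hp, h2⟩ := exists_ne_zero_of_sum_ne_zero h1
    have h3 := right_ne_zero_of_smul h2
    have h4 := h _ _ _ (left_ne_zero_of_mul h3)
    have h5 := h' _ _ _ (right_ne_zero_of_mul h3)
    refine ⟨fun hs => ?_, h5.2⟩
    rw [← union_sdiff_of_subset (mem_powerset.1 ht)] at hs
    exact (mem_union.1 hs).elim h4.1 h5.1

theorem xc_scalar_mul {r : Ser} (h : IsScalar r) (k : ℤ) (v : Ser) : xc k (r * v) = r * xc k v := by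
  refine (isScalar_xc _ _).eq_of_coef (h.mul (isScalar_xc _ _)) fun s e hs => ?_
  rw [coef_xc, if_pos ⟨hs, rfl⟩, coef_scalar_mul h, coef_scalar_mul h]
  refine sum_congr rfl fun t ht => sum_congr rfl fun p _ => ?_
  rw [coef_xc, if_pos ⟨fun hb => hs (sdiff_subset hb), rfl⟩]

/-- On the φ-free coefficient of x the zero mode acts as multiplication by a scalar. -/
theorem xc_zeroOp {r : Ser} (h : IsScalar r) (J : ℕ+) (u : Ser) :
    xc 1 (zeroOp (-r) J u) = (2 : ℂ) • r * xc 1 u := by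
  have e : zeroOp (-r) J u = (2 : ℂ) • r * (xpow 1 * dx u) + r * (phi * dphi u) := by
    unfold zeroOp opL
    rw [xpow_zero, mul_one, zero_add, Int.cast_zero, zero_add]
    simp only [neg_mul, mul_neg, smul_neg, smul_add, mul_add, mul_smul_comm, smul_mul_assoc]
    module
  rw [e, map_add, xc_scalar_mul (h.smul _), xc_scalar_mul h]
  have e1 : xc 1 (xpow 1 * dx u) = xc 1 u := ser_ext_coef fun s e l => by
    rw [coef_xc, coef_xc, xpow_comm, coef_mul_xpow, coef_dx]
    norm_num
  have e2 : xc 1 (phi * dphi u) = 0 := ser_ext_coef fun s e l => by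
    rw [coef_xc]
    split_ifs with hc
    · rw [phi_mul, coef_eq, cf_mul_phi hc.1]; rfl
    · rfl
  rw [e1, e2, mul_zero, add_zero]

theorem xc_zeroOp_iterate {r : Ser} (h : IsScalar r) (J : ℕ+) (n : ℕ) (u : Ser) :
    xc 1 ((zeroOp (-r) J)^[n] u) = (LinearMap.mulLeft ℂ ((2 : ℂ) • r) ^ n) (xc 1 u) := by
  induction n with
  | zero => rfl
  | succ n ih =>
    rw [Function.iterate_succ_apply', xc_zeroOp h, ih, pow_succ', Module.End.mul_apply,
      LinearMap.mulLeft_apply]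

theorem supp_expPartial_sub_self {σ w : ℤ} {P : Ser →ₗ[ℂ] Ser}
    (hP : ∀ w u, Supp (WtLe σ w) u → Supp (WtLe σ (w - 1)) (P u)) {u : Ser}
    (hu : Supp (WtLe σ w) u) {N : ℕ} (hN : 1 ≤ N) :
    Supp (WtLe σ (w - 1)) (expPartial P N u - u) := by
  have hpow : ∀ n : ℕ, Supp (WtLe σ (w - n)) ((P ^ n) u) := by
    intro n
    induction n with
    | zero => simpa using hu
    | succ n ih =>
      rw [pow_succ', Module.End.mul_apply]
      have := hP _ _ ih
      rwa [show w - (n : ℤ) - 1 = w - (n + 1 : ℕ) by push_cast; ring] at this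
  obtain ⟨N, rfl⟩ := Nat.exists_eq_add_of_le' hN
  unfold expPartial
  rw [sum_range_succ']
  simp only [Nat.factorial_zero, Nat.cast_one, inv_one, one_smul, pow_zero, Module.End.one_apply,
    add_sub_cancel_right]
  refine Supp.sum fun n _ => Supp.smul _ ((hpow (n + 1)).mono fun s e k l h => ?_)
  unfold WtLe at *
  push_cast at h
  linarith [Int.natCast_nonneg n]

theorem neg_psiPos_eq {Ψ : PsiSeq} (h : ∀ j, IsScalar (Ψ.even j)) (J : ℕ+) (u : Ser) :
    -psiPos Ψ J u = vf (psum (fun j : ℕ+ => -Ψ.even (j : ℕ)) (fun j => ((j : ℕ) : ℤ) + 1) J)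
      (psum (fun j : ℕ+ => -Ψ.odd (j : ℕ)) (fun j => ((j : ℕ) : ℤ)) J) u := by
  rw [psum_neg, psum_neg, vf_neg]
  unfold psiPos
  rw [posOp_eq fun j => h _]

theorem iterate_eq_expPartial {T : Ser → Ser} {P : Ser →ₗ[ℂ] Ser} (hT : ∀ u, T u = P u) (N : ℕ)
    (u : Ser) : ∑ n ∈ range N, ((n.factorial : ℂ)⁻¹) • T^[n] u = expPartial P N u := by
  refine sum_congr rfl fun n _ => ?_
  rw [Module.End.pow_apply]
  exact congrArg (fun F : Ser → Ser => ((n.factorial : ℂ)⁻¹) • F^[n] u) (funext hT)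

/-- Positive modes strictly raise the weight, so they cannot change the coefficient of x itself. -/
theorem xc_of_hasExp_neg_psiPos {Ψ : PsiSeq} (he : ∀ j, IsScalar (Ψ.even j))
    (ho : ∀ j, IsScalar (Ψ.odd j)) {v : Ser} (h : HasExp (fun J u => -psiPos Ψ J u) (xpow 1) v) :
    xc 1 v = 1 := by
  refine (isScalar_xc _ _).eq_of_coef isScalar_one fun s e hs => ?_
  rw [coef_xc, if_pos ⟨hs, rfl⟩]
  obtain ⟨p, h1, h2⟩ := ((h s e 1).and (eventually_ge_atTop ((1, 1) : ℕ × ℕ+))).exists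
  rw [iterate_eq_expPartial (neg_psiPos_eq he p.2)] at h1
  have sa : Supp (WtLe (-1) (2 * (-1) + -1))
      (psum (fun j : ℕ+ => -Ψ.even (j : ℕ)) (fun j => ((j : ℕ) : ℤ) + 1) p.2) :=
    supp_psum (fun j => (he _).neg) (fun j _ => by have := j.pos; omega) p.2
  have sb : Supp (WtLe (-1) (-1 + -1))
      (psum (fun j : ℕ+ => -Ψ.odd (j : ℕ)) (fun j => ((j : ℕ) : ℤ)) p.2) :=
    supp_psum (fun j => (ho _).neg) (fun j _ => by have := j.pos; omega) p.2
  have h3 := (supp_expPartial_sub_self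
    (fun w u hu => (suppFam_wtLe (-1)).supp_vf sa sb hu) (supp_xpow_one_wt (-1)) h2.1).coef_eq_zero
      (s := s) (e := e) (k := 1) fun l hl => by
        unfold WtLe wt at hl
        rw [if_neg hs] at hl
        omega
  rw [coef_sub, h1, sub_eq_zero] at h3
  rw [h3, ← one_mul (xpow 1), coef_mul_xpow, sub_self]

/-- The coefficient of x in the second pair is exp(2Ψ₀) α₀^{-1}: the positive modes leave it equal
to 1, the scaling gives `alpha (-2)`, and the zero mode gives the exponential. Only eventual
equality of partial sums is available at this point. -/
theorem IsPsi.eventually_zero {F : (Ser × Ser) × (Ser × Ser)} {Ψ : PsiSeq} (h : IsPsi F Ψ)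
    {s : Finset OddVarPhi} (hs : ⊥ ∉ s) (e) : ∀ᶠ N in atTop,
      coef (expPartial (LinearMap.mulLeft ℂ ((2 : ℂ) • Ψ.even 0)) N (alpha (-2))) s e 0 =
        coef F.2.1 s e 1 := by
  obtain ⟨U, hU, hF⟩ := h.eq₂
  obtain ⟨⟨N₀, J₀⟩, h0⟩ := eventually_atTop.1 (hF.1 s e 1)
  filter_upwards [eventually_ge_atTop N₀] with N hN
  rw [← h0 (N, J₀) ⟨hN, le_rfl⟩]
  have h1 : ∀ u, coef u s e 1 = coef (xc 1 u) s e 0 := fun u => by rw [coef_xc, if_pos ⟨hs, rfl⟩]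
  rw [h1, map_sum]
  simp only [map_smul, xc_zeroOp_iterate (h.even 0).1]
  have h2 : xc 1 (scalePair (-1) U).1 = alpha (-2) := by
    have := xc_alpha_mul_scale 0 (-1) 1 U.1
    rw [alpha_zero, one_mul] at this
    change xc 1 (scale (-1) U.1) = _
    rw [this, xc_of_hasExp_neg_psiPos (fun j => (h.even j).1) (fun j => (h.odd j).1) hU.1, mul_one]
    norm_num
  rw [h2]
  rfl

theorem cf_mul_const (u v : Ser) : cf (u * v) ∅ 0 = cf u ∅ 0 * cf v ∅ 0 := by
  rw [cf_mul]
  simp [sgn, inversions]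

theorem eq_empty_of_deg {s : Finset OddVarPhi} {e : EvenVar →₀ ℕ} (hs : ⊥ ∉ s) (h : deg s e < 1) :
    s = ∅ ∧ e = 0 := by
  unfold deg at h
  rw [erase_eq_of_notMem hs] at h
  exact ⟨card_eq_zero.1 (by omega), (Finsupp.degree_eq_zero_iff e).1 (by omega)⟩

theorem IsScalar.ord_of {r : Ser} (h : IsScalar r) {m : ℕ}
    (h0 : ∀ s e, ⊥ ∉ s → deg s e < m → coef r s e 0 = 0) : Ord m r := fun s e hd => by
  rw [h.cf_eq]
  by_cases hs : ⊥ ∈ s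
  · rw [not_not.1 fun hc => (h s e 0 hc).1 hs, map_zero]
  · rw [h0 s e hs hd, map_zero]

theorem cf_alpha_const (n : ℤ) : cf (alpha n) ∅ 0 = LaurentPolynomial.C (LaurentPolynomial.T n) := by
  rw [(isScalar_alpha n).cf_eq, ← mul_one (alpha n), coef_alpha_mul, coef_eq, cf_one]
  simp

/-- A nonzero constant term of Ψ₀ is ruled out by convergence: partial sums that are eventually
stationary have a vanishing term (2c₀)^N α₀^{-1} / N!, and Laurent polynomials have no nilpotents.
-/
theorem IsPsi.ord_zero_mode {F : (Ser × Ser) × (Ser × Ser)} {Ψ : PsiSeq} (h : IsPsi F Ψ) :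
    Ord 1 (Ψ.even 0) := by
  refine (h.even 0).1.ord_of fun s e hs hd => ?_
  obtain ⟨rfl, rfl⟩ := eq_empty_of_deg hs hd
  obtain ⟨N, hN⟩ := eventually_atTop.1 (h.eventually_zero hs 0)
  have h1 := (hN (N + 1) (Nat.le_succ N)).trans (hN N le_rfl).symm
  unfold expPartial at h1
  rw [sum_range_succ, coef_add, add_eq_left, coef_smul] at h1
  have h2 := (smul_eq_zero.1 h1).resolve_left (inv_ne_zero (by exact_mod_cast N.factorial_ne_zero))
  set c₀ := coef (Ψ.even 0) ∅ 0 0 with hc₀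
  have h3 : ∀ n : ℕ, cf ((LinearMap.mulLeft ℂ ((2 : ℂ) • Ψ.even 0) ^ n) (alpha (-2))) ∅ 0 =
      LaurentPolynomial.C (((2 : ℂ) • c₀) ^ n * LaurentPolynomial.T (-2)) := by
    intro n
    induction n with
    | zero => rw [pow_zero, Module.End.one_apply, cf_alpha_const, pow_zero, one_mul]
    | succ n ih =>
      rw [pow_succ', Module.End.mul_apply, LinearMap.mulLeft_apply, cf_mul_const, ih,
        ((h.even 0).1.smul 2).cf_eq, coef_smul, ← hc₀, ← map_mul, pow_succ', mul_assoc]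
  rw [coef_eq, h3, LaurentPolynomial.C_apply, if_pos rfl] at h2
  have h4 := ((LaurentPolynomial.isUnit_T (-2)).mul_left_eq_zero).1 h2
  by_contra hne
  exact pow_ne_zero N (smul_ne_zero two_ne_zero hne) h4

/-- Now that multiplication by 2Ψ₀ raises the degree, the exponential is injective by induction on
the degree, its linear term being dominant. -/
theorem IsPsi.zero_mode_unique {F : (Ser × Ser) × (Ser × Ser)} {Ψ Ψ' : PsiSeq} (h : IsPsi F Ψ)
    (h' : IsPsi F Ψ') : Ψ.even 0 = Ψ'.even 0 := by
  refine eq_of_ord_sub fun m => ?_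
  induction m with
  | zero => exact ord_zero _
  | succ m ih =>
    refine ((h.even 0).1.sub (h'.even 0).1).ord_of fun s e hs hd => ?_
    obtain ⟨N, ⟨h1, h2⟩, hN⟩ := (((h.eventually_zero hs e).and (h'.eventually_zero hs e)).and
      (eventually_ge_atTop 2)).exists
    have r : Raises m (LinearMap.mulLeft ℂ ((2 : ℂ) • Ψ.even 0) -
        LinearMap.mulLeft ℂ ((2 : ℂ) • Ψ'.even 0)) := by
      have : LinearMap.mulLeft ℂ ((2 : ℂ) • Ψ.even 0) - LinearMap.mulLeft ℂ ((2 : ℂ) • Ψ'.even 0) =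
          LinearMap.mulLeft ℂ ((2 : ℂ) • (Ψ.even 0 - Ψ'.even 0)) := LinearMap.ext fun u => by
        rw [LinearMap.sub_apply, LinearMap.mulLeft_apply, LinearMap.mulLeft_apply,
          LinearMap.mulLeft_apply, smul_sub, sub_mul]
      rw [this]
      exact raises_mulLeft (ih.smul 2)
    have h3 := expPartial_sub (raises_mulLeft (h.ord_zero_mode.smul 2))
      (raises_mulLeft (h'.ord_zero_mode.smul 2)) r N hN (alpha (-2)) s e hd
    have h4 : coef ((LinearMap.mulLeft ℂ ((2 : ℂ) • Ψ.even 0) -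
        LinearMap.mulLeft ℂ ((2 : ℂ) • Ψ'.even 0)) (alpha (-2))) s e 0 = 0 := by
      have := congrArg (fun q : XRing => q.coeff 0) h3
      simp only [← coef_eq, coef_sub] at this
      rw [h1, h2, sub_self, zero_sub] at this
      exact neg_eq_zero.1 this
    rw [LinearMap.sub_apply, LinearMap.mulLeft_apply, LinearMap.mulLeft_apply, ← sub_mul, ← smul_sub,
      ← alpha_comm, coef_alpha_mul, coef_smul] at h4
    exact (smul_eq_zero.1 (((LaurentPolynomial.isUnit_T _).mul_right_eq_zero).1 h4)).resolve_left
      two_ne_zero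

theorem goodVF_zeroOp {c : Ser} (hs : IsScalar c) (hp : par c = c) (h : Ord 1 c) :
    GoodVF ((2 : ℂ) • (c * xpow 1)) 0 where
  even := by rw [map_smul, par_mul, hp, par_xpow]
  odd := by rw [map_zero, neg_zero]
  dphi_even := by
    rw [dphi_smul, dphi_mul, dphi_eq_zero_of_isScalar hs, dphi_xpow, zero_mul, mul_zero, add_zero,
      smul_zero]
  dphi_odd := dphi_zero
  ord_even := ((lowerMon_deg 1).mul_right _ h).smul 2
  ord_odd := Van.zero

theorem isExp_zeroOp {c : Ser} (hs : IsScalar c) (hp : par c = c) (h : Ord 1 c) :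
    IsExp (zeroOp c) (evf ((2 : ℂ) • (c * xpow 1)) 0) :=
  isExp_evf (zeroOp_eq hs) (locConv_const _) (locConv_const _) (goodVF_zeroOp hs hp h)

theorem evf_injective {a b : Ser} (h : GoodVF a b) : Function.Injective (evf a b) := fun u v he => by
  rw [← evf_neg_apply' h u, he, evf_neg_apply' h v]

theorem scale_injective (n : ℤ) : Function.Injective (scale n) := fun u v he => by
  rw [← scale_neg_scale n u, he, scale_neg_scale n v]

theorem IsPsi.unique {F : (Ser × Ser) × (Ser × Ser)} {Ψ Ψ' : PsiSeq} (h : IsPsi F Ψ)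
    (h' : IsPsi F Ψ') : Ψ = Ψ' := by
  have hz := h.zero_mode_unique h'
  have hs := fun j => (h.even j).1
  have ho := fun j => (h.odd j).1
  have hs' := fun j => (h'.even j).1
  have ho' := fun j => (h'.odd j).1
  have hneg := exp_coords_unique (σ := 1) (κ := fun j => 1 - ((j : ℕ) : ℤ))
    (κ' := fun j => 1 - ((j : ℕ) : ℤ)) (fun j => by ring) (fun j => by ring)
    (c := fun j => Ψ.even (-((j : ℕ) : ℤ))) (c' := fun j => Ψ'.even (-((j : ℕ) : ℤ)))
    (d := fun j => Ψ.odd (1 - (j : ℕ))) (d' := fun j => Ψ'.odd (1 - (j : ℕ)))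
    (fun j => hs _) (fun j => hs' _) (fun j => ho _) (fun j => ho' _)
    (negOp_eq fun j => hs _) (negOp_eq fun j => hs' _) h.eq₁.1 h'.eq₁.1
  obtain ⟨U, hU, hF⟩ := h.eq₂
  obtain ⟨U', hU', hF'⟩ := h'.eq₂
  -- With equal zero modes, the zero-mode exponential and the scaling are the same injective
  -- operators on both sides and can be cancelled.
  have hU1 : U.1 = U'.1 := by
    have g := goodVF_zeroOp (hs 0).neg (by rw [map_neg, isEvenSer_iff.1 (h.even 0).2])
      h.ord_zero_mode.neg
    have i := isExp_zeroOp (hs 0).neg (by rw [map_neg, isEvenSer_iff.1 (h.even 0).2])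
      h.ord_zero_mode.neg
    rw [← hz] at hF'
    have e := (hF.1.unique (i _)).symm.trans (hF'.1.unique (i _))
    exact scale_injective _ (evf_injective g e)
  have h1 := hU'.1
  rw [← hU1] at h1
  have hpos := exp_coords_unique (σ := -1) (κ := fun j => ((j : ℕ) : ℤ) + 1)
    (κ' := fun j => ((j : ℕ) : ℤ)) (fun j => by ring) (fun j => by ring)
    (fun j => (hs _).neg) (fun j => (hs' _).neg) (fun j => (ho _).neg) (fun j => (ho' _).neg)
    (neg_psiPos_eq hs) (neg_psiPos_eq hs') hU.1 h1
  have ev : Ψ.even = Ψ'.even := funext fun j => by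
    rcases lt_trichotomy j 0 with hj | rfl | hj
    · have := congrFun hneg.1 ⟨(-j).toNat, by omega⟩
      simp only [PNat.mk_coe] at this
      rwa [show -(((-j).toNat : ℕ) : ℤ) = j by omega] at this
    · exact hz
    · have := congrFun hpos.1 ⟨j.toNat, by omega⟩
      simp only [PNat.mk_coe] at this
      rw [show ((j.toNat : ℕ) : ℤ) = j by omega] at this
      exact neg_injective this
  have od : Ψ.odd = Ψ'.odd := funext fun j => by
    rcases lt_or_ge j 1 with hj | hj
    · have := congrFun hneg.2 ⟨(1 - j).toNat, by omega⟩
      simp only [PNat.mk_coe] at this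
      rwa [show 1 - (((1 - j).toNat : ℕ) : ℤ) = j by omega] at this
    · have := congrFun hpos.2 ⟨j.toNat, by omega⟩
      simp only [PNat.mk_coe] at this
      rw [show ((j.toNat : ℕ) : ℤ) = j by omega] at this
      exact neg_injective this
  cases Ψ
  cases Ψ'
  simp only at ev od
  rw [ev, od]

/-! ### Elements of the algebra of formal sums of endomorphisms -/

/-- The inclusion of `ℂ[x, x⁻¹]` in `ℂ[α₀^{1/2}, α₀^{-1/2}][x, x⁻¹]`. -/
def embX (p : LaurentPolynomial ℂ) : XRing :=
  p.coeff.sum fun k c => AddMonoidAlgebra.single k (LaurentPolynomial.C c)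

theorem coeff_embX (p : LaurentPolynomial ℂ) (k : ℤ) :
    (embX p).coeff k = LaurentPolynomial.C (p.coeff k) := by
  unfold embX
  rw [AddMonoidAlgebra.coeff_finsuppSum, Finsupp.sum_apply, Finsupp.sum, sum_eq_single k]
  · rw [AddMonoidAlgebra.coeff_single, Finsupp.single_eq_same]
  · intro b _ hb
    rw [AddMonoidAlgebra.coeff_single, Finsupp.single_apply, if_neg hb]
  · intro h
    simp [Finsupp.notMem_support_iff.1 h]

theorem embX_add (p q : LaurentPolynomial ℂ) : embX (p + q) = embX p + embX q :=
  LaurentPolynomial.ext fun k => by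
    rw [coeff_embX, AddMonoidAlgebra.coeff_add, Finsupp.add_apply, map_add,
      AddMonoidAlgebra.coeff_add, Finsupp.add_apply, coeff_embX, coeff_embX]

theorem embX_smul (c : ℂ) (p : LaurentPolynomial ℂ) : embX (c • p) = c • embX p :=
  LaurentPolynomial.ext fun k => by
    rw [coeff_embX, AddMonoidAlgebra.coeff_smul_apply, AddMonoidAlgebra.coeff_smul_apply, coeff_embX,
      smul_eq_mul, map_mul, ← LaurentPolynomial.smul_eq_C_mul]

theorem embX_zero : embX 0 = 0 := LaurentPolynomial.ext fun k => by
  rw [coeff_embX]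
  exact map_zero _

theorem ofV_eq (v : VSpace) : ofV v = ofX (embX (v 0)) + phi * ofX (embX (v 1)) := by
  have : ofV v = phi ^ (0 : ZMod 2).val * ofX (embX (v 0)) +
    phi ^ (1 : ZMod 2).val * ofX (embX (v 1)) := Fin.sum_univ_two _
  rw [this, ZMod.val_zero, ZMod.val_one, pow_zero, one_mul, pow_one]

theorem ofX_smul (c : ℂ) (p : XRing) : ofX (c • p) = c • ofX p := ser_ext fun s e => by
  rw [cf_smul, cf_ofX, cf_ofX]
  split_ifs
  · rfl
  · rw [smul_zero]

/-- `ofV` as a linear map. -/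
def ofVL : VSpace →ₗ[ℂ] Ser where
  toFun := ofV
  map_add' u v := by
    rw [ofV_eq, ofV_eq, ofV_eq, Pi.add_apply, Pi.add_apply, embX_add, embX_add, ofX_add, ofX_add,
      mul_add]
    abel
  map_smul' c u := by
    rw [ofV_eq, ofV_eq, Pi.smul_apply, Pi.smul_apply, embX_smul, embX_smul, ofX_smul, ofX_smul,
      mul_smul_comm, ← smul_add]
    rfl

theorem ofX_zero : ofX 0 = 0 := ser_ext fun s e => by rw [cf_ofX, ite_self]; rfl

theorem par_ofV_zero (p : LaurentPolynomial ℂ) : par (ofV (Pi.single 0 p)) = ofV (Pi.single 0 p) := by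
  rw [ofV_eq, Pi.single_eq_same, Pi.single_eq_of_ne one_ne_zero, embX_zero, ofX_zero, mul_zero,
    add_zero, par_ofX]

theorem par_ofV_one (p : LaurentPolynomial ℂ) : par (ofV (Pi.single 1 p)) = -ofV (Pi.single 1 p) := by
  rw [ofV_eq, Pi.single_eq_same, Pi.single_eq_of_ne zero_ne_one, embX_zero, ofX_zero, zero_add,
    par_mul, par_ofX, par_phi, neg_mul]

theorem zmod_two_eq : ∀ i : ZMod 2, i = 0 ∨ i = 1 := by decide

theorem zmod_two_add : ∀ c j i : ZMod 2, c + j = i → j = i + c := by decide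

theorem card_withPhi (i : ZMod 2) (s : Finset OddVar) :
    ((withPhi i s).card : ZMod 2) = (s.card : ZMod 2) + i := by
  unfold withPhi
  split_ifs with h
  · rw [h, card_map, add_zero]
  · have hb : ⊥ ∉ s.map oddEmb := fun hb => by
      obtain ⟨r, _, hr⟩ := mem_map.1 hb
      exact bot_ne_oddEmb r hr.symm
    have hi : i = 1 := (zmod_two_eq i).resolve_left h
    rw [card_insert_of_notMem hb, card_map, hi]
    push_cast
    rfl

/-- The coefficients of `(α₀^{1/2})^l`. -/
def alphaCoeff (l : ℤ) : XRing →ₗ[ℂ] LaurentPolynomial ℂ where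
  toFun q := AddMonoidAlgebra.ofCoeff (q.coeff.mapRange (fun c : AlphaRing => c.coeff l) rfl)
  map_add' _ _ := LaurentPolynomial.ext fun _ => rfl
  map_smul' _ _ := LaurentPolynomial.ext fun _ => rfl

/-- The monomials dividing a given one have `α₀^{1/2}`-degree at most `w` in absolute value. -/
def AlphaLe (S : Finset OddVarPhi) (e : EvenVar →₀ ℕ) (w : ℤ) (t : Finset OddVarPhi)
    (a : EvenVar →₀ ℕ) (_ l : ℤ) : Prop := t ⊆ insert ⊥ S → a ≤ e → |l| ≤ w

theorem suppFam_alphaLe (S : Finset OddVarPhi) (e : EvenVar →₀ ℕ) : SuppFam 0 (AlphaLe S e) where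
  mul {w w' t t' a a' i i' j j'} _ h h' hs he :=
    (abs_add_le j j').trans (add_le_add (h (subset_union_left.trans hs) (le_self_add.trans he))
      (h' (subset_union_right.trans hs) (le_add_self.trans he)))
  index_dx h hs he := by simpa using h hs he
  index_dphi {w s a k l} _ h := by
    intro hs he
    have := h (insert_subset (mem_insert_self _ _) hs) he
    simpa using this
  index_phi _ _ := by simp

theorem exists_alphaLe (S : Finset OddVarPhi) (e : EvenVar →₀ ℕ) (u : Ser) :
    ∃ w : ℕ, Supp (AlphaLe S e w) u := by
  refine ⟨∑ t ∈ (insert ⊥ S).powerset, ∑ a ∈ Iic e, ∑ k ∈ (cf u t a).coeff.support,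
    ∑ l ∈ ((cf u t a).coeff k).coeff.support, l.natAbs, fun t a k l h ht ha => ?_⟩
  rw [Int.abs_eq_natAbs]
  refine Int.ofNat_le.2 ?_
  have hl : l ∈ ((cf u t a).coeff k).coeff.support := Finsupp.mem_support_iff.2 h
  have hk : k ∈ (cf u t a).coeff.support := Finsupp.mem_support_iff.2 fun h0 => h (by
    unfold coef₂
    rw [coeff₂_apply, h0]; rfl)
  refine (single_le_sum (f := Int.natAbs) (fun _ _ => Nat.zero_le _) hl).trans ?_
  refine (single_le_sum (f := fun k => ∑ l ∈ ((cf u t a).coeff k).coeff.support, l.natAbs)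
    (fun _ _ => Nat.zero_le _) hk).trans ?_
  refine (single_le_sum (f := fun a => ∑ k ∈ (cf u t a).coeff.support,
    ∑ l ∈ ((cf u t a).coeff k).coeff.support, l.natAbs)
    (fun _ _ => Nat.zero_le _) (mem_Iic.2 ha)).trans ?_
  exact single_le_sum (f := fun t => ∑ a ∈ Iic e, ∑ k ∈ (cf u t a).coeff.support,
    ∑ l ∈ ((cf u t a).coeff k).coeff.support, l.natAbs)
    (fun _ _ => Nat.zero_le _) (mem_powerset.2 ht)

theorem supp_ofX_embX (S : Finset OddVarPhi) (e : EvenVar →₀ ℕ) (p : LaurentPolynomial ℂ) :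
    Supp (AlphaLe S e 0) (ofX (embX p)) := fun t a k l h _ _ => by
  unfold coef₂ at h
  rw [cf_ofX] at h
  split_ifs at h
  · rw [coeff₂_apply, coeff_embX, LaurentPolynomial.C_apply] at h
    split_ifs at h with hl
    · rw [hl, abs_zero]
    · exact absurd rfl h
  · exact absurd (map_zero _) h

theorem supp_ofV (S : Finset OddVarPhi) (e : EvenVar →₀ ℕ) (v : VSpace) :
    Supp (AlphaLe S e 0) (ofV v) := by
  rw [ofV_eq]
  exact (supp_ofX_embX S e _).add
    ((suppFam_alphaLe S e).supp_mul (suppFam_alphaLe S e).supp_phi (supp_ofX_embX S e _))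

/-- The argument `ofV v` contains no α₀^{1/2}, and at a fixed monomial at most `deg S e` factors
from the field occur, each of bounded exponent. The bound is independent of `v`, as is necessary for
the coefficients to be Laurent polynomials in α₀^{1/2} over endomorphisms. -/
theorem exists_alpha_bound (a b : Ser) (S : Finset OddVarPhi) (e : EvenVar →₀ ℕ) :
    ∃ N : ℕ, ∀ v k l, coef₂ (evf a b (ofV v)) S e k l ≠ 0 → |l| ≤ N := by
  obtain ⟨w, hw⟩ := exists_alphaLe S e a
  obtain ⟨w', hw'⟩ := exists_alphaLe S e b
  have hm : ∀ {u : Ser} {w : ℕ} {W : ℤ}, (w : ℤ) ≤ W → Supp (AlphaLe S e w) u →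
      Supp (AlphaLe S e W) u := fun h hu => hu.mono fun t a k l h1 ht ha => (h1 ht ha).trans h
  refine ⟨deg S e * (w + w'), fun v k l h => ?_⟩
  obtain ⟨n, hn, h1⟩ := (suppFam_alphaLe S e).exists_of_evf (c := w + w')
    (hm (by omega) hw) (hm (by omega) hw') (supp_ofV S e v) S e k l h
  refine (h1 (subset_insert _ _) le_rfl).trans ?_
  push_cast
  rw [zero_add]
  exact mul_le_mul_of_nonneg_right (by exact_mod_cast hn) (by positivity)

/-- The coefficient of a monomial in an operator, as an endomorphism of `ℂ[x, x⁻¹, φ]`. -/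
def coeffEnd (E : Ser →ₗ[ℂ] Ser) (s : Finset OddVar) (e : EvenVar →₀ ℕ) (l : ℤ) :
    Module.End ℂ VSpace :=
  LinearMap.pi fun i => (-1 : ℂ) ^ (s.card * i.val) •
    (alphaCoeff l ∘ₗ cfL (withPhi i s) e ∘ₗ E ∘ₗ ofVL)

theorem coeff_coeffEnd (E : Ser →ₗ[ℂ] Ser) (s : Finset OddVar) (e : EvenVar →₀ ℕ) (l : ℤ)
    (v : VSpace) (i : ZMod 2) (k : ℤ) : (coeffEnd E s e l v i).coeff k =
      (-1) ^ (s.card * i.val) * coef₂ (E (ofV v)) (withPhi i s) e k l := rfl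

theorem isEnvelopeOp_evf {a b : Ser} (h : GoodVF a b) : IsEnvelopeOp (evf a b) where
  map_add := map_add _
  map_scalar_mul r u hr := by rw [(scHom_evf h).mul, (scHom_evf h).scalar r hr]
  continuous u s e hu k := by
    rw [coef_eq, (scHom_evf h).loc u s e fun t a ht ha =>
      LaurentPolynomial.ext fun k => hu t a ht ha k]
    rfl
  action := by
    have hN : ∀ s e, ∃ N : ℕ, ∀ i v k l,
        coef₂ (evf a b (ofV v)) (withPhi i s) e k l ≠ 0 → |l| ≤ N := by
      intro s e
      obtain ⟨N₀, h₀⟩ := exists_alpha_bound a b (withPhi 0 s) e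
      obtain ⟨N₁, h₁⟩ := exists_alpha_bound a b (withPhi 1 s) e
      refine ⟨N₀ + N₁, fun i v k l hc => ?_⟩
      have hi := zmod_two_eq i
      push_cast
      rcases hi with rfl | rfl
      · exact (h₀ v k l hc).trans (by omega)
      · exact (h₁ v k l hc).trans (by omega)
    choose N hN using hN
    -- Outside the window given by the uniform bound all coefficient endomorphisms vanish, so the
    -- finite sum has the right coefficient for every `l`.
    have hθ : ∀ s e l, (∑ l ∈ Icc (-(N s e : ℤ)) (N s e),
        AddMonoidAlgebra.single l (coeffEnd (evf a b) s e l) :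
          LaurentPolynomial (Module.End ℂ VSpace)).coeff l = coeffEnd (evf a b) s e l := by
      intro s e l
      rw [AddMonoidAlgebra.coeff_sum, Finsupp.finsetSum_apply]
      simp only [AddMonoidAlgebra.coeff_single, Finsupp.single_apply]
      rw [sum_ite_eq' (Icc (-(N s e : ℤ)) (N s e)) l]
      split_ifs with hl
      · rfl
      · refine (LinearMap.ext fun v => funext fun i => LaurentPolynomial.ext fun k => ?_).symm
        rw [coeff_coeffEnd]
        have : coef₂ (evf a b (ofV v)) (withPhi i s) e k l = 0 := by
          by_contra hc
          exact hl (mem_Icc.2 (abs_le.1 (hN s e i v k l hc)))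
        rw [this, mul_zero]
        rfl
    refine ⟨fun s e => ∑ l ∈ Icc (-(N s e : ℤ)) (N s e),
      AddMonoidAlgebra.single l (coeffEnd (evf a b) s e l), ?_, ?_⟩
    · intro s e l i j p hne
      rw [hθ] at hne
      have hc : evf a b (ofV (Pi.single i p)) (withPhi j s) ≠ 0 := fun h0 => hne <| by
        refine LaurentPolynomial.ext fun k => ?_
        rw [coeff_coeffEnd]
        have : cf (evf a b (ofV (Pi.single i p))) (withPhi j s) e = 0 := by
          unfold cf
          rw [h0, map_zero]
        unfold coef₂
        rw [this, map_zero, mul_zero]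
        rfl
      have hcard : ((withPhi j s).card : ZMod 2) = i := by
        have hi := zmod_two_eq i
        rcases hi with rfl | rfl
        · have : IsEvenSer (evf a b (ofV (Pi.single 0 p))) := isEvenSer_iff.2 (by
            rw [(scHom_evf h).par, par_ofV_zero])
          exact (ZMod.natCast_eq_zero_iff_even).2 (this _ hc)
        · have : IsOddSer (evf a b (ofV (Pi.single 1 p))) := isOddSer_iff.2 (by
            rw [(scHom_evf h).par, par_ofV_one, map_neg])
          exact (ZMod.natCast_eq_one_iff_odd).2 (this _ hc)
      rw [card_withPhi] at hcard
      exact zmod_two_add _ _ _ hcard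
    · intro v s e i k l
      rw [hθ, coeff_coeffEnd, ← mul_assoc, ← mul_pow]
      simp
      rfl

end

end NSNormalOrder

/-! ### Transfer of the constructed factorization to arbitrary solutions by uniqueness. -/

theorem mainTheorem3 :
    (∃! F : (Ser × Ser) × (Ser × Ser), IsSewingSolution F) ∧
    ∀ F : (Ser × Ser) × (Ser × Ser), IsSewingSolution F →
      (∃! Ψ : PsiSeq, IsPsi F Ψ) ∧
      ∀ Ψ : PsiSeq, IsPsi F Ψ →
        (∀ j : ℕ+,
          IsMixed (Ψ.even (j : ℕ) + varA j) ∧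
          IsMixed (Ψ.odd (j : ℕ) + varM j) ∧
          IsMixed (Ψ.even (-((j : ℕ) : ℤ)) + alpha (-2 * (j : ℕ)) * varB j) ∧
          IsMixed (Ψ.odd (1 - (j : ℕ)) + alpha (-2 * (j : ℕ) + 1) * varN j)) ∧
        IsMixed (Ψ.even 0) ∧
        ∃ EA EB Eneg Epos E0 : Ser → Ser,
          IsExp (posOp (fun j => -varA j) (fun j => -varM j)) EA ∧
          IsExp (negOp (fun j => -varB j) (fun j => -varN j)) EB ∧
          IsExp (psiNeg Ψ) Eneg ∧
          IsExp (psiPos Ψ) Epos ∧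
          IsExp (zeroOp (Ψ.even 0)) E0 ∧
          IsEnvelopeOp EA ∧ IsEnvelopeOp EB ∧
          IsEnvelopeOp Eneg ∧ IsEnvelopeOp Epos ∧ IsEnvelopeOp E0 ∧
          EA ∘ scale 1 ∘ EB = Eneg ∘ Epos ∘ scale 1 ∘ E0 := by
  refine ⟨⟨facF, isSewingSolution_facF, fun F hF => hF.unique isSewingSolution_facF⟩, fun F hF => ?_⟩
  obtain rfl : F = facF := hF.unique isSewingSolution_facF
  refine ⟨⟨facPsi, isPsi_facPsi, fun Ψ hΨ => hΨ.unique isPsi_facPsi⟩, fun Ψ hΨ => ?_⟩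
  obtain rfl : Ψ = facPsi := hΨ.unique isPsi_facPsi
  have g := goodVF_fac
  refine ⟨isMixed_facPsi, isMixed_facPsi_zero, evf serA serM, evf serB serN,
    negExp facEven facOdd, posExp facEven facOdd, zeroExp facEven, isExp_AM, isExp_BN,
    isExp_psiNeg g, isExp_psiPos g, isExp_psiZero g, isEnvelopeOp_evf goodVF_AM,
    isEnvelopeOp_evf goodVF_BN, isEnvelopeOp_evf (g.xproj _ _), isEnvelopeOp_evf (g.xproj _ _),
    isEnvelopeOp_evf (g.xproj _ fun k => k = 1).zero_right, funext fun u => ?_⟩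
  exact (sewOp_apply u).symm.trans ((congrArg (fun E => E u) sewOp_eq_facOp).trans (facOp_apply _ _ u))
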